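/- Let $K\subset\mathbb{C}$ be an imaginary quadratic field, $\mathcal{O}$ an order in $K$ and $N$ a positive integer. A nonzero ideal $\mathfrak{a}$ of $\mathcal{O}$ is proper if $\{x\in K: x\mathfrak{a}\subseteq\mathfrak{a}\}=\mathcal{O}$, and prime to $N$ if $\mathfrak{a}+N\mathcal{O}=\mathcal{O}$; write $\mathcal{M}(\mathcal{O},N)$ for the set of nonzero proper ideals of $\mathcal{O}$ prime to $N$, and $\mathrm{N}_{\mathcal{O}}(\mathfrak{a})=|\mathcal{O}/\mathfrak{a}|$. Let $\mathcal{C}_N(\mathcal{O})=I(\mathcal{O},N)/P_N(\mathcal{O})$, where $I(\mathcal{O},N)$ is the group of fractional ideals generated by $\mathcal{M}(\mathcal{O},N)$ and $P_N(\mathcal{O})$ is the subgroup generated by the principal ideals $\nu\mathcal{O}$ with $0\ne\nu\in\mathcal{O}$, $\nu\equiv1\pmod{N\mathcal{O}}$; this is a finite abelian group. Put $\gamma_{\mathcal{O},N}=|\{\nu\in\mathcal{O}^*:\nu\equiv1\pmod{N\mathcal{O}}\}|$. For $C\in\mathcal{C}_N(\mathcal{O})$ choose $\mathfrak{c}\in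 C\cap\mathcal{M}(\mathcal{O},N)$ and a $\mathbb{Z}$-basis $\{\xi_1,\xi_2\}$ of $\mathfrak{c}^{-1}$ such that $\xi=\xi_1/\xi_2$ lies in the upper half-plane $\mathbb{H}$. If $N=1$, let $$g_{\mathcal{O},1}(C)=(2\pi)^{12}\,\mathrm{N}_{\mathcal{O}}(\mathfrak{c})^{-6}\,|\Delta(\mathfrak{c}^{-1})|,\qquad \Delta(\mathfrak{c}^{-1})=\xi_2^{-12}\,\eta(\xi)^{24},\qquad \eta(\tau)=e^{\pi i\tau/12}\prod_{n\ge1}(1-e^{2\pi in\tau}).$$ If $N\ge2$, let $\tau_{\mathcal{O}}=\sqrt{D}/2$ or $(-1+\sqrt{D})/2$ according as the discriminant $D$ of $\mathcal{O}$ is $\equiv0$ or $1\pmod 4$ (with $\sqrt D\in\mathbb{H}$), so that $\mathcal{O}=\mathbb{Z}\tau_{\mathcal{O}}+\mathbb{Z}$, let $A$ be the integral matrix with $\begin{bmatrix}\tau_{\mathcal{O}}\\1\end{bmatrix}=A\begin{bmatrix}\xi_1\\\xi_2\end{bmatrix}$, whose determinant is prime to $N$, and let $$g_{\mathcal{O},N}(C)=f^{A}(\xi),\qquad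 f=g_{[0\ \frac1N]}^{12N}.$$ Here, for $v=[v_1\ v_2]\in\mathbb{Q}^2\setminus\mathbb{Z}^2$, $g_v$ is the Siegel function $$g_v(\tau)=-q^{\frac12(v_1^2-v_1+\frac16)}e^{\pi iv_2(v_1-1)}(1-q_z)\prod_{n\ge1}(1-q^nq_z)(1-q^nq_z^{-1}),\quad q=e^{2\pi i\tau},\ z=v_1\tau+v_2,\ q_z=e^{2\pi iz},$$ and $f\mapsto f^A$ is the usual action of $\mathrm{GL}_2(\mathbb{Z}/N\mathbb{Z})/\langle-I_2\rangle$ on modular functions of level $N$ with Fourier coefficients in $\mathbb{Q}(\zeta_N)$, $\zeta_N=e^{2\pi i/N}$: if $A\equiv\begin{bmatrix}1&0\\0&d\end{bmatrix}\gamma\pmod N$ with $\gamma\in\mathrm{SL}_2(\mathbb{Z})$, then $f^A$ is obtained by applying $\zeta_N\mapsto\zeta_N^d$ to the Fourier coefficients of $f$ and then composing with $\gamma$. The value $g_{\mathcal{O},N}(C)$ does not depend on the choices. Let $\chi$ be a character of $\mathcal{C}_N(\mathcal{O})$. Then the series $$L_{\mathcal{O}}(s,\chi)=\sum_{\mathfrak{a}\in\mathcal{M}(\mathcal{O},N)}\frac{\chi([\mathfrak{a}])}{\mathrm{N}_{\mathcal{O}}(\mathfrak{a})^{s}}$$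 converges absolutely for $\mathrm{Re}(s)>1$ and continues analytically to $\mathbb{C}\setminus\{1\}$, and the continuation satisfies $$L_{\mathcal{O}}'(0,\chi)=-\frac{1}{6N\,\gamma_{\mathcal{O},N}}\sum_{C\in\mathcal{C}_N(\mathcal{O})}\chi(C)\,\ln|g_{\mathcal{O},N}(C)|.$$ -/

import Mathlib

open scoped nonZeroDivisors MatrixGroups

noncomputable section

namespace QuadraticOrder

/-! ### Proper ideals of an order in a quadratic field

An order in a number field `K` is a subring `O` which is finitely generated as a `ℤ`-module and
whose field of fractions is `K`. -/

section Ideals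

variable {K : Type*} [Field K]

/-- An ideal `𝔞` of `O` is proper if `{x ∈ K : x𝔞 ⊆ 𝔞} = O` (the inclusion `⊇` is automatic). -/
def IsProper (O : Subring K) (𝔞 : Ideal O) : Prop :=
  ∀ x : K, (∀ y ∈ 𝔞, ∃ z ∈ 𝔞, (z : K) = x * y) → x ∈ O

/-- The set `M(O, N)` of nonzero proper `O`-ideals prime to `N`. -/
def properIdeals (O : Subring K) (N : ℕ) : Set (Ideal O) :=
  {𝔞 | 𝔞 ≠ ⊥ ∧ IsProper O 𝔞 ∧ 𝔞 ⊔ Ideal.span {(N : O)} = ⊤}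

/-- The norm `|O / 𝔞|`. -/
def idealNorm (O : Subring K) (𝔞 : Ideal O) : ℕ := Nat.card (O ⧸ 𝔞)

/-- The number of units `ν` of `O` with `ν ≡ 1 mod NO`. -/
def unitCount (O : Subring K) (N : ℕ) : ℕ :=
  Nat.card {ν : Oˣ // (ν : O) - 1 ∈ Ideal.span {(N : O)}}

/-- A conjugation on a quadratic field: traces and norms are rational. -/
theorem exists_conj (K : Type*) [Field K] [NumberField K] [Algebra.IsQuadraticExtension ℚ K] :
    ∃ σ : K ≃ₐ[ℚ] K, ∀ x : K,
      (∃ q : ℚ, x + σ x = algebraMap ℚ K q) ∧ (∃ q : ℚ, x * σ x = algebraMap ℚ K q) ∧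
        σ (σ x) = x := by
  have hcard : Nat.card (K ≃ₐ[ℚ] K) = 2 := by
    rw [IsGalois.card_aut_eq_finrank, Algebra.IsQuadraticExtension.finrank_eq_two]
  obtain ⟨a, b, hab, huniv⟩ := Nat.card_eq_two_iff.1 hcard
  obtain ⟨σ, hσ⟩ : ∃ σ : K ≃ₐ[ℚ] K, σ ≠ 1 := by
    by_cases h : a = 1
    · exact ⟨b, fun hb => hab (h.trans hb.symm)⟩
    · exact ⟨a, h⟩
  have hall : ∀ τ : K ≃ₐ[ℚ] K, τ = 1 ∨ τ = σ := by
    have hm : ∀ τ : K ≃ₐ[ℚ] K, τ = a ∨ τ = b := fun τ => by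
      have : τ ∈ ({a, b} : Set (K ≃ₐ[ℚ] K)) := huniv ▸ Set.mem_univ τ
      simpa using this
    intro τ
    rcases hm τ with h | h <;> rcases hm σ with h' | h' <;> rcases hm 1 with h'' | h'' <;>
      simp_all
  have hinv : ∀ x, σ (σ x) = x := by
    intro x
    have : σ * σ = 1 := by
      rcases hall (σ * σ) with h | h
      · exact h
      · exact absurd (mul_eq_left.1 h) hσ
    exact DFunLike.congr_fun this x
  refine ⟨σ, fun x => ⟨?_, ?_, hinv x⟩⟩
  · have : x + σ x ∈ (⊥ : IntermediateField ℚ K) := by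
      rw [IsGalois.mem_bot_iff_fixed]
      intro τ
      rcases hall τ with rfl | rfl
      · rfl
      · rw [map_add, hinv, add_comm]
    obtain ⟨q, hq⟩ := IntermediateField.mem_bot.1 this
    exact ⟨q, hq.symm⟩
  · have : x * σ x ∈ (⊥ : IntermediateField ℚ K) := by
      rw [IsGalois.mem_bot_iff_fixed]
      intro τ
      rcases hall τ with rfl | rfl
      · rfl
      · rw [map_mul, hinv, mul_comm]
    obtain ⟨q, hq⟩ := IntermediateField.mem_bot.1 this
    exact ⟨q, hq.symm⟩

variable [NumberField K] [Algebra.IsQuadraticExtension ℚ K]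

/-- An ideal of an order in a quadratic field is generated by two elements over `ℤ`. -/
theorem exists_two_generators (O : Subring K) [Module.Finite ℤ O] (𝔞 : Ideal O) :
    ∃ α ∈ 𝔞, ∃ β ∈ 𝔞, ∀ y ∈ 𝔞, ∃ m n : ℤ, y = m • α + n • β := by
  let M : Submodule ℤ O := 𝔞.restrictScalars ℤ
  have : Module.Free ℤ M := inferInstance
  let b := Module.finBasis ℤ M
  have hle : Module.finrank ℤ M ≤ 2 := by
    have h1 : LinearIndependent ℤ (fun i => ((b i : O) : K)) := by
      let f : M →ₗ[ℤ] K := (O.subtype.toAddMonoidHom.toIntLinearMap).comp M.subtype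
      have hf : Function.Injective f := by
        intro x y hxy
        exact Subtype.ext (Subtype.ext hxy)
      exact b.linearIndependent.map' f (LinearMap.ker_eq_bot.2 hf)
    have h2 := (LinearIndependent.iff_fractionRing ℤ ℚ).1 h1
    have h3 := h2.fintype_card_le_finrank
    rwa [Fintype.card_fin, Algebra.IsQuadraticExtension.finrank_eq_two] at h3
  let v : ℕ → M := fun i => if h : i < Module.finrank ℤ M then b ⟨i, h⟩ else 0
  refine ⟨v 0, (v 0).2, v 1, (v 1).2, fun y hy => ?_⟩
  have hs := b.sum_repr ⟨y, hy⟩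
  let c : ℕ → ℤ := fun i => if h : i < Module.finrank ℤ M then b.repr ⟨y, hy⟩ ⟨i, h⟩ else 0
  have hs2 : ∑ i ∈ Finset.range (Module.finrank ℤ M), c i • v i = ⟨y, hy⟩ := by
    rw [← hs, ← Fin.sum_univ_eq_sum_range (fun i => c i • v i)]
    refine Finset.sum_congr rfl fun i _ => ?_
    simp [c, v]
  have hs3 : ∑ i ∈ Finset.range 2, c i • v i = ⟨y, hy⟩ := by
    rw [← hs2]
    symm
    refine Finset.sum_subset (Finset.range_mono hle) fun i _ hi => ?_
    have : ¬ i < Module.finrank ℤ M := by simpa using hi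
    simp [v, this]
  refine ⟨c 0, c 1, ?_⟩
  have := congrArg (fun z : M => (z : O)) hs3
  simpa [Finset.sum_range_succ] using this.symm

theorem exists_int_of_rat {K : Type*} [Field K] [NumberField K] {x : K} (hx : IsIntegral ℤ x)
    (q : ℚ) (h : x = algebraMap ℚ K q) : ∃ m : ℤ, x = m := by
  have : IsIntegral ℤ q := by
    rw [h] at hx
    exact (isIntegral_algebraMap_iff (algebraMap ℚ K).injective).1 hx
  obtain ⟨m, hm⟩ := IsIntegrallyClosed.isIntegral_iff.1 this
  exact ⟨m, by rw [h, ← hm]; simp⟩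

/-- In an order of a quadratic field every nonzero proper ideal is invertible. -/
theorem isUnit_of_isProper (O : Subring K) [Module.Finite ℤ O] [IsFractionRing O K]
    {𝔞 : Ideal O} (h0 : 𝔞 ≠ ⊥) (hp : IsProper O 𝔞) :
    IsUnit (𝔞 : FractionalIdeal O⁰ K) := by
  obtain ⟨α, hα, β, hβ, hgen⟩ := exists_two_generators O 𝔞
  obtain ⟨σ, hσ⟩ := exists_conj K
  have hint : ∀ x : O, IsIntegral ℤ (x : K) := fun x =>
    (Algebra.IsIntegral.isIntegral (R := ℤ) x).map (O.subtype.toIntAlgHom)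
  have hints : ∀ x : O, IsIntegral ℤ (σ (x : K)) := fun x =>
    (hint x).map ((σ : K →+* K).toIntAlgHom)
  obtain ⟨u, hu⟩ : ∃ m : ℤ, (α : K) * σ α = m := by
    obtain ⟨q, hq⟩ := (hσ α).2.1
    exact exists_int_of_rat ((hint α).mul (hints α)) q hq
  obtain ⟨w, hw⟩ : ∃ m : ℤ, (β : K) * σ β = m := by
    obtain ⟨q, hq⟩ := (hσ β).2.1
    exact exists_int_of_rat ((hint β).mul (hints β)) q hq
  obtain ⟨t, ht⟩ : ∃ m : ℤ, (α : K) * σ β + β * σ α = m := by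
    obtain ⟨q, hq⟩ := (hσ (α * σ β)).1
    rw [map_mul, (hσ β).2.2] at hq
    refine exists_int_of_rat
      (((hint α).mul (hints β)).add ((hint β).mul (hints α))) q ?_
    rw [← hq]; ring
  let I : Ideal ℤ := Ideal.span {u, t, w}
  obtain ⟨n, hn⟩ : ∃ n : ℤ, I = Ideal.span {n} := (IsPrincipalIdealRing.principal I).1
  have hdvd : ∀ x ∈ I, ∃ y, x = n * y := fun x hx => by
    rw [hn, Ideal.mem_span_singleton] at hx; exact hx
  obtain ⟨u', hu'⟩ := hdvd u (Ideal.subset_span (by simp))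
  obtain ⟨t', ht'⟩ := hdvd t (Ideal.subset_span (by simp))
  obtain ⟨w', hw'⟩ := hdvd w (Ideal.subset_span (by simp))
  obtain ⟨r, s, p, hbez⟩ : ∃ r s p : ℤ, n = r * u + s * t + p * w := by
    have : n ∈ I := by rw [hn]; exact Ideal.mem_span_singleton_self n
    obtain ⟨r, z, hz, h1⟩ := Ideal.mem_span_insert.1 this
    obtain ⟨s, z', hz', h2⟩ := Ideal.mem_span_insert.1 hz
    obtain ⟨p, h3⟩ := Ideal.mem_span_singleton'.1 hz'
    exact ⟨r, s, p, by rw [h1, h2, ← h3]; ring⟩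
  have hc : ∀ x : O, algebraMap O K x = x := fun _ => rfl
  have hn0 : n ≠ 0 := by
    rintro rfl
    have hu0 : (α : K) = 0 := by
      have : (α : K) * σ α = 0 := by rw [hu, hu']; simp
      simpa using this
    have hw0 : (β : K) = 0 := by
      have : (β : K) * σ β = 0 := by rw [hw, hw']; simp
      simpa using this
    apply h0
    rw [eq_bot_iff]
    intro y hy
    obtain ⟨m, k, rfl⟩ := hgen y hy
    have e1 : α = 0 := Subtype.ext hu0
    have e2 : β = 0 := Subtype.ext hw0
    simp [e1, e2]
  have hnK : (n : K) ≠ 0 := by exact_mod_cast hn0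
  have hu2 : (α : K) * σ α / n = u' := by rw [hu, hu']; push_cast; field_simp
  have hw2 : (β : K) * σ β / n = w' := by rw [hw, hw']; push_cast; field_simp
  have ht2 : (α : K) * σ β / n + β * σ α / n = t' := by
    rw [← add_div, ht, ht']; push_cast; field_simp
  have hx : (α : K) * σ β / n ∈ O := by
    apply hp
    intro y hy
    obtain ⟨m, k, rfl⟩ := hgen y hy
    refine ⟨m • (t' • α - u' • β) + k • (w' • α), ?_, ?_⟩
    · exact add_mem (zsmul_mem (sub_mem (zsmul_mem hα _) (zsmul_mem hβ _)) _)
        (zsmul_mem (zsmul_mem hα _) _)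
    · push_cast [zsmul_eq_mul]
      rw [← ht2, ← hu2, ← hw2]
      ring
  have hx' : (β : K) * σ α / n ∈ O := by
    have : (β : K) * σ α / n = t' - (α : K) * σ β / n := by rw [← ht2]; ring
    rw [this]
    exact sub_mem (intCast_mem O t') hx
  let sp : K → FractionalIdeal O⁰ K := fun x => FractionalIdeal.spanSingleton O⁰ x
  have h𝔞 : (𝔞 : FractionalIdeal O⁰ K) = sp α + sp β := by
    apply le_antisymm
    · intro x hx
      obtain ⟨y, hy, rfl⟩ := (FractionalIdeal.mem_coeIdeal O⁰).1 hx
      obtain ⟨m, k, rfl⟩ := hgen y hy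
      refine (FractionalIdeal.mem_add _ _ _).2
        ⟨m • (α : K), ?_, k • (β : K), ?_, ?_⟩
      · exact (FractionalIdeal.mem_spanSingleton O⁰).2 ⟨(m : O), by simp [Algebra.smul_def]⟩
      · exact (FractionalIdeal.mem_spanSingleton O⁰).2 ⟨(k : O), by simp [Algebra.smul_def]⟩
      · simp [hc]
    · intro x hx
      obtain ⟨y, hy, z, hz, rfl⟩ := (FractionalIdeal.mem_add _ _ _).1 hx
      obtain ⟨a, rfl⟩ := (FractionalIdeal.mem_spanSingleton O⁰).1 hy
      obtain ⟨b, rfl⟩ := (FractionalIdeal.mem_spanSingleton O⁰).1 hz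
      refine (FractionalIdeal.mem_coeIdeal O⁰).2
        ⟨a * α + b * β, add_mem (𝔞.mul_mem_left _ hα) (𝔞.mul_mem_left _ hβ), ?_⟩
      simp [Algebra.smul_def, hc]
  refine IsUnit.of_mul_eq_one (sp (σ α / n) + sp (σ β / n)) ?_
  have hprod : (𝔞 : FractionalIdeal O⁰ K) * (sp (σ α / n) + sp (σ β / n)) =
      (sp (α * σ α / n) + sp (α * σ β / n)) + (sp (β * σ α / n) + sp (β * σ β / n)) := by
    rw [h𝔞, add_mul, mul_add, mul_add]
    simp only [sp, FractionalIdeal.spanSingleton_mul_spanSingleton, mul_div_assoc]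
  rw [hprod]
  have hone : ∀ x ∈ O, sp x ≤ 1 := fun x hx => by
    rw [FractionalIdeal.spanSingleton_le_iff_mem]
    exact (FractionalIdeal.mem_one_iff O⁰).2 ⟨⟨x, hx⟩, rfl⟩
  apply le_antisymm
  · rw [← FractionalIdeal.sup_eq_add, ← FractionalIdeal.sup_eq_add,
      ← FractionalIdeal.sup_eq_add]
    refine sup_le (sup_le (hone _ ?_) (hone _ hx)) (sup_le (hone _ hx') (hone _ ?_))
    · rw [hu2]; exact intCast_mem O u'
    · rw [hw2]; exact intCast_mem O w'
  · rw [← FractionalIdeal.spanSingleton_one, FractionalIdeal.spanSingleton_le_iff_mem]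
    have hm : ∀ (k : ℤ) (x : K), (k : K) * x ∈ sp x := fun k x =>
      (FractionalIdeal.mem_spanSingleton O⁰).2 ⟨(k : O), by simp [Algebra.smul_def]⟩
    refine (FractionalIdeal.mem_add _ _ _).2
      ⟨r * (α * σ α / n) + s * (α * σ β / n), (FractionalIdeal.mem_add _ _ _).2
        ⟨_, hm r _, _, hm s _, rfl⟩,
       s * (β * σ α / n) + p * (β * σ β / n), (FractionalIdeal.mem_add _ _ _).2
        ⟨_, hm s _, _, hm p _, rfl⟩, ?_⟩
    have hb : (n : K) = r * u + s * t + p * w := by exact_mod_cast hbez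
    field_simp
    rw [hb, ← hu, ← ht, ← hw]
    ring

variable (O : Subring K) [Module.Finite ℤ O] [IsFractionRing O K]

/-- A nonzero proper ideal as an element of the group of invertible fractional ideals
(for quadratic orders, the group `I(O)` of proper fractional ideals). -/
def toUnit {N : ℕ} (𝔞 : properIdeals O N) : (FractionalIdeal O⁰ K)ˣ :=
  (isUnit_of_isProper O 𝔞.2.1 𝔞.2.2.1).unit

/-- `I(O, N)`: the group generated by the nonzero proper `O`-ideals prime to `N`. -/
def idealGroup (N : ℕ) : Subgroup (FractionalIdeal O⁰ K)ˣ :=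
  Subgroup.closure (Set.range (toUnit O (N := N)))

/-- `P_N(O)`: the group generated by the principal ideals `νO` with `0 ≠ ν ∈ O`,
`ν ≡ 1 mod NO`. -/
def principalGroup (N : ℕ) : Subgroup (FractionalIdeal O⁰ K)ˣ :=
  Subgroup.closure {u | ∃ ν : O, ν ≠ 0 ∧ ν - 1 ∈ Ideal.span {(N : O)} ∧
    (u : FractionalIdeal O⁰ K) = (Ideal.span {ν} : Ideal O)}

/-- `C_N(O) = I(O, N) / P_N(O)`. -/
abbrev RayClassGroup (N : ℕ) : Type _ :=
  idealGroup O N ⧸ (principalGroup O N).subgroupOf (idealGroup O N)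

/-- The class in `C_N(O)` of a nonzero proper `O`-ideal prime to `N`. -/
def rayClass {N : ℕ} (𝔞 : properIdeals O N) : RayClassGroup O N :=
  QuotientGroup.mk ⟨toUnit O 𝔞, Subgroup.subset_closure ⟨𝔞, rfl⟩⟩

end Ideals

/-! ### Siegel functions and the action on Fourier coefficients -/

section Modular

open Complex UpperHalfPlane

/-- The Siegel function `g_v` for `v = [v₁ v₂]`, with `q = exp (2πiτ)`, `z = v₁ τ + v₂` and
`B₂(x) = x² - x + 1/6`. -/
def siegel (v₁ v₂ : ℚ) (τ : ℍ) : ℂ :=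
  let e : ℂ → ℂ := fun w => exp (2 * Real.pi * Complex.I * w)
  let z : ℂ := v₁ * (τ : ℂ) + v₂
  (-1) * e ((τ : ℂ) * ((v₁ : ℂ) ^ 2 - v₁ + 1 / 6) / 2) *
    exp (Real.pi * Complex.I * v₂ * (v₁ - 1)) * (1 - e z) *
    ∏' n : ℕ, ((1 - e ((n + 1) * τ + z)) * (1 - e ((n + 1) * τ - z)))

/-- `ζ_N = exp (2πi/N)`. -/
def zetaN (N : ℕ) : ℂ := exp (2 * Real.pi * Complex.I / N)

/-- The cyclotomic field `ℚ(ζ_N)` inside `ℂ`. -/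
abbrev cyclotomic (N : ℕ) : IntermediateField ℚ ℂ := IntermediateField.adjoin ℚ {zetaN N}

/-- `ζ_N` as an element of `ℚ(ζ_N)`. -/
def zetaN' (N : ℕ) : cyclotomic N :=
  ⟨zetaN N, IntermediateField.subset_adjoin ℚ {zetaN N} rfl⟩

/-- `c` is the sequence of Fourier coefficients of `f`: one has `f(τ) = ∑ c(n) exp (2πinτ/N)` on
the upper half-plane, with only finitely many nonzero coefficients of negative index. -/
def HasFourierExpansion (N : ℕ) (f : ℍ → ℂ) (c : ℤ → ℂ) : Prop :=
  (∃ m : ℤ, ∀ n < m, c n = 0) ∧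
    ∀ τ : ℍ, HasSum (fun n : ℤ => c n * exp (2 * Real.pi * Complex.I * n * τ / N)) (f τ)

/-- The (right) action of the integral matrices of determinant prime to `N` on modular functions
of level `N` which are holomorphic on the upper half-plane and have Fourier coefficients in
`ℚ(ζ_N)`, that is, of `Gal(F_N/F_1) ≃ GL₂(ℤ/Nℤ)/⟨-I₂⟩`: a matrix congruent modulo `N` to
`diag(1, d) γ` with `γ ∈ SL₂(ℤ)` acts by applying `ζ_N ↦ ζ_N ^ d` to the Fourier coefficients
and then composing with `γ`. `IsConjugate N A f h` says that `h = f ^ A`. -/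
def IsConjugate (N : ℕ) (A : Matrix (Fin 2) (Fin 2) ℤ) (f h : ℍ → ℂ) : Prop :=
  ∃ (d : ℤ) (γ : SL(2, ℤ)) (σ : cyclotomic N ≃ₐ[ℚ] cyclotomic N) (c : ℤ → cyclotomic N)
    (f' : ℍ → ℂ),
    A.map (Int.cast : ℤ → ZMod N) =
      ((!![1, 0; 0, d] : Matrix (Fin 2) (Fin 2) ℤ) * γ.1).map (Int.cast : ℤ → ZMod N) ∧
    σ (zetaN' N) = zetaN' N ^ d ∧
    HasFourierExpansion N f (fun n => c n) ∧
    HasFourierExpansion N f' (fun n => σ (c n)) ∧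
    ∀ τ : ℍ, h τ = f' (γ • τ)

end Modular

/-! ### Ray class invariants and the `L`-function -/

section Invariants

variable {K : Type*} [Field K]

/-- A `ℤ`-basis `ξ₁, ξ₂` of a lattice `L ⊆ K` with `ξ₁ / ξ₂` in the upper half-plane, `K` being
viewed inside `ℂ` through `φ`. -/
structure OrientedBasis (φ : K →+* ℂ) (L : Set K) where
  ξ₁ : K
  ξ₂ : K
  mem_iff : ∀ x : K, x ∈ L ↔ ∃ m n : ℤ, x = m * ξ₁ + n * ξ₂
  pos : 0 < (φ ξ₁ / φ ξ₂).im

/-- The point `ξ = ξ₁ / ξ₂` of the upper half-plane. -/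
def OrientedBasis.ξ {φ : K →+* ℂ} {L : Set K} (b : OrientedBasis φ L) : UpperHalfPlane :=
  ⟨φ b.ξ₁ / φ b.ξ₂, b.pos⟩

/-- The discriminant of a lattice, `Δ([ξ₁, ξ₂]) = ξ₂ ^ (-12) η(ξ₁ / ξ₂) ^ 24`. -/
def OrientedBasis.Δ {φ : K →+* ℂ} {L : Set K} (b : OrientedBasis φ L) : ℂ :=
  (φ b.ξ₂ ^ 12)⁻¹ * ModularForm.discriminant b.ξ

/-- `τ` is the generator `τ_O` of the order: `O = ℤτ + ℤ`, `τ` lies in the upper half-plane, and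
its real part is `0` or `-1/2` (so `τ` is `√D/2` or `(-1 + √D)/2`, where `D` is the
discriminant of `O`, according as `D ≡ 0` or `1` modulo `4`). -/
def IsTau (φ : K →+* ℂ) (O : Subring K) (τ : K) : Prop :=
  (∀ x : K, x ∈ O ↔ ∃ m n : ℤ, x = m * τ + n) ∧ 0 < (φ τ).im ∧
    ((φ τ).re = 0 ∨ (φ τ).re = -1 / 2)

variable [NumberField K] [Algebra.IsQuadraticExtension ℚ K]
  (φ : K →+* ℂ) (O : Subring K) [Module.Finite ℤ O] [IsFractionRing O K]

/-- The lattice `𝔠⁻¹`. -/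
def invLattice {N : ℕ} (𝔠 : properIdeals O N) : Set K :=
  {x | x ∈ (((toUnit O 𝔠)⁻¹ : (FractionalIdeal O⁰ K)ˣ) : FractionalIdeal O⁰ K)}

/-- `x` is the value of the invariant `f(C)`, for a modular function `f` of level `N`, computed
from some ideal `𝔠 ∈ C ∩ M(O, N)` and some basis of `𝔠⁻¹`: one has `x = f ^ A (ξ)`, where
`(τ_O, 1)ᵗ = A (ξ₁, ξ₂)ᵗ`. -/
def IsInvariantValue (N : ℕ) (f : UpperHalfPlane → ℂ) (C : RayClassGroup O N) (x : ℂ) : Prop :=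
  ∃ (𝔠 : properIdeals O N) (b : OrientedBasis φ (invLattice O 𝔠)) (τ : K)
    (A : Matrix (Fin 2) (Fin 2) ℤ) (h : UpperHalfPlane → ℂ),
    rayClass O 𝔠 = C ∧ IsTau φ O τ ∧
    τ = A 0 0 * b.ξ₁ + A 0 1 * b.ξ₂ ∧ 1 = A 1 0 * b.ξ₁ + A 1 1 * b.ξ₂ ∧
    IsConjugate N A f h ∧ x = h b.ξ

/-- `x = (2π)¹² N(𝔠⁻¹)⁶ |Δ(𝔠⁻¹)|` for some proper ideal `𝔠` in the class `C`. -/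
def IsDeltaValue (N : ℕ) (C : RayClassGroup O N) (x : ℂ) : Prop :=
  ∃ (𝔠 : properIdeals O N) (b : OrientedBasis φ (invLattice O 𝔠)),
    rayClass O 𝔠 = C ∧
    x = (2 * Real.pi) ^ 12 * ((idealNorm O 𝔠 : ℂ)⁻¹) ^ 6 * (‖b.Δ‖ : ℂ)

/-- The invariant `g_{O,N}(C)`: the value is independent of the ideal and of the basis it is
computed from. -/
def gInvariant (N : ℕ) (C : RayClassGroup O N) : ℂ :=
  Classical.epsilon fun x =>
    if N = 1 then IsDeltaValue φ O N C x
    else IsInvariantValue φ O N (fun τ => siegel 0 (1 / N) τ ^ (12 * N)) C x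

/-- The terms of the series `L_O(s, χ) = ∑ χ([𝔞]) N(𝔞)⁻ˢ`, indexed by `M(O, N)`. -/
def lTerm {N : ℕ} (χ : RayClassGroup O N →* ℂˣ) (s : ℂ) (𝔞 : properIdeals O N) : ℂ :=
  (χ (rayClass O 𝔞) : ℂ) * (idealNorm O 𝔞 : ℂ) ^ (-s)

end Invariants

end QuadraticOrder

end

/-! The series splits over the ray classes, so everything reduces to the partial zeta function of
one class C. Fix an ideal 𝔠 in C. The ideals of C prime to N are the x𝔠 with x a nonzero element of
1 + N𝔠⁻¹. Such an x is determined up to units congruent to 1 mod N, and the norm of x𝔠 is N(𝔠)|x|²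
(`exists_equiv_congrSet`, `idealNorm_of_scaled`). If an oriented basis of 𝔠⁻¹ satisfies 1 ≡ dξ₂ mod
N𝔠⁻¹, then 1 + N𝔠⁻¹ = Nξ₂(ℤξ + ℤ + d/N). Hence the partial zeta function is κ⁻ˢ E(s)/γ, where γ is
the number of units above, κ = N(𝔠)(N|ξ₂|)², v = d/N and E(s) = ∑ |mξ + n + v|⁻²ˢ is an Epstein zeta
function (`hasSum_rayClass`).

E is continued by Poisson summation in n on each row m ≠ 0 of the theta series
(`hasSum_theta_rows`). The zero frequency gives a completed Riemann zeta factor. The other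
frequencies give the Mellin transform of a kernel decaying rapidly at both ends, hence an entire
function. Since 1/Γ(s) has a simple zero at 0, the derivative of this part at 0 needs only values.
The Bessel integrals are elementary there (`bessel_half`) and sum to the logarithm of the infinite
product in the Siegel function (`mellin_besselKernel_eq_log_rowProd`). The row m = 0 is an even
Hurwitz zeta function, contributing log|1 - e(v)| or log 2π. This yields Kronecker's limit formulas
at s = 0: for v not an integer, E(0) = 0 and E'(0) = -2 log|g_{[0,v]}(ξ)|; for v = 0, E(0) = -1 and
E'(0) = -(1/6) log((2π)¹²|Δ(ξ)|).

For N ≥ 2 it remains to recognise the invariant. The expansion of g_{[0,1/N]}^{12N} in q shows that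
ζ ↦ ζᵈ turns it into g_{[0,d/N]}^{12N} (`conjPair_siegelPow`), so A ≡ diag(1,d)γ gives f^A =
g_{[0,d/N]}^{12N} ∘ γ. The second row of the same congruence says that the basis transformed by γ
satisfies 1 ≡ dξ₂ mod N𝔠⁻¹, which is exactly the basis needed above (`exists_partialZeta`). -/

section

open MeasureTheory Filter Topology Set

namespace QuadraticOrder

/-! ### The Bessel integral of index 1/2. -/

section BesselIntegral

/-- The antiderivative `∫₀ˣ exp (-u²) du`. -/
noncomputable def gaussPrim (x : ℝ) : ℝ := ∫ u in (0 : ℝ)..x, Real.exp (-u ^ 2)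

theorem hasDerivAt_gaussPrim (x : ℝ) : HasDerivAt gaussPrim (Real.exp (-x ^ 2)) x := by
  have hc : Continuous fun u : ℝ => Real.exp (-u ^ 2) := by fun_prop
  exact intervalIntegral.integral_hasDerivAt_right (hc.intervalIntegrable _ _)
    (hc.stronglyMeasurableAtFilter _ _) hc.continuousAt

theorem tendsto_gaussPrim_atTop : Tendsto gaussPrim atTop (𝓝 (√Real.pi / 2)) := by
  have h1 : IntegrableOn (fun u : ℝ => Real.exp (-u ^ 2)) (Ioi 0) := by
    have := (integrable_exp_neg_mul_sq (b := 1) one_pos).integrableOn (s := Ioi 0)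
    simpa using this
  have h2 := intervalIntegral_tendsto_integral_Ioi 0 h1 tendsto_id
  have h3 := integral_gaussian_Ioi 1
  simp only [neg_mul, one_mul, div_one] at h3
  rw [h3] at h2
  exact h2

theorem gaussPrim_neg (x : ℝ) : gaussPrim (-x) = -gaussPrim x := by
  have h := intervalIntegral.integral_comp_neg (a := 0) (b := x) fun u : ℝ => Real.exp (-u ^ 2)
  simp only [neg_sq, neg_zero] at h
  rw [gaussPrim, gaussPrim, h, intervalIntegral.integral_symm]

theorem tendsto_gaussPrim_atBot : Tendsto gaussPrim atBot (𝓝 (-(√Real.pi / 2))) := by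
  have h := (tendsto_gaussPrim_atTop.comp tendsto_neg_atBot_atTop).neg
  refine h.congr fun x => ?_
  simp [gaussPrim_neg]

variable {α β : ℝ}

/-- The exponent completes to a square in two ways, α²t + β²/t = (α√t ∓ β/√t)² ± 2αβ. The
derivatives of α√t - β/√t and α√t + β/√t have the same t^(-1/2) part and opposite t^(-3/2) parts, so
a weighted difference of two Gaussian primitives is an antiderivative. -/
theorem bessel_half (hα : 0 < α) (hβ : 0 < β) :
    IntegrableOn (fun t : ℝ => t ^ (-3 / 2 : ℝ) * Real.exp (-(α ^ 2 * t) - β ^ 2 / t)) (Ioi 0) ∧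
    ∫ t in Ioi (0 : ℝ), t ^ (-3 / 2 : ℝ) * Real.exp (-(α ^ 2 * t) - β ^ 2 / t) =
      √Real.pi / β * Real.exp (-(2 * α * β)) := by
  let W : ℝ → ℝ := fun t => (gaussPrim (α * √t - β / √t) -
    Real.exp (4 * α * β) * gaussPrim (α * √t + β / √t)) * (Real.exp (-(2 * α * β)) / β)
  let w₀ : ℝ := (-(√Real.pi / 2) - Real.exp (4 * α * β) * (√Real.pi / 2)) *
    (Real.exp (-(2 * α * β)) / β)
  let w₁ : ℝ := (√Real.pi / 2 - Real.exp (4 * α * β) * (√Real.pi / 2)) *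
    (Real.exp (-(2 * α * β)) / β)
  have hderiv : ∀ t ∈ Ioi (0 : ℝ), HasDerivAt W
      (t ^ (-3 / 2 : ℝ) * Real.exp (-(α ^ 2 * t) - β ^ 2 / t)) t := by
    intro t ht
    have ht' : 0 < t := ht
    have hs : 0 < √t := Real.sqrt_pos.2 ht'
    have hss : √t ^ 2 = t := Real.sq_sqrt ht'.le
    have d1 := Real.hasDerivAt_sqrt ht'.ne'
    have d2 : HasDerivAt (fun t => β / √t) (-(β / (2 * √t ^ 3))) t := by
      refine ((hasDerivAt_const t β).fun_div d1 hs.ne').congr_deriv ?_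
      field_simp
      ring
    have d3 := (hasDerivAt_gaussPrim _).comp t ((d1.const_mul α).sub d2)
    have d4 := (hasDerivAt_gaussPrim _).comp t ((d1.const_mul α).add d2)
    have d5 := (d3.sub (d4.const_mul (Real.exp (4 * α * β)))).mul_const
      (Real.exp (-(2 * α * β)) / β)
    refine d5.congr_deriv ?_
    have e1 : Real.exp (-(α * √t - β / √t) ^ 2) =
        Real.exp (-(α ^ 2 * t) - β ^ 2 / t) * Real.exp (2 * α * β) := by
      rw [← Real.exp_add]
      congr 1
      have h1 : β ^ 2 / t = (β / √t) ^ 2 := by rw [div_pow, hss]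
      have h2 : √t * (β / √t) = β := mul_div_cancel₀ β hs.ne'
      rw [h1]
      linear_combination (-α ^ 2) * hss + (2) * α * h2
    have e2 : Real.exp (-(α * √t + β / √t) ^ 2) =
        Real.exp (-(α ^ 2 * t) - β ^ 2 / t) * Real.exp (-(2 * α * β)) := by
      rw [← Real.exp_add]
      congr 1
      have h1 : β ^ 2 / t = (β / √t) ^ 2 := by rw [div_pow, hss]
      have h2 : √t * (β / √t) = β := mul_div_cancel₀ β hs.ne'
      rw [h1]
      linear_combination (-α ^ 2) * hss + (-2) * α * h2
    have e3 : Real.exp (4 * α * β) = Real.exp (2 * α * β) * Real.exp (2 * α * β) := by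
      rw [← Real.exp_add]; ring_nf
    have e4 : Real.exp (-(2 * α * β)) = (Real.exp (2 * α * β))⁻¹ := Real.exp_neg _
    have e5 : t ^ (-3 / 2 : ℝ) = (√t ^ 3)⁻¹ := by
      rw [Real.sqrt_eq_rpow, ← Real.rpow_natCast, ← Real.rpow_mul ht'.le, ← Real.rpow_neg ht'.le]
      norm_num
    simp only [Pi.add_apply, Pi.sub_apply] at *
    rw [e1, e2, e3, e4, e5]
    have := Real.exp_pos (2 * α * β)
    field_simp
    ring
  have hinv : Tendsto (fun t : ℝ => √t) atTop atTop := Real.tendsto_sqrt_atTop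
  have htop : Tendsto W atTop (𝓝 w₁) := by
    have h0 : Tendsto (fun t : ℝ => β / √t) atTop (𝓝 0) := hinv.const_div_atTop β
    have h1 : Tendsto (fun t : ℝ => α * √t) atTop atTop := hinv.const_mul_atTop hα
    refine ((tendsto_gaussPrim_atTop.comp ?_).sub
      ((tendsto_gaussPrim_atTop.comp ?_).const_mul _)).mul_const _
    · simpa only [sub_eq_add_neg] using h1.atTop_add h0.neg
    · exact h1.atTop_add h0
  have hbot : Tendsto W (𝓝[>] 0) (𝓝 w₀) := by
    have hs : Tendsto (fun t : ℝ => √t) (𝓝[>] 0) (𝓝[>] 0) := by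
      refine tendsto_nhdsWithin_iff.2 ⟨?_, ?_⟩
      · have : Tendsto (fun t : ℝ => √t) (𝓝 0) (𝓝 (√0)) := Real.continuous_sqrt.tendsto 0
        rw [Real.sqrt_zero] at this
        exact this.mono_left nhdsWithin_le_nhds
      · filter_upwards [self_mem_nhdsWithin] with t ht using Real.sqrt_pos.2 ht
    have h0 : Tendsto (fun t : ℝ => α * √t) (𝓝[>] 0) (𝓝 0) := by
      have := (tendsto_nhdsWithin_iff.1 hs).1.const_mul α
      rwa [mul_zero] at this
    have h1 : Tendsto (fun t : ℝ => β / √t) (𝓝[>] 0) atTop := by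
      simp only [div_eq_mul_inv]
      exact (tendsto_inv_nhdsGT_zero.comp hs).const_mul_atTop hβ
    refine ((tendsto_gaussPrim_atBot.comp ?_).sub
      ((tendsto_gaussPrim_atTop.comp ?_).const_mul _)).mul_const _
    · simp only [sub_eq_add_neg]
      exact h0.add_atBot (tendsto_neg_atTop_atBot.comp h1)
    · exact h0.add_atTop h1
  -- At 0 the division by √0 makes `W 0` a default value, not the limit `w₀`. Correcting this one
  -- value makes the antiderivative continuous on [0, ∞).
  let V : ℝ → ℝ := Function.update W 0 w₀
  have hV : ∀ t ∈ Ioi (0 : ℝ), V =ᶠ[𝓝 t] W := fun t ht => by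
    filter_upwards [eventually_ne_nhds (ne_of_gt ht)] with u hu
    exact Function.update_of_ne hu _ _
  have hVd : ∀ t ∈ Ioi (0 : ℝ), HasDerivAt V
      (t ^ (-3 / 2 : ℝ) * Real.exp (-(α ^ 2 * t) - β ^ 2 / t)) t := fun t ht =>
    (hderiv t ht).congr_of_eventuallyEq (hV t ht)
  have hVc : ContinuousWithinAt V (Ici 0) 0 := by
    rw [continuousWithinAt_update_same]
    simpa using hbot
  have hVt : Tendsto V atTop (𝓝 w₁) := by
    refine htop.congr' ?_
    filter_upwards [eventually_ne_atTop 0] with u hu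
    exact (Function.update_of_ne hu _ _).symm
  have hpos : ∀ t ∈ Ioi (0 : ℝ), 0 ≤ t ^ (-3 / 2 : ℝ) * Real.exp (-(α ^ 2 * t) - β ^ 2 / t) :=
    fun t ht => mul_nonneg (Real.rpow_nonneg (le_of_lt ht) _) (Real.exp_pos _).le
  have hint := integrableOn_Ioi_deriv_of_nonneg hVc hVd hpos hVt
  refine ⟨hint, ?_⟩
  rw [integral_Ioi_of_hasDerivAt_of_tendsto hVc hVd hint hVt]
  simp only [V, Function.update_self, w₁, w₀]
  ring

end BesselIntegral

/-! ### The derivative at 0 of the even Hurwitz zeta function. -/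

section CosZeta

open Complex HurwitzZeta

/-- `expZeta a 1 = ∑ e(na)/n = -log (1 - e(a))` for `a ≠ 0`. -/
theorem expZeta_one {a : ℝ} (ha : (a : UnitAddCircle) ≠ 0) :
    expZeta a 1 = -log (1 - exp (2 * Real.pi * I * a)) := by
  set z : ℂ := exp (2 * Real.pi * I * a) with hz
  have hz1 : z ≠ 1 := by
    intro h
    apply ha
    rw [hz, Complex.exp_eq_one_iff] at h
    obtain ⟨n, hn⟩ := h
    have : (a : ℂ) = n := by
      have h2 : (2 * Real.pi * I : ℂ) ≠ 0 := by simp [Real.pi_ne_zero]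
      apply mul_left_cancel₀ h2
      rw [hn]; ring
    have : a = n := by exact_mod_cast this
    rw [AddCircle.coe_eq_zero_iff]
    exact ⟨n, by simp [this]⟩
  have hzn : ‖z‖ = 1 := by
    rw [hz, show (2 * Real.pi * I * a : ℂ) = (2 * Real.pi * a : ℝ) * I by push_cast; ring]
    exact norm_exp_ofReal_mul_I _
  have hre : z.re < 1 := by
    have h1 : z.re ≤ 1 := hzn ▸ re_le_norm z
    refine lt_of_le_of_ne h1 fun h => hz1 ?_
    have h2 := Complex.sq_norm z
    rw [hzn, normSq_apply, h] at h2
    have : z.im = 0 := by nlinarith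
    exact Complex.ext h this
  -- the denominator stays away from zero
  have hsl : ∀ t : ℝ, 0 ≤ t → 1 - z * Real.exp (-t) ∈ slitPlane := fun t ht => by
    left
    have e1 : Real.exp (-t) ≤ 1 := by simpa using ht
    have e2 := Real.exp_pos (-t)
    simp only [sub_re, one_re, mul_re, ofReal_re, ofReal_im, mul_zero, sub_zero]
    rcases le_or_gt z.re 0 with h | h <;> nlinarith
  -- F is the sum of zⁿe^(-nt) over n ≥ 1, so its Mellin transform is Γ(s) times the exponential
  -- zeta function for Re s > 1. At s = 1 the integral still converges, with antiderivative log(1 -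
  -- ze^(-t)). Continuity of both sides carries the identity to s = 1, avoiding the conditionally
  -- convergent series.
  let F : ℝ → ℂ := fun t => z * Real.exp (-t) / (1 - z * Real.exp (-t))
  have hFc : ContinuousOn F (Ici 0) := by
    intro t ht
    refine ContinuousAt.continuousWithinAt ?_
    have h0 := slitPlane_ne_zero (hsl t ht)
    refine ContinuousAt.div (by fun_prop) (by fun_prop) h0
  have hder : ∀ t : ℝ, 0 ≤ t → HasDerivAt (fun t : ℝ => log (1 - z * Real.exp (-t))) (F t) t := by
    intro t ht
    have d1 : HasDerivAt (fun t : ℝ => ((Real.exp (-t) : ℝ) : ℂ)) (-(Real.exp (-t) : ℝ) : ℂ) t := by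
      have := ((hasDerivAt_neg t).exp).ofReal_comp
      simpa using this
    have d2 := ((d1.const_mul z).const_sub 1).clog_real (hsl t ht)
    simpa [F] using d2
  have hFbd : ∀ t : ℝ, 1 ≤ t → ‖F t‖ ≤ 2 * Real.exp (-1 * t) := fun t ht => by
    have e1 : Real.exp (-t) ≤ 1 / 2 := by
      have : Real.exp (-t) ≤ Real.exp (-1) := Real.exp_le_exp.2 (by linarith)
      have h3 : Real.exp (-1) < 1 / 2 := by
        rw [Real.exp_neg, inv_eq_one_div]
        exact one_div_lt_one_div_of_lt (by norm_num) (by linarith [Real.exp_one_gt_d9])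
      linarith
    have e0 := Real.exp_pos (-t)
    have e2 : ‖z * Real.exp (-t)‖ = Real.exp (-t) := by
      rw [norm_mul, hzn, one_mul, norm_real, Real.norm_of_nonneg e0.le]
    have e3 : 1 / 2 ≤ ‖1 - z * Real.exp (-t)‖ := by
      have := norm_sub_norm_le (1 : ℂ) (z * Real.exp (-t))
      rw [norm_one, e2] at this
      linarith
    simp only [F, norm_div, e2, neg_mul, one_mul]
    rw [div_le_iff₀ (by linarith)]
    nlinarith
  have hO : F =O[atTop] fun t => Real.exp (-1 * t) := by
    refine Asymptotics.IsBigO.of_bound 2 ?_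
    filter_upwards [eventually_ge_atTop 1] with t ht
    rw [Real.norm_of_nonneg (Real.exp_pos _).le]
    exact hFbd t ht
  have hO0 : F =O[𝓝[>] 0] fun t : ℝ => t ^ (-(0 : ℝ)) := by
    have : Tendsto F (𝓝[>] 0) (𝓝 (F 0)) :=
      (hFc 0 self_mem_Ici).mono_left (nhdsWithin_mono _ Ioi_subset_Ici_self)
    simpa using this.isBigO_one ℝ
  have hloc : LocallyIntegrableOn F (Ioi 0) :=
    (hFc.mono Ioi_subset_Ici_self).locallyIntegrableOn measurableSet_Ioi
  have hint : IntegrableOn F (Ioi 0) := by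
    have := mellinConvergent_of_isBigO_rpow_exp (s := 1) one_pos hloc hO hO0 (by simp)
    simpa [MellinConvergent] using this
  have hmel : mellin F 1 = -log (1 - z) := by
    have : mellin F 1 = ∫ t in Ioi (0 : ℝ), F t := by simp [mellin]
    rw [this]
    have hlim : Tendsto (fun t : ℝ => log (1 - z * Real.exp (-t))) atTop (𝓝 0) := by
      have h1 : Tendsto (fun t : ℝ => (1 : ℂ) - z * Real.exp (-t)) atTop (𝓝 (1 - z * (0 : ℝ))) :=
        ((continuous_ofReal.tendsto 0).comp
          (Real.tendsto_exp_atBot.comp tendsto_neg_atTop_atBot)).const_mul z |>.const_sub 1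
      have h2 := h1.clog (by simp)
      simpa using h2
    rw [integral_Ioi_of_hasDerivAt_of_tendsto
      (hder 0 le_rfl).continuousAt.continuousWithinAt (fun t ht => hder t (le_of_lt ht)) hint hlim]
    simp
  have hsum : ∀ t ∈ Ioi (0 : ℝ), HasSum (fun n : ℕ =>
      exp (2 * Real.pi * I * a * (n + 1 : ℕ)) * Real.exp (-((n + 1 : ℕ) : ℝ) * t)) (F t) := by
    intro t ht
    have hn : ‖z * Real.exp (-t)‖ < 1 := by
      rw [norm_mul, hzn, one_mul, norm_real, Real.norm_of_nonneg (Real.exp_pos _).le]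
      simpa using ht
    have h := (hasSum_geometric_of_norm_lt_one hn).mul_left (z * Real.exp (-t))
    refine (h.congr_fun fun n => ?_)
    rw [← pow_succ', mul_pow, hz, ← Complex.exp_nat_mul, ofReal_exp, ofReal_exp,
      ← Complex.exp_nat_mul]
    congr 2 <;> push_cast <;> ring
  have heq : ∀ s : ℂ, 1 < s.re → Gamma s * expZeta a s = mellin F s := by
    intro s hs
    have hs0 : s ≠ 0 := ne_zero_of_one_lt_re hs
    have h1 := hasSum_mellin (s := s) (F := F) (p := fun n : ℕ => ((n + 1 : ℕ) : ℝ))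
      (fun n => Or.inr (by positivity)) (by linarith) hsum (by
        have : Summable fun n : ℕ => 1 / ((n + 1 : ℕ) : ℝ) ^ s.re :=
          (summable_nat_add_iff 1).2 (Real.summable_one_div_nat_rpow.2 hs)
        refine this.congr fun n => ?_
        congr 1
        rw [show (2 * Real.pi * I * a * (n + 1 : ℕ) : ℂ) = (2 * Real.pi * a * (n + 1 : ℕ) : ℝ) * I by
          push_cast; ring, norm_exp_ofReal_mul_I])
    have h2 := (hasSum_expZeta_of_one_lt_re a hs).mul_left (Gamma s)
    rw [← hasSum_nat_add_iff' 1] at h2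
    simp only [Finset.range_one, Finset.sum_singleton, Nat.cast_zero, zero_cpow hs0, div_zero,
      mul_zero, sub_zero] at h2
    refine h2.unique (h1.congr_fun fun n => ?_)
    push_cast
    ring
  have hcont1 : ContinuousAt (fun s => Gamma s * expZeta a s) 1 :=
    ((differentiableAt_Gamma_one).continuousAt).mul
      (differentiableAt_expZeta a 1 (Or.inr ha)).continuousAt
  have hcont2 : ContinuousAt (mellin F) 1 :=
    (mellin_differentiableAt_of_isBigO_rpow_exp (s := 1) one_pos hloc hO hO0 (by simp)).continuousAt
  have hseq : Tendsto (fun ε : ℝ => (1 + ε : ℂ)) (𝓝[>] 0) (𝓝 1) := by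
    have : Continuous fun ε : ℝ => (1 + ε : ℂ) := by fun_prop
    have := this.tendsto 0
    simp only [ofReal_zero, add_zero] at this
    exact this.mono_left nhdsWithin_le_nhds
  have hl1 := hcont1.tendsto.comp hseq
  have hl2 := hcont2.tendsto.comp hseq
  have := tendsto_nhds_unique_of_eventuallyEq hl1 hl2 (by
    filter_upwards [self_mem_nhdsWithin] with ε hε
    exact heq _ (by simpa using hε))
  rw [Gamma_one, one_mul] at this
  rw [this, hmel]

/-- The cosine series is the mean of the exponential series at a and -a, whose values are minus the
logarithms of conjugate numbers. These do not lie on the branch cut, so the imaginary parts cancel.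
-/
theorem cosZeta_one {a : ℝ} (ha : (a : UnitAddCircle) ≠ 0) :
    cosZeta a 1 = -(Real.log ‖1 - exp (2 * Real.pi * I * a)‖ : ℂ) := by
  have hneg : ((-a : ℝ) : UnitAddCircle) ≠ 0 := by
    simpa [AddCircle.coe_neg] using ha
  have h := expZeta_one hneg
  rw [AddCircle.coe_neg] at h
  rw [cosZeta_eq, expZeta_one ha, h]
  have hc : (1 : ℂ) - exp (2 * Real.pi * I * (-a : ℝ)) =
      (starRingEnd ℂ) (1 - exp (2 * Real.pi * I * a)) := by
    simp [← exp_conj, Complex.conj_ofNat]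
  rw [hc]
  set w := (1 : ℂ) - exp (2 * Real.pi * I * a)
  have : log ((starRingEnd ℂ) w) + log w = 2 * (Real.log ‖w‖ : ℂ) := by
    by_cases hw : w.arg = Real.pi
    · have h1 : (starRingEnd ℂ) w = w := by
        rw [conj_eq_iff_im]; exact (arg_eq_pi_iff.1 hw).2
      exfalso
      have h3 := (arg_eq_pi_iff.1 hw).1
      have h4 : (exp (2 * Real.pi * I * a)).re ≤ 1 := by
        refine (re_le_norm _).trans ?_
        rw [show (2 * Real.pi * I * a : ℂ) = (2 * Real.pi * a : ℝ) * I by push_cast; ring,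
          norm_exp_ofReal_mul_I]
      simp only [w, sub_re, one_re] at h3
      linarith
    · rw [log_conj _ hw]
      apply Complex.ext
      · simp [log_re]; ring
      · simp
  rw [add_comm] at this
  linear_combination (-1 / 2 : ℂ) * this

/-- In the functional equation s ↦ 1 - s the factor cos(πs/2) vanishes at s = 1. The derivative at 0
therefore involves only the value of the cosine zeta function at 1. -/
theorem hasDerivAt_hurwitzZetaEven_zero {a : ℝ} (ha : (a : UnitAddCircle) ≠ 0) :
    HasDerivAt (hurwitzZetaEven a) (-(Real.log ‖1 - exp (2 * Real.pi * I * a)‖ : ℂ) / 2) 0 := by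
  let g : ℂ → ℂ := fun s => 2 * (2 * Real.pi) ^ (-s) * Gamma s * cosZeta a s
  have hgd : DifferentiableAt ℂ g 1 := by
    have h0 : (2 * Real.pi : ℂ) ≠ 0 := by simp [Real.pi_ne_zero]
    refine ((DifferentiableAt.const_mul ?_ 2).mul differentiableAt_Gamma_one).mul
      (differentiableAt_cosZeta a (Or.inr ha))
    exact differentiableAt_id.neg.const_cpow (Or.inl h0)
  have hcos : HasDerivAt (fun s : ℂ => cos (Real.pi * s / 2)) (-(Real.pi / 2)) 1 := by
    have := (((hasDerivAt_id (1 : ℂ)).const_mul (Real.pi : ℂ)).div_const 2).ccos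
    simpa using this
  have hprod := hgd.hasDerivAt.mul hcos
  have hsub : HasDerivAt (fun w : ℂ => 1 - w) (-1) 0 := (hasDerivAt_id 0).const_sub 1
  have h1 : HasDerivAt (g * fun s : ℂ => cos (Real.pi * s / 2))
    (deriv g 1 * cos (Real.pi * 1 / 2) + g 1 * -(Real.pi / 2)) (1 - 0) := by
    simpa using hprod
  have h2 := h1.comp 0 hsub
  have h3 : hurwitzZetaEven a =ᶠ[𝓝 0] (g * fun s : ℂ => cos (Real.pi * s / 2)) ∘ fun w => 1 - w := by
    have hb : Metric.ball (0 : ℂ) 1 ∈ 𝓝 0 := Metric.ball_mem_nhds _ one_pos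
    filter_upwards [hb] with w hw
    have hw' : ‖w‖ < 1 := by simpa using hw
    have := hurwitzZetaEven_one_sub (a : UnitAddCircle) (s := 1 - w) (fun n hn => by
      have : w = 1 + n := by linear_combination -hn
      rw [this] at hw'
      have h5 : ‖(1 + n : ℂ)‖ = 1 + n := by
        rw [show (1 + n : ℂ) = ((1 + n : ℕ) : ℂ) by push_cast; ring, Complex.norm_natCast]; push_cast; ring
      rw [h5] at hw'
      have : (0 : ℝ) ≤ n := by positivity
      linarith) (Or.inl ha)
    rw [sub_sub_cancel] at this
    simp only [this, g, Function.comp, Pi.mul_apply]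
    ring
  refine (h2.congr_of_eventuallyEq h3).congr_deriv ?_
  simp only [mul_one, cos_pi_div_two, mul_zero, zero_add, g, Gamma_one, cosZeta_one ha]
  rw [cpow_neg_one]
  have : (Real.pi : ℂ) ≠ 0 := by simp [Real.pi_ne_zero]
  field_simp

end CosZeta

end QuadraticOrder

end

/-! ### Theta series and the rows m ≠ 0 of the Epstein zeta function. -/

section

open MeasureTheory Filter Topology Set

namespace QuadraticOrder

section Epstein

open Complex HurwitzZeta

/-- The nonzero integers. -/
abbrev NZInt : Type := {m : ℤ // m ≠ 0}

theorem NZInt.one_le_abs (m : NZInt) : (1 : ℝ) ≤ |((m : ℤ) : ℝ)| := by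
  have := Int.one_le_abs m.2
  exact_mod_cast this

theorem NZInt.one_le_sq (m : NZInt) : (1 : ℝ) ≤ ((m : ℤ) : ℝ) ^ 2 := by
  rw [← sq_abs]; nlinarith [m.one_le_abs]

theorem summable_exp_neg_abs_int {c : ℝ} (hc : 0 < c) :
    Summable fun m : ℤ => Real.exp (-(c * |(m : ℝ)|)) := by
  have h : Summable fun n : ℕ => Real.exp (-(c * |((n : ℤ) : ℝ)|)) := by
    have := Real.summable_exp_nat_mul_iff.2 (neg_lt_zero.2 hc)
    refine this.congr fun n => ?_
    congr 1
    simp; ring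
  refine summable_int_iff_summable_nat_and_neg.2 ⟨h, ?_⟩
  refine h.congr fun n => ?_
  simp

theorem summable_exp_neg_mul {c : ℝ} (hc : 0 < c) :
    Summable fun p : NZInt × NZInt =>
      Real.exp (-(c * (|((p.1 : ℤ) : ℝ)| * |((p.2 : ℤ) : ℝ)|))) := by
  have h : Summable fun m : NZInt => Real.exp (-(c / 2 * |((m : ℤ) : ℝ)|)) :=
    (summable_exp_neg_abs_int (half_pos hc)).comp_injective Subtype.val_injective
  have h2 := h.mul_of_nonneg h (fun _ => (Real.exp_pos _).le) (fun _ => (Real.exp_pos _).le)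
  refine Summable.of_nonneg_of_le (fun _ => (Real.exp_pos _).le) (fun p => ?_) h2
  rw [← Real.exp_add]
  apply Real.exp_le_exp.2
  have h3 := p.1.one_le_abs
  have h4 := p.2.one_le_abs
  nlinarith [mul_nonneg (sub_nonneg.2 h3) (sub_nonneg.2 h4)]

/-- `max |m|, |n|` is controlled by `|mτ + n + v|` for `m ≠ 0`. -/
theorem exists_norm_le_shifted (τ : UpperHalfPlane) (v : ℝ) : ∃ C : ℝ, 0 < C ∧
    ∀ m n : ℤ, m ≠ 0 → C * ‖(![m, n] : Fin 2 → ℤ)‖ ≤ ‖(m : ℂ) * τ + ((n + v : ℝ) : ℂ)‖ := by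
  have hr := EisensteinSeries.r_pos τ
  set r := EisensteinSeries.r τ
  have hv := abs_nonneg v
  -- The norm X on the right dominates r|m| and r|n + v|. Since |m| ≥ 1 gives r ≤ X, the shift costs
  -- at most r|v| ≤ X|v|, whence r|n| ≤ (1 + |v|)X.
  refine ⟨r / (1 + |v|), by positivity, fun m n hm => ?_⟩
  have hm' : (1 : ℝ) ≤ |(m : ℝ)| := NZInt.one_le_abs ⟨m, hm⟩
  have h1 : r * |(m : ℝ)| ≤ ‖(m : ℂ) * τ + ((n + v : ℝ) : ℂ)‖ := by
    have h0 : (0 : ℝ) < |(m : ℝ)| := by linarith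
    have := EisensteinSeries.auxbound1 τ (c := m / |(m : ℝ)|) ((n + v) / |(m : ℝ)|)
      (by rw [div_pow, sq_abs, div_self (by positivity)])
    rw [← le_div_iff₀ h0]
    refine this.trans (le_of_eq ?_)
    have e0 : |(m : ℝ)| = ‖((|(m : ℝ)| : ℝ) : ℂ)‖ := by
      rw [Complex.norm_real, Real.norm_of_nonneg h0.le]
    conv_rhs => rw [e0, ← norm_div]
    congr 1
    have : ((|(m : ℝ)| : ℝ) : ℂ) ≠ 0 := by exact_mod_cast h0.ne'
    push_cast
    field_simp
  have h2 : r * |(n + v : ℝ)| ≤ ‖(m : ℂ) * τ + ((n + v : ℝ) : ℂ)‖ := by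
    rcases eq_or_ne (n + v : ℝ) 0 with h | h
    · rw [h]; simpa using by positivity
    have h0 : (0 : ℝ) < |(n + v : ℝ)| := abs_pos.2 h
    have := EisensteinSeries.auxbound2 τ (m / |(n + v : ℝ)|) (d := (n + v) / |(n + v : ℝ)|)
      (by rw [div_pow, sq_abs, div_self (by positivity)])
    rw [← le_div_iff₀ h0]
    refine this.trans (le_of_eq ?_)
    have e0 : |(n + v : ℝ)| = ‖((|(n + v : ℝ)| : ℝ) : ℂ)‖ := by
      rw [Complex.norm_real, Real.norm_of_nonneg h0.le]
    conv_rhs => rw [e0, ← norm_div]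
    congr 1
    have : ((|(n + v : ℝ)| : ℝ) : ℂ) ≠ 0 := by exact_mod_cast h0.ne'
    push_cast at this ⊢
    field_simp
  have h3 : ‖(![m, n] : Fin 2 → ℤ)‖ = max |(m : ℝ)| |(n : ℝ)| := by
    rw [EisensteinSeries.norm_eq_max_natAbs]
    simp [Nat.cast_natAbs]
  rw [h3, div_mul_eq_mul_div, div_le_iff₀ (by positivity)]
  set X := ‖(m : ℂ) * τ + ((n + v : ℝ) : ℂ)‖
  have hX : 0 ≤ X := norm_nonneg _
  have h4 : |(n : ℝ)| ≤ |(n + v : ℝ)| + |v| := by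
    have := abs_sub (n + v : ℝ) v
    simpa using this
  rcases max_cases |(m : ℝ)| |(n : ℝ)| with ⟨h, -⟩ | ⟨h, -⟩ <;> rw [h]
  · nlinarith
  · have h5 : r * |(n : ℝ)| ≤ r * (|(n + v : ℝ)| + |v|) := mul_le_mul_of_nonneg_left h4 hr.le
    have h6 : r * |v| ≤ X * |v| := by
      refine mul_le_mul_of_nonneg_right ?_ hv
      nlinarith
    nlinarith

theorem summable_shifted (τ : UpperHalfPlane) (v : ℝ) {k : ℝ} (hk : 2 < k) :
    Summable fun p : NZInt × ℤ =>
      ‖((p.1 : ℤ) : ℂ) * τ + ((p.2 + v : ℝ) : ℂ)‖ ^ (-k) := by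
  obtain ⟨C, hC, h⟩ := exists_norm_le_shifted τ v
  have h1 := EisensteinSeries.summable_one_div_norm_rpow hk
  have hinj : Function.Injective fun p : NZInt × ℤ => (![(p.1 : ℤ), p.2] : Fin 2 → ℤ) := by
    rintro ⟨⟨a, ha⟩, b⟩ ⟨⟨c, hc⟩, d⟩ he
    have e1 := congrFun he 0
    have e2 := congrFun he 1
    simp at e1 e2
    subst e1 e2
    rfl
  have h2 := (h1.comp_injective hinj).mul_left (C ^ (-k))
  refine Summable.of_nonneg_of_le (fun _ => by positivity) (fun p => ?_) h2
  have h0 : 0 < ‖(![(p.1 : ℤ), p.2] : Fin 2 → ℤ)‖ := by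
    rw [norm_pos_iff]
    intro h
    exact p.1.2 (by simpa using congrFun h 0)
  simp only [Function.comp]
  rw [← Real.mul_rpow hC.le h0.le]
  exact Real.rpow_le_rpow_of_nonpos (by positivity) (h _ _ p.1.2) (by linarith)

/-- The terms of the rapidly decaying part of the theta series. -/
noncomputable def besselTerm (τ : UpperHalfPlane) (v : ℝ) (p : NZInt × NZInt) (t : ℝ) : ℂ :=
  exp (2 * Real.pi * I * ((p.1 : ℤ) * τ.re + v : ℝ) * (p.2 : ℤ)) *
    Real.exp (-(Real.pi * ((p.1 : ℤ) * τ.im) ^ 2 * t) - Real.pi * (p.2 : ℤ) ^ 2 / t)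

/-- The rapidly decaying part of the theta series. -/
noncomputable def besselKernel (τ : UpperHalfPlane) (v : ℝ) (t : ℝ) : ℂ :=
  ∑' p, besselTerm τ v p t

theorem norm_exp_two_pi_mul (a : ℝ) (n : ℤ) : ‖exp (2 * Real.pi * I * a * n)‖ = 1 := by
  rw [show (2 * Real.pi * I * a * n : ℂ) = (2 * Real.pi * a * n : ℝ) * I by push_cast; ring,
    norm_exp_ofReal_mul_I]

theorem norm_besselTerm (τ : UpperHalfPlane) (v : ℝ) (p : NZInt × NZInt) (t : ℝ) :
    ‖besselTerm τ v p t‖ =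
      Real.exp (-(Real.pi * ((p.1 : ℤ) * τ.im) ^ 2 * t) - Real.pi * (p.2 : ℤ) ^ 2 / t) := by
  rw [besselTerm, norm_mul, norm_exp_two_pi_mul, one_mul, Complex.norm_real,
    Real.norm_of_nonneg (Real.exp_pos _).le]

/-- Half of the exponent is spent on the arithmetic-geometric mean inequality, which gives decay in
|m||k| independent of t. The other half, bounded using m² ≥ 1 and k² ≥ 1, gives decay as t → ∞ and t
→ 0 independent of (m, k). -/
theorem norm_besselTerm_le (τ : UpperHalfPlane) (v : ℝ) (p : NZInt × NZInt) {t : ℝ} (ht : 0 < t) :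
    ‖besselTerm τ v p t‖ ≤
      Real.exp (-(Real.pi * τ.im * (|((p.1 : ℤ) : ℝ)| * |((p.2 : ℤ) : ℝ)|))) *
        (Real.exp (-(Real.pi * τ.im ^ 2 / 2) * t) * Real.exp (-(Real.pi / 2) * t⁻¹)) := by
  rw [norm_besselTerm, ← Real.exp_add, ← Real.exp_add]
  apply Real.exp_le_exp.2
  have hy := τ.im_pos
  have h1 := p.1.one_le_sq
  have h2 := p.2.one_le_sq
  have hti : 0 < t⁻¹ := inv_pos.2 ht
  have htt : t * t⁻¹ = 1 := mul_inv_cancel₀ ht.ne'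
  set m : ℝ := ((p.1 : ℤ) : ℝ)
  set k : ℝ := ((p.2 : ℤ) : ℝ)
  set y := τ.im
  have e1 : y ^ 2 * t ≤ (m * y) ^ 2 * t := by
    have : y ^ 2 * t * 1 ≤ y ^ 2 * t * m ^ 2 := mul_le_mul_of_nonneg_left h1 (by positivity)
    nlinarith
  have e2 : t⁻¹ ≤ k ^ 2 * t⁻¹ := by nlinarith
  have e3 : 2 * (y * (|m| * |k|)) ≤ (m * y) ^ 2 * t + k ^ 2 * t⁻¹ := by
    have hs := Real.sq_sqrt ht.le
    have hs0 := Real.sqrt_pos.2 ht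
    have : 0 ≤ (|m| * y * √t - |k| * (√t)⁻¹) ^ 2 := sq_nonneg _
    have e : (|m| * y * √t - |k| * (√t)⁻¹) ^ 2 =
        (m * y) ^ 2 * t - 2 * (y * (|m| * |k|)) + k ^ 2 * t⁻¹ := by
      have f1 : √t * (√t)⁻¹ = 1 := mul_inv_cancel₀ hs0.ne'
      have f2 : (√t)⁻¹ ^ 2 = t⁻¹ := by rw [inv_pow, hs]
      linear_combination (m * y) ^ 2 * hs + k ^ 2 * f2 - 2 * (y * (|m| * |k|)) * f1 +
        (y * √t) ^ 2 * sq_abs m + ((√t)⁻¹) ^ 2 * sq_abs k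
    linarith
  rw [div_eq_mul_inv]
  have hpi := Real.pi_pos
  have := mul_le_mul_of_nonneg_left (add_le_add (add_le_add e1 e2) e3) hpi.le
  nlinarith

/-- The constant in the bound for `besselKernel`. -/
noncomputable def besselBound (τ : UpperHalfPlane) : ℝ :=
  ∑' p : NZInt × NZInt, Real.exp (-(Real.pi * τ.im * (|((p.1 : ℤ) : ℝ)| * |((p.2 : ℤ) : ℝ)|)))

theorem summable_besselBound (τ : UpperHalfPlane) : Summable fun p : NZInt × NZInt =>
    Real.exp (-(Real.pi * τ.im * (|((p.1 : ℤ) : ℝ)| * |((p.2 : ℤ) : ℝ)|))) :=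
  summable_exp_neg_mul (mul_pos Real.pi_pos τ.im_pos)

theorem summable_besselTerm (τ : UpperHalfPlane) (v : ℝ) {t : ℝ} (ht : 0 < t) :
    Summable fun p => besselTerm τ v p t :=
  Summable.of_norm_bounded ((summable_besselBound τ).mul_right _)
    fun p => norm_besselTerm_le τ v p ht

theorem norm_besselKernel_le (τ : UpperHalfPlane) (v : ℝ) {t : ℝ} (ht : 0 < t) :
    ‖besselKernel τ v t‖ ≤ besselBound τ *
      (Real.exp (-(Real.pi * τ.im ^ 2 / 2) * t) * Real.exp (-(Real.pi / 2) * t⁻¹)) := by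
  rw [besselBound, ← tsum_mul_right]
  exact tsum_of_norm_bounded ((summable_besselBound τ).mul_right _).hasSum
    fun p => norm_besselTerm_le τ v p ht

theorem continuousOn_besselTerm (τ : UpperHalfPlane) (v : ℝ) (p : NZInt × NZInt) :
    ContinuousOn (besselTerm τ v p) (Ioi 0) := by
  refine continuousOn_const.mul (continuous_ofReal.comp_continuousOn ?_)
  refine Real.continuous_exp.comp_continuousOn ?_
  refine ContinuousOn.sub (by fun_prop) (continuousOn_const.div continuousOn_id ?_)
  exact fun t ht => ne_of_gt ht

theorem continuousOn_besselKernel (τ : UpperHalfPlane) (v : ℝ) :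
    ContinuousOn (besselKernel τ v) (Ioi 0) := by
  refine continuousOn_tsum (continuousOn_besselTerm τ v) (summable_besselBound τ)
    fun p t ht => (norm_besselTerm_le τ v p ht).trans ?_
  have ht' : (0 : ℝ) < t := ht
  refine mul_le_of_le_one_right (Real.exp_pos _).le (mul_le_one₀ ?_ (Real.exp_pos _).le ?_)
  · rw [Real.exp_le_one_iff]
    have := mul_nonneg (show 0 ≤ Real.pi * τ.im ^ 2 / 2 by positivity) ht'.le
    linarith
  · rw [Real.exp_le_one_iff]
    have := mul_nonneg (show 0 ≤ Real.pi / 2 by positivity) (inv_nonneg.2 ht'.le)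
    linarith

theorem besselBound_nonneg (τ : UpperHalfPlane) : 0 ≤ besselBound τ :=
  tsum_nonneg fun _ => (Real.exp_pos _).le

theorem besselKernel_isBigO_atTop (τ : UpperHalfPlane) (v : ℝ) :
    besselKernel τ v =O[atTop] fun t => Real.exp (-(Real.pi * τ.im ^ 2 / 2) * t) := by
  refine Asymptotics.IsBigO.of_bound (besselBound τ) ?_
  filter_upwards [eventually_gt_atTop 0] with t ht
  refine (norm_besselKernel_le τ v ht).trans ?_
  rw [Real.norm_of_nonneg (Real.exp_pos _).le]
  refine mul_le_mul_of_nonneg_left ?_ (besselBound_nonneg τ)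
  refine mul_le_of_le_one_right (Real.exp_pos _).le ?_
  rw [Real.exp_le_one_iff]
  have := mul_nonneg (show 0 ≤ Real.pi / 2 by positivity) (inv_nonneg.2 ht.le)
  linarith

theorem besselKernel_isBigO_zero (τ : UpperHalfPlane) (v b : ℝ) :
    besselKernel τ v =O[𝓝[>] 0] fun t : ℝ => t ^ (-b) := by
  have h1 : besselKernel τ v =O[𝓝[>] 0] fun t : ℝ => Real.exp (-(Real.pi / 2) * t⁻¹) := by
    refine Asymptotics.IsBigO.of_bound (besselBound τ) ?_
    filter_upwards [self_mem_nhdsWithin] with t ht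
    have ht' : (0 : ℝ) < t := ht
    refine (norm_besselKernel_le τ v ht).trans ?_
    rw [Real.norm_of_nonneg (Real.exp_pos _).le]
    refine mul_le_mul_of_nonneg_left ?_ (besselBound_nonneg τ)
    refine mul_le_of_le_one_left (Real.exp_pos _).le ?_
    rw [Real.exp_le_one_iff]
    have := mul_nonneg (show 0 ≤ Real.pi * τ.im ^ 2 / 2 by positivity) ht'.le
    linarith
  have h2 := (isLittleO_exp_neg_mul_rpow_atTop (half_pos Real.pi_pos) b).isBigO.comp_tendsto
    tendsto_inv_nhdsGT_zero
  refine h1.trans (h2.congr' (Eventually.of_forall fun _ => rfl) ?_)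
  filter_upwards [self_mem_nhdsWithin] with t ht
  have ht' : (0 : ℝ) < t := ht
  simp only [Function.comp]
  rw [Real.inv_rpow ht'.le, Real.rpow_neg ht'.le]

theorem mellinConvergent_besselKernel (τ : UpperHalfPlane) (v : ℝ) (s : ℂ) :
    MellinConvergent (besselKernel τ v) s :=
  mellinConvergent_of_isBigO_rpow_exp (a := Real.pi * τ.im ^ 2 / 2)
    (by have := τ.im_pos; have := Real.pi_pos; positivity)
    ((continuousOn_besselKernel τ v).locallyIntegrableOn measurableSet_Ioi)
    (besselKernel_isBigO_atTop τ v) (besselKernel_isBigO_zero τ v (s.re - 1)) (by linarith)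

/-- Exponential decay at infinity and decay faster than any power at 0 impose no restriction on s.
-/
theorem differentiable_mellin_besselKernel (τ : UpperHalfPlane) (v : ℝ) :
    Differentiable ℂ (mellin (besselKernel τ v)) := fun s =>
  mellin_differentiableAt_of_isBigO_rpow_exp (a := Real.pi * τ.im ^ 2 / 2)
    (by have := τ.im_pos; have := Real.pi_pos; positivity)
    ((continuousOn_besselKernel τ v).locallyIntegrableOn measurableSet_Ioi)
    (besselKernel_isBigO_atTop τ v) (besselKernel_isBigO_zero τ v (s.re - 1)) (by linarith)

/-- The point -1/2 is s - 1/2 at s = 0. The power of t is then t^(-3/2), the elementary case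
`bessel_half` with α = √π|m|Im τ and β = √π|k|. The resulting bounds justify termwise integration.
-/
theorem mellin_besselKernel_neg_half (τ : UpperHalfPlane) (v : ℝ) :
    HasSum (fun p : NZInt × NZInt =>
      exp (2 * Real.pi * I * ((p.1 : ℤ) * τ.re + v : ℝ) * (p.2 : ℤ)) *
        (Real.exp (-(2 * Real.pi * τ.im * (|((p.1 : ℤ) : ℝ)| * |((p.2 : ℤ) : ℝ)|))) /
          |((p.2 : ℤ) : ℝ)| : ℝ)) (mellin (besselKernel τ v) (-1 / 2)) := by
  have hy := τ.im_pos
  have hpi := Real.pi_pos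
  let α : NZInt × NZInt → ℝ := fun p => √Real.pi * (|((p.1 : ℤ) : ℝ)| * τ.im)
  let β : NZInt × NZInt → ℝ := fun p => √Real.pi * |((p.2 : ℤ) : ℝ)|
  have hα : ∀ p, 0 < α p := fun p => by
    have := p.1.one_le_abs; simp only [α]; positivity
  have hβ : ∀ p, 0 < β p := fun p => by
    have := p.2.one_le_abs; simp only [β]; positivity
  have hreal : ∀ p : NZInt × NZInt, ∀ t : ℝ,
      Real.exp (-(Real.pi * ((p.1 : ℤ) * τ.im) ^ 2 * t) - Real.pi * (p.2 : ℤ) ^ 2 / t) =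
      Real.exp (-(α p ^ 2 * t) - β p ^ 2 / t) := fun p t => by
    simp only [α, β, mul_pow, sq_abs, Real.sq_sqrt hpi.le]
  have hval : ∀ p : NZInt × NZInt, √Real.pi / β p * Real.exp (-(2 * α p * β p)) =
      Real.exp (-(2 * Real.pi * τ.im * (|((p.1 : ℤ) : ℝ)| * |((p.2 : ℤ) : ℝ)|))) /
          |((p.2 : ℤ) : ℝ)| := fun p => by
    have h1 : √Real.pi * √Real.pi = Real.pi := Real.mul_self_sqrt hpi.le
    have h2 : 2 * α p * β p = 2 * Real.pi * τ.im * (|((p.1 : ℤ) : ℝ)| * |((p.2 : ℤ) : ℝ)|) := by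
      simp only [α, β]
      linear_combination (2 * |((p.1 : ℤ) : ℝ)| * τ.im * |((p.2 : ℤ) : ℝ)|) * h1
    rw [h2]
    have := p.2.one_le_abs
    have : 0 < √Real.pi := Real.sqrt_pos.2 hpi
    simp only [β]
    field_simp
  have hF : ∀ p : NZInt × NZInt, ∀ t ∈ Ioi (0 : ℝ),
      (t : ℂ) ^ ((-1 / 2 : ℂ) - 1) • besselTerm τ v p t =
      exp (2 * Real.pi * I * ((p.1 : ℤ) * τ.re + v : ℝ) * (p.2 : ℤ)) *
      ((t ^ (-3 / 2 : ℝ) * Real.exp (-(α p ^ 2 * t) - β p ^ 2 / t) : ℝ) : ℂ) := fun p t ht => by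
    have ht' : (0 : ℝ) < t := ht
    rw [besselTerm, hreal, smul_eq_mul, ofReal_mul, ofReal_cpow ht'.le]
    have : ((-1 / 2 : ℂ) - 1) = ((-3 / 2 : ℝ) : ℂ) := by push_cast; norm_num
    rw [this]
    ring
  have hInt : ∀ p, IntegrableOn (fun t : ℝ => (t : ℂ) ^ ((-1 / 2 : ℂ) - 1) • besselTerm τ v p t)
      (Ioi 0) := fun p => by
    refine IntegrableOn.congr_fun ?_ (fun t ht => (hF p t ht).symm) measurableSet_Ioi
    exact (bessel_half (hα p) (hβ p)).1.ofReal.const_mul _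
  have hnorm : ∀ p, ∫ t in Ioi (0 : ℝ), ‖(t : ℂ) ^ ((-1 / 2 : ℂ) - 1) • besselTerm τ v p t‖ =
      √Real.pi / β p * Real.exp (-(2 * α p * β p)) := fun p => by
    rw [← (bessel_half (hα p) (hβ p)).2]
    refine setIntegral_congr_fun measurableSet_Ioi fun t ht => ?_
    have ht' : (0 : ℝ) < t := ht
    rw [hF p t ht, norm_mul, norm_exp_two_pi_mul, one_mul, Complex.norm_real,
      Real.norm_of_nonneg]
    positivity
  have hsum : Summable fun p => √Real.pi / β p * Real.exp (-(2 * α p * β p)) := by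
    refine Summable.of_nonneg_of_le (fun p => ?_) (fun p => ?_)
      (summable_exp_neg_mul (c := 2 * Real.pi * τ.im) (by positivity))
    · have := hβ p
      positivity
    · rw [hval]
      exact div_le_self (Real.exp_pos _).le p.2.one_le_abs
  have key := hasSum_integral_of_summable_integral_norm
    (μ := volume.restrict (Ioi 0))
    (F := fun p (t : ℝ) => (t : ℂ) ^ ((-1 / 2 : ℂ) - 1) • besselTerm τ v p t)
    hInt (by simpa only [hnorm] using hsum)
  have e1 : mellin (besselKernel τ v) (-1 / 2) = ∫ t in Ioi (0 : ℝ),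
      ∑' p, (t : ℂ) ^ ((-1 / 2 : ℂ) - 1) • besselTerm τ v p t := by
    rw [mellin]
    refine setIntegral_congr_fun measurableSet_Ioi fun t ht => ?_
    simp only [smul_eq_mul]
    rw [tsum_mul_left]
    rfl
  rw [e1]
  refine key.congr_fun fun p => ?_
  rw [setIntegral_congr_fun measurableSet_Ioi (hF p), integral_const_mul, integral_complex_ofReal,
    (bessel_half (hα p) (hβ p)).2, hval]

theorem hasMellin_evenKernel_zero_sub_one {s : ℂ} (hs : 1 / 2 < s.re) :
    HasMellin (fun t => (evenKernel 0 t : ℂ) - 1) s (2 * completedRiemannZeta (2 * s)) := by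
  have h := (hurwitzEvenFEPair 0).hasMellin (s := s) hs
  have h2 : (hurwitzEvenFEPair 0).Λ s = 2 * completedRiemannZeta (2 * s) := by
    rw [← completedHurwitzZetaEven_zero, completedHurwitzZetaEven]
    rw [mul_div_cancel_left₀ s two_ne_zero]
    ring
  rw [← h2]
  simpa [hurwitzEvenFEPair, Function.comp] using h

/-- On row m the sum over n is a Gaussian in n centred at -(m Re τ + v), and the theta functional
equation rewrites it as t^(-1/2) times a sum over frequencies k. The frequency k = 0 collects to a
theta constant at (Im τ)²t with its term m = 0 removed; the frequencies k ≠ 0 form `besselKernel`.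
-/
theorem hasSum_theta_rows (τ : UpperHalfPlane) (v : ℝ) {t : ℝ} (ht : 0 < t) :
    HasSum (fun p : NZInt × ℤ => (1 : ℂ) * Real.exp (-Real.pi *
        ‖((p.1 : ℤ) : ℂ) * τ + ((p.2 + v : ℝ) : ℂ)‖ ^ 2 * t))
      ((t : ℂ) ^ (-1 / 2 : ℂ) • (((evenKernel 0 (τ.im ^ 2 * t) : ℂ) - 1) + besselKernel τ v t)) := by
  have hy := τ.im_pos
  have hpi := Real.pi_pos
  have hsq : ∀ m n : ℤ, ‖(m : ℂ) * τ + ((n + v : ℝ) : ℂ)‖ ^ 2 =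
      (n + (m * τ.re + v)) ^ 2 + (m * τ.im) ^ 2 := fun m n => by
    rw [Complex.sq_norm, normSq_apply]
    simp
    ring
  have hterm : ∀ m n : ℤ, Real.exp (-Real.pi * ‖(m : ℂ) * τ + ((n + v : ℝ) : ℂ)‖ ^ 2 * t) =
      Real.exp (-Real.pi * (m * τ.im) ^ 2 * t) *
        Real.exp (-Real.pi * (n + (m * τ.re + v)) ^ 2 * t) := fun m n => by
    rw [hsq, ← Real.exp_add]
    congr 1
    ring
  -- sums over the rows
  have hrow : ∀ m : ℤ, HasSum (fun n : ℤ =>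
      Real.exp (-Real.pi * ‖(m : ℂ) * τ + ((n + v : ℝ) : ℂ)‖ ^ 2 * t))
      (Real.exp (-Real.pi * (m * τ.im) ^ 2 * t) *
        evenKernel ((m * τ.re + v : ℝ) : UnitAddCircle) t) := fun m => by
    simp only [hterm]
    exact (hasSum_int_evenKernel _ ht).mul_left _
  -- the theta functional equation in every row
  have hfe : ∀ m : NZInt, ((Real.exp (-Real.pi * ((m : ℤ) * τ.im) ^ 2 * t) *
        evenKernel (((m : ℤ) * τ.re + v : ℝ) : UnitAddCircle) t : ℝ) : ℂ) =
      (t : ℂ) ^ (-1 / 2 : ℂ) * (Real.exp (-Real.pi * ((m : ℤ) * τ.im) ^ 2 * t) +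
        ∑' k : NZInt, besselTerm τ v (m, k) t) := fun m => by
    have h1 := hasSum_int_cosKernel ((m : ℤ) * τ.re + v) (one_div_pos.2 ht)
    have h2 := hasSum_int_cosKernel₀ ((m : ℤ) * τ.re + v) (one_div_pos.2 ht)
    have h3 : HasSum (fun k : NZInt => exp (2 * Real.pi * I * ((m : ℤ) * τ.re + v : ℝ) * (k : ℤ)) *
        Real.exp (-Real.pi * (k : ℤ) ^ 2 * (1 / t)))
        ((cosKernel (((m : ℤ) * τ.re + v : ℝ) : UnitAddCircle) (1 / t) : ℂ) - 1) := by
      have : HasSum ((fun n : ℤ => exp (2 * Real.pi * I * ((m : ℤ) * τ.re + v : ℝ) * n) *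
        Real.exp (-Real.pi * n ^ 2 * (1 / t))) ∘ (Subtype.val : NZInt → ℤ))
        ((cosKernel (((m : ℤ) * τ.re + v : ℝ) : UnitAddCircle) (1 / t) : ℂ) - 1) := by
        refine (hasSum_subtype_iff_indicator (s := {m : ℤ | m ≠ 0})).2 ?_
        refine h2.congr_fun fun n => ?_
        by_cases hn : n = 0 <;> simp [hn]
      exact this
    have h4 := (h3.mul_left ((Real.exp (-Real.pi * ((m : ℤ) * τ.im) ^ 2 * t) : ℝ) : ℂ))
    have h5 : ∑' k : NZInt, besselTerm τ v (m, k) t =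
        (Real.exp (-Real.pi * ((m : ℤ) * τ.im) ^ 2 * t) : ℝ) *
        ((cosKernel (((m : ℤ) * τ.re + v : ℝ) : UnitAddCircle) (1 / t) : ℂ) - 1) := by
      rw [← h4.tsum_eq]
      refine tsum_congr fun k => ?_
      rw [besselTerm, mul_left_comm, ← ofReal_mul, ← Real.exp_add]
      congr 4
      ring
    rw [h5, evenKernel_functional_equation]
    have h6 : ((1 / t ^ (1 / 2 : ℝ) : ℝ) : ℂ) = (t : ℂ) ^ (-1 / 2 : ℂ) := by
      rw [one_div, ← Real.rpow_neg ht.le, ofReal_cpow ht.le]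
      congr 1
      push_cast
      ring
    push_cast [← h6]
    ring
  have hb := summable_besselTerm τ v ht
  have hbf : HasSum (fun m : NZInt => ∑' k : NZInt, besselTerm τ v (m, k) t)
      (besselKernel τ v t) := hb.hasSum.prod_fiberwise fun m => (hb.prod_factor m).hasSum
  have hev : HasSum (fun m : NZInt => (Real.exp (-Real.pi * ((m : ℤ) * τ.im) ^ 2 * t) : ℂ))
      ((evenKernel 0 (τ.im ^ 2 * t) : ℂ) - 1) := by
    have h2 := hasSum_int_evenKernel₀ 0 (show 0 < τ.im ^ 2 * t by positivity)
    simp only [AddCircle.coe_zero, if_true, add_zero, Int.cast_eq_zero] at h2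
    have h3 : HasSum ((fun n : ℤ => Real.exp (-Real.pi * (n * τ.im) ^ 2 * t)) ∘
        (Subtype.val : NZInt → ℤ)) (evenKernel 0 (τ.im ^ 2 * t) - 1) := by
      refine (hasSum_subtype_iff_indicator (s := {m : ℤ | m ≠ 0})).2 ?_
      refine h2.congr_fun fun n => ?_
      by_cases hn : n = 0
      · simp [hn]
      · simp only [hn, Set.indicator, mem_ofPred_eq, ne_eq, not_false_eq_true, if_true, if_false]
        congr 1
        ring
    have h4 := Complex.hasSum_ofReal.2 h3
    rw [ofReal_sub, ofReal_one] at h4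
    exact h4
  have hrows : HasSum (fun m : NZInt => ((Real.exp (-Real.pi * ((m : ℤ) * τ.im) ^ 2 * t) *
        evenKernel (((m : ℤ) * τ.re + v : ℝ) : UnitAddCircle) t : ℝ) : ℂ))
      ((t : ℂ) ^ (-1 / 2 : ℂ) • (((evenKernel 0 (τ.im ^ 2 * t) : ℂ) - 1) + besselKernel τ v t)) := by
    simp only [hfe]
    exact (hev.add hbf).mul_left _
  have hsum : Summable fun p : NZInt × ℤ => Real.exp (-Real.pi *
        ‖((p.1 : ℤ) : ℂ) * τ + ((p.2 + v : ℝ) : ℂ)‖ ^ 2 * t) := by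
    rw [summable_prod_of_nonneg fun _ => (Real.exp_pos _).le]
    refine ⟨fun m => (hrow m).summable, ?_⟩
    have := Complex.summable_ofReal.1 hrows.summable
    exact this.congr fun m => (hrow m).tsum_eq.symm
  have hsumC := Complex.hasSum_ofReal.2 hsum.hasSum
  have h7 := hsumC.prod_fiberwise fun m => Complex.hasSum_ofReal.2 (hrow m)
  rw [← h7.unique hrows]
  simpa using hsumC

/-- The rows with `m ≠ 0` of the Epstein zeta function. -/
theorem hasSum_epstein_rows (τ : UpperHalfPlane) (v : ℝ) {s : ℂ} (hs : 1 < s.re) :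
    HasSum (fun p : NZInt × ℤ => (‖((p.1 : ℤ) : ℂ) * τ + ((p.2 + v : ℝ) : ℂ)‖ : ℂ) ^ (-2 * s))
      (Real.pi ^ s / Gamma s * (2 * (τ.im : ℂ) ^ (1 - 2 * s) * completedRiemannZeta (2 * s - 1) +
        mellin (besselKernel τ v) (s - 1 / 2))) := by
  have hy := τ.im_pos
  have hpi := Real.pi_pos
  let q : NZInt × ℤ → ℝ := fun p => ‖((p.1 : ℤ) : ℂ) * τ + ((p.2 + v : ℝ) : ℂ)‖
  have hq : ∀ p, 0 < q p := fun p => by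
    rw [norm_pos_iff]
    intro h
    have := congrArg Complex.im h
    simp only [add_im, mul_im, intCast_re, intCast_im, zero_mul, add_zero, ofReal_im,
      zero_im, mul_eq_zero, Int.cast_eq_zero] at this
    rcases this with h | h
    · exact p.1.2 h
    · exact hy.ne' h
  have h1 := hasSum_mellin_pi_mul (s := s) (a := fun _ : NZInt × ℤ => 1) (q := fun p => q p ^ 2)
    (fun p => Or.inr (pow_pos (hq p) 2)) (by linarith)
    (fun t ht => hasSum_theta_rows τ v ht) (by
      refine (summable_shifted τ v (k := 2 * s.re) (by linarith)).congr fun p => ?_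
      rw [norm_one, one_div, ← Real.rpow_natCast, ← Real.rpow_mul (hq p).le, ← Real.rpow_neg (hq p).le]
      rfl)
  -- The factor t^(-1/2) from Poisson summation shifts the Mellin variable to s - 1/2.
  rw [mellin_cpow_smul] at h1
  have hs' : 1 / 2 < (s + -1 / 2).re := by
    simp only [add_re, div_ofNat_re, neg_re, one_re]; linarith
  have h2 := hasMellin_evenKernel_zero_sub_one hs'
  have hy2 : 0 < τ.im ^ 2 := by positivity
  have h3 := (MellinConvergent.comp_mul_left hy2).2 h2.1
  have h4 := (hasMellin_add h3 (mellinConvergent_besselKernel τ v (s + -1 / 2))).2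
  rw [mellin_comp_mul_left (fun t => (evenKernel 0 t : ℂ) - 1) _ hy2, h2.2] at h4
  rw [h4] at h1
  have h5 := h1.mul_left (Real.pi ^ s / Gamma s)
  have hG : Gamma s ≠ 0 := Gamma_ne_zero_of_re_pos (by linarith)
  have hpis : (Real.pi : ℂ) ^ s ≠ 0 := by
    rw [Ne, cpow_eq_zero_iff, not_and_or]
    exact Or.inl (by exact_mod_cast hpi.ne')
  have e1 : ((τ.im ^ 2 : ℝ) : ℂ) ^ (-(s + -1 / 2)) = (τ.im : ℂ) ^ (1 - 2 * s) := by
    rw [ofReal_pow, ← cpow_nat_mul']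
    · congr 1; push_cast; ring
    all_goals rw [arg_ofReal_of_nonneg hy.le]; linarith
  rw [e1, show 2 * (s + -1 / 2) = 2 * s - 1 by ring, show s + -1 / 2 = s - 1 / 2 by ring] at h5
  rw [smul_eq_mul, show (τ.im : ℂ) ^ (1 - 2 * s) * (2 * completedRiemannZeta (2 * s - 1)) =
    2 * (τ.im : ℂ) ^ (1 - 2 * s) * completedRiemannZeta (2 * s - 1) by ring] at h5
  refine h5.congr_fun fun p => ?_
  have e2 : ((q p ^ 2 : ℝ) : ℂ) ^ s = (q p : ℂ) ^ (2 * s) := by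
    rw [ofReal_pow, ← cpow_nat_mul']
    · congr 1
    all_goals rw [arg_ofReal_of_nonneg (hq p).le]; linarith
  change (q p : ℂ) ^ (-2 * s) = _
  rw [e2, cpow_neg, neg_mul, cpow_neg]
  field_simp

end Epstein

end QuadraticOrder

end

/-! ### Kronecker's limit formulas at s = 0. -/

section

open MeasureTheory Filter Topology Set

namespace QuadraticOrder

section Kronecker

open Complex HurwitzZeta

/-- `e(w) = exp (2πiw)`. -/
noncomputable abbrev cexpTwoPi (w : ℂ) : ℂ := exp (2 * Real.pi * I * w)

theorem norm_cexpTwoPi (w : ℂ) : ‖cexpTwoPi w‖ = Real.exp (-(2 * Real.pi * w.im)) := by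
  rw [cexpTwoPi, norm_exp]
  congr 1
  simp

theorem norm_cexpTwoPi_nat_add (τ : UpperHalfPlane) (v : ℝ) (n : ℕ) :
    ‖cexpTwoPi (n * τ + v)‖ = Real.exp (-(2 * Real.pi * τ.im)) ^ n := by
  rw [norm_cexpTwoPi, ← Real.exp_nat_mul]
  congr 1
  simp
  ring

theorem exp_neg_im_lt_one (τ : UpperHalfPlane) : Real.exp (-(2 * Real.pi * τ.im)) < 1 := by
  rw [Real.exp_lt_one_iff]
  have := mul_pos Real.pi_pos τ.im_pos
  linarith

theorem norm_cexpTwoPi_succ_lt_one (τ : UpperHalfPlane) (v : ℝ) (n : ℕ) :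
    ‖cexpTwoPi ((n + 1) * τ + v)‖ < 1 := by
  have := norm_cexpTwoPi_nat_add τ v (n + 1)
  push_cast at this
  rw [this]
  exact pow_lt_one₀ (Real.exp_pos _).le (exp_neg_im_lt_one τ) (Nat.succ_ne_zero n)

theorem one_sub_cexpTwoPi_ne_zero (τ : UpperHalfPlane) (v : ℝ) (n : ℕ) :
    1 - cexpTwoPi ((n + 1) * τ + v) ≠ 0 := by
  intro h
  have := norm_cexpTwoPi_succ_lt_one τ v n
  rw [← sub_eq_zero.1 h, norm_one] at this
  exact lt_irrefl _ this

theorem summable_norm_cexpTwoPi (τ : UpperHalfPlane) (v : ℝ) :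
    Summable fun n : ℕ => ‖-cexpTwoPi ((n + 1) * τ + v)‖ := by
  have h := (summable_nat_add_iff 1).2
    (summable_geometric_of_lt_one (Real.exp_pos _).le (exp_neg_im_lt_one τ))
  refine h.congr fun n => ?_
  rw [norm_neg, ← norm_cexpTwoPi_nat_add τ v (n + 1)]
  push_cast
  rfl

theorem multipliable_one_sub_cexpTwoPi (τ : UpperHalfPlane) (v : ℝ) :
    Multipliable fun n : ℕ => 1 - cexpTwoPi ((n + 1) * τ + v) := by
  simpa only [sub_eq_add_neg] using
    multipliable_one_add_of_summable (summable_norm_cexpTwoPi τ v)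

/-- The product over the rows in the Siegel function. -/
noncomputable def rowProd (τ : UpperHalfPlane) (v : ℝ) : ℂ :=
  ∏' n : ℕ, ((1 - cexpTwoPi ((n + 1) * τ + v)) * (1 - cexpTwoPi ((n + 1) * τ - v)))

/-- The sum of a row of the Bessel expansion at `s = 0`. -/
theorem hasSum_bessel_row {r X : ℝ} (hr : 0 < r) :
    HasSum (fun k : NZInt => exp (2 * Real.pi * I * X * (k : ℤ)) *
      (Real.exp (-(r * |((k : ℤ) : ℝ)|)) / |((k : ℤ) : ℝ)| : ℝ))
      (-2 * (Real.log ‖1 - exp (2 * Real.pi * I * X) * Real.exp (-r)‖ : ℂ)) := by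
  set w : ℂ := exp (2 * Real.pi * I * X) * Real.exp (-r) with hw
  -- The division by |k| gives f 0 = 0, so f may be summed over all integers and split into two
  -- logarithm series.
  let f : ℤ → ℂ := fun k => exp (2 * Real.pi * I * X * k) *
      (Real.exp (-(r * |(k : ℝ)|)) / |(k : ℝ)| : ℝ)
  have hwn : ‖w‖ < 1 := by
    have := norm_exp_two_pi_mul X 1
    rw [Int.cast_one, mul_one] at this
    rw [hw, norm_mul, this, one_mul, Complex.norm_real, Real.norm_of_nonneg (Real.exp_pos _).le]
    simpa using hr
  have hwc : ‖(starRingEnd ℂ) w‖ < 1 := by simpa using hwn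
  have h1 : HasSum (fun n : ℕ => f n) (-log (1 - w)) := by
    refine (hasSum_taylorSeries_neg_log hwn).congr_fun fun n => ?_
    simp only [f, hw, mul_pow, ← Complex.exp_nat_mul, ofReal_div, ofReal_exp, Int.cast_natCast,
      Nat.abs_cast, ofReal_natCast]
    rw [mul_div_assoc]
    congr 1
    · congr 1; ring
    · congr 2; push_cast; ring
  have h2 : HasSum (fun n : ℕ => f (-(n + 1))) (-log (1 - (starRingEnd ℂ) w)) := by
    have h3 := hasSum_taylorSeries_neg_log hwc
    rw [← hasSum_nat_add_iff' 1] at h3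
    simp only [Finset.range_one, Finset.sum_singleton, Nat.cast_zero, div_zero, sub_zero] at h3
    refine h3.congr_fun fun n => ?_
    have e1 : (starRingEnd ℂ) w = exp (-(2 * Real.pi * I * X)) * Real.exp (-r) := by
      rw [hw, map_mul, conj_ofReal, ← exp_conj]
      simp [Complex.conj_ofNat]
    have e2 : |((-(n + 1 : ℤ) : ℤ) : ℝ)| = (n : ℝ) + 1 := by
      push_cast
      rw [abs_neg, abs_of_nonneg (by positivity)]
    simp only [f, e2, e1, mul_pow, ← Complex.exp_nat_mul, ofReal_div, ofReal_exp]
    rw [mul_div_assoc]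
    congr 1
    · congr 1; push_cast; ring
    · congr 1
      · congr 1; push_cast; ring
      · push_cast; ring
  have h3 := HasSum.of_nat_of_neg_add_one h1 h2
  have h4 : -log (1 - w) + -log (1 - (starRingEnd ℂ) w) = -2 * (Real.log ‖1 - w‖ : ℂ) := by
    have hne : (1 - w).arg ≠ Real.pi := by
      intro h
      have h5 := (arg_eq_pi_iff.1 h).1
      have h6 := (re_le_norm w).trans_lt hwn
      simp only [sub_re, one_re] at h5
      linarith
    rw [show 1 - (starRingEnd ℂ) w = (starRingEnd ℂ) (1 - w) by simp, log_conj _ hne]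
    apply Complex.ext
    · simp [log_re]; ring
    · simp
  rw [h4] at h3
  have hinj : Function.Injective (Subtype.val : NZInt → ℤ) := Subtype.val_injective
  refine (hinj.hasSum_iff fun x hx => ?_).2 h3
  have : x = 0 := by
    by_contra h
    exact hx ⟨⟨x, h⟩, rfl⟩
  simp [f, this]

/-- Complex conjugation reverses the sign of the real part of the exponent's argument, so the row
-(n + 1) produces the factor with z⁻¹ in the Siegel product. -/
theorem norm_one_sub_neg_row (τ : UpperHalfPlane) (v : ℝ) (n : ℕ) :
    ‖1 - exp (2 * Real.pi * I * ((-(n + 1 : ℝ) * τ.re + v : ℝ) : ℂ)) *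
      Real.exp (-(2 * Real.pi * τ.im * (n + 1)))‖ = ‖1 - cexpTwoPi ((n + 1) * τ - v)‖ := by
  rw [← norm_conj (1 - cexpTwoPi ((n + 1) * τ - v))]
  congr 1
  rw [map_sub, map_one, cexpTwoPi, ← exp_conj, ofReal_exp, ← Complex.exp_add]
  congr 2
  have : (τ : ℂ) = τ.re + τ.im * I := (re_add_im (τ : ℂ)).symm
  rw [this]
  simp only [map_mul, map_sub, map_add, map_one, conj_ofReal, conj_I, Complex.conj_ofNat,
    map_natCast]
  push_cast
  linear_combination (-2 * Real.pi * (n + 1) * τ.im : ℂ) * I_sq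

theorem norm_one_sub_pos_row (τ : UpperHalfPlane) (v : ℝ) (n : ℕ) :
    ‖1 - exp (2 * Real.pi * I * (((n + 1 : ℝ) * τ.re + v : ℝ) : ℂ)) *
      Real.exp (-(2 * Real.pi * τ.im * (n + 1)))‖ = ‖1 - cexpTwoPi ((n + 1) * τ + v)‖ := by
  congr 2
  rw [cexpTwoPi, ofReal_exp, ← Complex.exp_add]
  congr 1
  have : (τ : ℂ) = τ.re + τ.im * I := (re_add_im (τ : ℂ)).symm
  rw [this]
  push_cast
  linear_combination (-2 * Real.pi * (n + 1) * τ.im : ℂ) * I_sq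

/-- Summing over k first turns row m into -2 log of the modulus of one factor. The rows m and -m
together give the two factors at index |m| of the product. -/
theorem mellin_besselKernel_eq_log_rowProd (τ : UpperHalfPlane) (v : ℝ) :
    mellin (besselKernel τ v) (-1 / 2) = -2 * (Real.log ‖rowProd τ v‖ : ℂ) := by
  let g : ℤ → ℂ := fun m => if m = 0 then 0 else
    -2 * (Real.log ‖1 - exp (2 * Real.pi * I * ((m * τ.re + v : ℝ) : ℂ)) *
      Real.exp (-(2 * Real.pi * τ.im * |(m : ℝ)|))‖ : ℂ)
  have hrow : ∀ m : NZInt, HasSum (fun k : NZInt =>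
      exp (2 * Real.pi * I * ((m : ℤ) * τ.re + v : ℝ) * (k : ℤ)) *
        (Real.exp (-(2 * Real.pi * τ.im * (|((m : ℤ) : ℝ)| * |((k : ℤ) : ℝ)|))) /
          |((k : ℤ) : ℝ)| : ℝ)) (g m) := fun m => by
    have hr : 0 < 2 * Real.pi * τ.im * |((m : ℤ) : ℝ)| := by
      have := m.one_le_abs
      have := τ.im_pos
      have := Real.pi_pos
      positivity
    have := hasSum_bessel_row (X := (m : ℤ) * τ.re + v) hr
    simp only [g, if_neg m.2]
    refine this.congr_fun fun k => ?_
    rw [mul_assoc (2 * Real.pi * τ.im)]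
  have h1 := (mellin_besselKernel_neg_half τ v).prod_fiberwise hrow
  have h2 : HasSum g (mellin (besselKernel τ v) (-1 / 2)) := by
    refine ((Subtype.val_injective (p := fun m : ℤ => m ≠ 0)).hasSum_iff fun x hx => ?_).1 h1
    have : x = 0 := by
      by_contra h
      exact hx ⟨⟨x, h⟩, rfl⟩
    simp [g, this]
  have h3 := h2.nat_add_neg
  rw [← hasSum_nat_add_iff' 1] at h3
  have hg0 : g 0 = 0 := by simp [g]
  simp only [Finset.range_one, Finset.sum_singleton, Nat.cast_zero, neg_zero, hg0, add_zero,
    sub_zero] at h3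
  have h4 : HasSum (fun n : ℕ => ((-2 * Real.log ‖(1 - cexpTwoPi ((n + 1) * τ + v)) *
      (1 - cexpTwoPi ((n + 1) * τ - v))‖ : ℝ) : ℂ)) (mellin (besselKernel τ v) (-1 / 2)) := by
    refine h3.congr_fun fun n => ?_
    have hp : ((n + 1 : ℕ) : ℤ) ≠ 0 := by exact_mod_cast Nat.succ_ne_zero n
    have hn : -((n + 1 : ℕ) : ℤ) ≠ 0 := neg_ne_zero.2 hp
    have habs : |((n : ℝ) + 1)| = (n : ℝ) + 1 := abs_of_nonneg (by positivity)
    have hneg := norm_one_sub_neg_row τ v n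
    have hpos := norm_one_sub_pos_row τ v n
    have h0 := one_sub_cexpTwoPi_ne_zero τ v n
    have h0' := one_sub_cexpTwoPi_ne_zero τ (-v) n
    rw [ofReal_neg, ← sub_eq_add_neg] at h0'
    rw [norm_mul, Real.log_mul (norm_ne_zero_iff.2 h0) (norm_ne_zero_iff.2 h0')]
    have eg1 : g ((n + 1 : ℕ) : ℤ) =
        -2 * (Real.log ‖1 - cexpTwoPi ((n + 1) * τ + v)‖ : ℂ) := by
      simp only [g, if_neg hp]
      rw [Int.cast_natCast, Nat.cast_add_one, habs, hpos]
    have eg2 : g (-((n + 1 : ℕ) : ℤ)) =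
        -2 * (Real.log ‖1 - cexpTwoPi ((n + 1) * τ - v)‖ : ℂ) := by
      simp only [g, if_neg hn]
      rw [Int.cast_neg, Int.cast_natCast, Nat.cast_add_one, abs_neg, habs, hneg]
    rw [eg1, eg2]
    push_cast
    ring
  -- The sum of logarithms is compared with the product by exponentiating: both sides are limits of
  -- the same product of moduli.
  have h5 := Complex.hasSum_re h4
  simp only [ofReal_re] at h5
  have h6 := (h5.div_const (-2)).rexp
  have h7 : HasProd (fun n : ℕ => ‖(1 - cexpTwoPi ((n + 1) * τ + v)) *
      (1 - cexpTwoPi ((n + 1) * τ - v))‖) ‖rowProd τ v‖ := by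
    have := (multipliable_one_sub_cexpTwoPi τ v).mul (multipliable_one_sub_cexpTwoPi τ (-v))
    simp only [ofReal_neg, ← sub_eq_add_neg] at this
    exact this.hasProd.norm
  have h8 : ‖rowProd τ v‖ = Real.exp ((mellin (besselKernel τ v) (-1 / 2)).re / -2) := by
    refine h7.unique (h6.congr_fun fun n => ?_)
    have h0 := one_sub_cexpTwoPi_ne_zero τ v n
    have h0' := one_sub_cexpTwoPi_ne_zero τ (-v) n
    rw [ofReal_neg, ← sub_eq_add_neg] at h0'
    simp only [Function.comp]
    rw [mul_div_cancel_left₀ _ (by norm_num), Real.exp_log (norm_pos_iff.2 (mul_ne_zero h0 h0'))]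
  have him : (mellin (besselKernel τ v) (-1 / 2)).im = 0 := by
    have := Complex.hasSum_im h4
    simp only [ofReal_im] at this
    exact this.unique hasSum_zero
  have hre : mellin (besselKernel τ v) (-1 / 2) = ((mellin (besselKernel τ v) (-1 / 2)).re : ℂ) :=
    Complex.ext rfl (by simp [him])
  rw [h8, Real.log_exp]
  conv_lhs => rw [hre]
  push_cast
  ring

/-- The Hurwitz zeta function without its pole. -/
noncomputable def hurwitzReg (a : UnitAddCircle) (w : ℂ) : ℂ :=
  hurwitzZetaEven a w - 1 / (w - 1) / Gammaℝ w

theorem differentiable_hurwitzReg (a : UnitAddCircle) : Differentiable ℂ (hurwitzReg a) := by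
  intro w
  rcases eq_or_ne w 1 with rfl | hw
  · exact differentiableAt_hurwitzZetaEven_sub_one_div a
  · refine (differentiableAt_hurwitzZetaEven a hw).sub ?_
    simp only [div_eq_mul_inv _ (Gammaℝ _)]
    refine DifferentiableAt.mul ?_ differentiable_Gammaℝ_inv.differentiableAt
    exact (differentiableAt_const _).div (differentiableAt_id.sub_const 1) (sub_ne_zero.2 hw)

/-- The second factor in the continuation of the Epstein zeta function. -/
noncomputable def epsteinFactor (τ : UpperHalfPlane) (v : ℝ) (s : ℂ) : ℂ :=
  dslope (fun s : ℂ => 1 - (τ.im : ℂ) ^ (1 - 2 * s)) (1 / 2) s +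
    2 * (τ.im : ℂ) ^ (1 - 2 * s) * (completedRiemannZeta₀ (2 * s - 1) - 1 / (2 - 2 * s)) +
    mellin (besselKernel τ v) (s - 1 / 2)

/-- The analytic continuation of `∑ |mτ + n + v| ^ (-2s)`. -/
noncomputable def epsteinZeta (τ : UpperHalfPlane) (v : ℝ) (s : ℂ) : ℂ :=
  2 * hurwitzReg v (2 * s) + Real.pi ^ s * (Gamma s)⁻¹ * epsteinFactor τ v s

theorem differentiable_im_cpow (τ : UpperHalfPlane) :
    Differentiable ℂ fun s : ℂ => (τ.im : ℂ) ^ (1 - 2 * s) := by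
  have h : (τ.im : ℂ) ≠ 0 := by exact_mod_cast τ.im_pos.ne'
  intro s
  exact DifferentiableAt.const_cpow (by fun_prop) (Or.inl h)

theorem differentiableAt_epsteinFactor (τ : UpperHalfPlane) (v : ℝ) {s : ℂ} (hs : s ≠ 1) :
    DifferentiableAt ℂ (epsteinFactor τ v) s := by
  have h1 : Differentiable ℂ (dslope (fun s : ℂ => 1 - (τ.im : ℂ) ^ (1 - 2 * s)) (1 / 2)) := by
    rw [← differentiableOn_univ, Complex.differentiableOn_dslope univ_mem, differentiableOn_univ]
    exact (differentiable_const 1).sub (differentiable_im_cpow τ)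
  refine ((h1 s).add ?_).add ?_
  · refine (((differentiable_im_cpow τ) s).const_mul 2).mul (DifferentiableAt.sub ?_ ?_)
    · exact (differentiable_completedZeta₀ _).comp s
        (by fun_prop : DifferentiableAt ℂ (fun s : ℂ => 2 * s - 1) s)
    · refine (differentiableAt_const _).div (by fun_prop) ?_
      intro h
      exact hs (by linear_combination (-1 / 2 : ℂ) * h)
  · exact (differentiable_mellin_besselKernel τ v _).comp s
      (by fun_prop : DifferentiableAt ℂ (fun s : ℂ => s - 1 / 2) s)

theorem differentiableAt_epsteinZeta (τ : UpperHalfPlane) (v : ℝ) {s : ℂ} (hs : s ≠ 1) :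
    DifferentiableAt ℂ (epsteinZeta τ v) s := by
  refine DifferentiableAt.add ?_ (DifferentiableAt.mul (DifferentiableAt.mul ?_ ?_) ?_)
  · exact ((differentiable_hurwitzReg v _).comp s (by fun_prop)).const_mul 2
  · exact differentiableAt_id.const_cpow (Or.inl (by exact_mod_cast Real.pi_ne_zero))
  · exact differentiable_one_div_Gamma s
  · exact differentiableAt_epsteinFactor τ v hs

/-- At s = 1/2 the row m = 0 and the zero-frequency term each have a pole, and these cancel.
`hurwitzReg` removes the first, and the `dslope` in `epsteinFactor` is the combination (1 -
y^(1-2s))/(s - 1/2) that both polar parts leave, where y = Im τ. Away from 1/2 the unregularised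
formula is recovered by 1/Γ_ℝ(2s) = πˢ/Γ(s). -/
theorem epsteinZeta_eq (τ : UpperHalfPlane) (v : ℝ) {s : ℂ} (hs : s ≠ 1 / 2) :
    epsteinZeta τ v s = 2 * hurwitzZetaEven v (2 * s) + Real.pi ^ s * (Gamma s)⁻¹ *
      (2 * (τ.im : ℂ) ^ (1 - 2 * s) * completedRiemannZeta (2 * s - 1) +
        mellin (besselKernel τ v) (s - 1 / 2)) := by
  have h2 : (2 * s - 1 : ℂ) ≠ 0 := fun h => hs (by linear_combination (1 / 2 : ℂ) * h)
  have hpi : (Real.pi : ℂ) ^ s ≠ 0 := by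
    rw [Ne, cpow_eq_zero_iff, not_and_or]
    exact Or.inl (by exact_mod_cast Real.pi_ne_zero)
  have hG : (Gammaℝ (2 * s))⁻¹ = Real.pi ^ s * (Gamma s)⁻¹ := by
    rw [Gammaℝ_def, mul_div_cancel_left₀ s two_ne_zero, neg_div, mul_div_cancel_left₀ s two_ne_zero,
      cpow_neg, mul_inv, inv_inv]
  rw [epsteinZeta, epsteinFactor, hurwitzReg, dslope_of_ne _ hs, slope_def_field,
    completedRiemannZeta_eq, div_eq_mul_inv _ (Gammaℝ _), hG]
  have e0 : (1 - 2 * (1 / 2) : ℂ) = 0 := by norm_num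
  have e1 : (1 - (2 * s - 1) : ℂ) = 2 - 2 * s := by ring
  have e2 : s - 1 / 2 = (2 * s - 1) / 2 := by ring
  simp only [e0, cpow_zero, sub_self, sub_zero, e1]
  rw [e2]
  field_simp
  ring

theorem hasSum_epsteinZeta (τ : UpperHalfPlane) (v : ℝ) {s : ℂ} (hs : 1 < s.re) :
    HasSum (fun p : ℤ × ℤ => (‖(p.1 : ℂ) * τ + ((p.2 + v : ℝ) : ℂ)‖ : ℂ) ^ (-2 * s))
      (epsteinZeta τ v s) := by
  have hs2 : s ≠ 1 / 2 := by
    rintro rfl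
    norm_num at hs
  rw [epsteinZeta_eq τ v hs2]
  have h1 := hasSum_epstein_rows τ v hs
  rw [div_eq_mul_inv] at h1
  have h2 := (hasSum_int_hurwitzZetaEven v (s := 2 * s) (by
    rw [mul_re]; norm_num; linarith)).mul_left 2
  let f : ℤ × ℤ → ℂ := fun p => (‖(p.1 : ℂ) * τ + ((p.2 + v : ℝ) : ℂ)‖ : ℂ) ^ (-2 * s)
  have h3 : HasSum (fun p : ℤ × ℤ => if p.1 = 0 then f p else 0)
      (2 * hurwitzZetaEven v (2 * s)) := by
    have hinj : Function.Injective fun n : ℤ => ((0 : ℤ), n) := fun a b h => (Prod.ext_iff.1 h).2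
    refine (hinj.hasSum_iff fun p hp => ?_).1 (h2.congr_fun fun n => ?_)
    · rw [if_neg]
      intro h
      exact hp ⟨p.2, Prod.ext h.symm rfl⟩
    · simp only [Function.comp, if_true, f, Int.cast_zero, zero_mul, zero_add, Complex.norm_real,
        Real.norm_eq_abs]
      rw [neg_mul, cpow_neg]
      ring
  have h4 : HasSum (fun p : ℤ × ℤ => if p.1 = 0 then 0 else f p) (Real.pi ^ s * (Gamma s)⁻¹ *
      (2 * (τ.im : ℂ) ^ (1 - 2 * s) * completedRiemannZeta (2 * s - 1) +
        mellin (besselKernel τ v) (s - 1 / 2))) := by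
    have hinj : Function.Injective fun p : NZInt × ℤ => ((p.1 : ℤ), p.2) := by
      rintro ⟨⟨a, ha⟩, b⟩ ⟨⟨c, hc⟩, d⟩ h
      simp at h
      simp [h]
    refine (hinj.hasSum_iff fun p hp => ?_).1 (h1.congr_fun fun n => ?_)
    · rw [if_pos]
      by_contra h
      exact hp ⟨(⟨p.1, h⟩, p.2), rfl⟩
    · simp only [Function.comp, if_neg n.1.2, f]
  refine (h3.add h4).congr_fun fun p => ?_
  by_cases h : p.1 = 0 <;> simp [h, f]

theorem completedRiemannZeta_neg_one : completedRiemannZeta (-1) = Real.pi / 6 := by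
  have h1 := completedRiemannZeta_one_sub 2
  rw [show (1 - 2 : ℂ) = -1 by norm_num] at h1
  have h2 := riemannZeta_def_of_ne_zero (two_ne_zero (α := ℂ))
  have hpi : (Real.pi : ℂ) ≠ 0 := by exact_mod_cast Real.pi_ne_zero
  have h3 : Gammaℝ 2 = (Real.pi : ℂ)⁻¹ := by
    rw [Gammaℝ_def, neg_div, div_self two_ne_zero, cpow_neg_one, Gamma_one, mul_one]
  rw [riemannZeta_two, h3, div_inv_eq_mul] at h2
  rw [h1]
  apply mul_right_cancel₀ hpi
  rw [← h2]
  ring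

theorem epsteinZeta_zero (τ : UpperHalfPlane) (v : ℝ) :
    epsteinZeta τ v 0 = 2 * hurwitzZetaEven v 0 := by
  -- The convention Γ(0) = 0 makes the inverse 0, which is the true value of 1/Γ there; only the row
  -- m = 0 survives.
  rw [epsteinZeta_eq τ v (by norm_num), Complex.Gamma_zero]
  simp

/-- Writing 1/Γ(s) = s/Γ(s + 1), the rows m ≠ 0 contribute s A(s) with A regular at 0, so their
derivative is A(0). The term π Im τ/3 is 2 Im τ times the completed zeta value π/6 at -1. The
coefficient 4 comes from the two signs in the row m = 0 and the argument 2s. -/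
theorem hasDerivAt_epsteinZeta_zero (τ : UpperHalfPlane) (v : ℝ) {d : ℂ}
    (hd : HasDerivAt (hurwitzZetaEven v) d 0) :
    HasDerivAt (epsteinZeta τ v)
      (4 * d + Real.pi * τ.im / 3 - 2 * (Real.log ‖rowProd τ v‖ : ℂ)) 0 := by
  let B : ℂ → ℂ := fun s => 2 * (τ.im : ℂ) ^ (1 - 2 * s) * completedRiemannZeta (2 * s - 1) +
        mellin (besselKernel τ v) (s - 1 / 2)
  let A : ℂ → ℂ := fun s => Real.pi ^ s * (Gamma (s + 1))⁻¹ * B s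
  have hBd : DifferentiableAt ℂ B 0 := by
    refine DifferentiableAt.add (((differentiable_im_cpow τ 0).const_mul 2).mul ?_) ?_
    · exact DifferentiableAt.comp (0 : ℂ)
        (differentiableAt_completedZeta (by norm_num) (by norm_num)) (by fun_prop)
    · exact (differentiable_mellin_besselKernel τ v _).comp (0 : ℂ) (by fun_prop)
  have hAd : DifferentiableAt ℂ A 0 := by
    refine DifferentiableAt.mul (DifferentiableAt.mul ?_ ?_) hBd
    · exact differentiableAt_id.const_cpow (Or.inl (by exact_mod_cast Real.pi_ne_zero))
    · exact (differentiable_one_div_Gamma _).comp (0 : ℂ) (by fun_prop)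
  have hA0 : A 0 = Real.pi * τ.im / 3 - 2 * (Real.log ‖rowProd τ v‖ : ℂ) := by
    have h := mellin_besselKernel_eq_log_rowProd τ v
    simp only [A, B, cpow_zero, zero_add, Gamma_one, inv_one, mul_one, mul_zero, sub_zero, cpow_one,
      zero_sub, completedRiemannZeta_neg_one, one_mul]
    rw [← neg_div, h]
    ring
  have h1 : HasDerivAt (fun s : ℂ => s * A s) (A 0) 0 := by
    have := (hasDerivAt_id (0 : ℂ)).fun_mul hAd.hasDerivAt
    simpa using this
  have h2 : HasDerivAt (fun s : ℂ => 2 * hurwitzZetaEven v (2 * s)) (2 * (d * 2)) 0 := by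
    have e : HasDerivAt (fun s : ℂ => 2 * s) 2 0 := by
      simpa using (hasDerivAt_id (0 : ℂ)).const_mul 2
    have hd' : HasDerivAt (hurwitzZetaEven v) d (2 * 0) := by rwa [mul_zero]
    exact (hd'.comp (0 : ℂ) e).const_mul 2
  have h3 := h2.add h1
  rw [hA0] at h3
  refine (h3.congr_of_eventuallyEq ?_).congr_deriv (by ring)
  filter_upwards [eventually_ne_nhds (show (0 : ℂ) ≠ 1 / 2 by norm_num)] with s hs
  rw [epsteinZeta_eq τ v hs, one_div_Gamma_eq_self_mul_one_div_Gamma_add_one]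
  simp only [A, B, Pi.add_apply]
  ring

theorem siegel_zero_eq (v : ℚ) (τ : UpperHalfPlane) :
    siegel 0 v τ = -(exp (2 * Real.pi * I * ((τ : ℂ) / 12)) * exp (-(Real.pi * I * v))) *
      (1 - cexpTwoPi v) * rowProd τ v := by
  simp only [siegel, rowProd, cexpTwoPi, Rat.cast_zero, zero_mul, zero_add, ofReal_ratCast]
  have e1 : (τ : ℂ) * (0 ^ 2 - 0 + 1 / 6) / 2 = τ / 12 := by ring
  have e2 : (Real.pi : ℂ) * I * v * (0 - 1) = -(Real.pi * I * v) := by ring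
  rw [e1, e2]
  ring

theorem norm_siegel_zero (v : ℚ) (τ : UpperHalfPlane) :
    ‖siegel 0 v τ‖ =
      Real.exp (-(Real.pi * τ.im / 6)) * ‖1 - cexpTwoPi v‖ * ‖rowProd τ v‖ := by
  rw [siegel_zero_eq, norm_mul, norm_mul, norm_neg, norm_mul, norm_exp, norm_exp]
  have e1 : (2 * Real.pi * I * ((τ : ℂ) / 12)).re = -(Real.pi * τ.im / 6) := by
    have : (2 * Real.pi * I * ((τ : ℂ) / 12)) = ((Real.pi / 6 : ℝ) : ℂ) * (I * τ) := by
      push_cast; ring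
    rw [this, re_ofReal_mul]
    simp
    ring
  have e2 : (-(Real.pi * I * v) : ℂ).re = 0 := by
    have : (-(Real.pi * I * v) : ℂ) = ((-(Real.pi * v) : ℝ) : ℂ) * I := by push_cast; ring
    rw [this, re_ofReal_mul]
    simp
  rw [e1, e2, Real.exp_zero, mul_one]

theorem rowProd_ne_zero (τ : UpperHalfPlane) (v : ℝ) : rowProd τ v ≠ 0 := by
  have h (w : ℝ) : ∏' n : ℕ, (1 - cexpTwoPi ((n + 1) * τ + w)) ≠ 0 := by
    have := tprod_one_add_ne_zero_of_summable (f := fun n : ℕ => -cexpTwoPi ((n + 1) * τ + w))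
      (fun n => by simpa [sub_eq_add_neg] using one_sub_cexpTwoPi_ne_zero τ w n)
      (summable_norm_cexpTwoPi τ w)
    simpa [sub_eq_add_neg] using this
  have h2 := h (-v)
  simp only [ofReal_neg, ← sub_eq_add_neg] at h2
  have h3 := multipliable_one_sub_cexpTwoPi τ (-v)
  simp only [ofReal_neg, ← sub_eq_add_neg] at h3
  rw [rowProd, (multipliable_one_sub_cexpTwoPi τ v).tprod_mul h3]
  exact mul_ne_zero (h v) h2

/-- Kronecker's second limit formula at `s = 0`. -/
theorem hasDerivAt_epsteinZeta_of_ne (τ : UpperHalfPlane) {v : ℚ}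
    (hv : ((v : ℝ) : UnitAddCircle) ≠ 0) :
    HasDerivAt (epsteinZeta τ v) (-2 * (Real.log ‖siegel 0 v τ‖ : ℂ)) 0 := by
  refine (hasDerivAt_epsteinZeta_zero τ v (hasDerivAt_hurwitzZetaEven_zero hv)).congr_deriv ?_
  have h1 : (1 - cexpTwoPi v) ≠ 0 := by
    intro h
    have h2 := (sub_eq_zero.1 h).symm
    rw [cexpTwoPi, Complex.exp_eq_one_iff] at h2
    obtain ⟨n, hn⟩ := h2
    have h3 : (v : ℂ) = n := by
      have h2 : (2 * Real.pi * I : ℂ) ≠ 0 := by simp [Real.pi_ne_zero]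
      apply mul_left_cancel₀ h2
      rw [hn]; ring
    have h4 : (v : ℝ) = n := by exact_mod_cast h3
    apply hv
    rw [AddCircle.coe_eq_zero_iff]
    exact ⟨n, by simp [h4]⟩
  rw [norm_siegel_zero, Real.log_mul (mul_ne_zero (Real.exp_ne_zero _) (norm_ne_zero_iff.2 h1))
    (norm_ne_zero_iff.2 (rowProd_ne_zero τ v)), Real.log_mul (Real.exp_ne_zero _)
    (norm_ne_zero_iff.2 h1), Real.log_exp]
  simp only [cexpTwoPi, ofReal_ratCast]
  push_cast
  ring

theorem epsteinZeta_zero_of_ne (τ : UpperHalfPlane) {v : ℝ} (hv : (v : UnitAddCircle) ≠ 0) :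
    epsteinZeta τ v 0 = 0 := by
  rw [epsteinZeta_zero, hurwitzZetaEven_apply_zero, if_neg hv, mul_zero]

theorem epsteinZeta_zero_zero (τ : UpperHalfPlane) : epsteinZeta τ 0 0 = -1 := by
  rw [epsteinZeta_zero, hurwitzZetaEven_apply_zero, if_pos (AddCircle.coe_zero _)]
  norm_num

theorem norm_discriminant_eq (τ : UpperHalfPlane) : ‖ModularForm.discriminant τ‖ =
    Real.exp (-(2 * Real.pi * τ.im)) * ‖rowProd τ 0‖ ^ 12 := by
  have h1 : rowProd τ 0 = (∏' n : ℕ, (1 - ModularForm.eta_q n τ)) ^ 2 := by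
    have hm := multipliable_one_sub_cexpTwoPi τ 0
    simp only [ofReal_zero, add_zero] at hm
    simp only [rowProd, ofReal_zero, add_zero, sub_zero]
    rw [hm.tprod_mul hm, sq]
    have : ∀ n : ℕ, cexpTwoPi ((n + 1) * τ) = ModularForm.eta_q n τ := fun n => by
      rw [ModularForm.eta_q_eq_cexp, cexpTwoPi]
      congr 1
      ring
    simp only [this]
  have h2 : Function.Periodic.qParam 24 (τ : ℂ) ^ 24 = cexpTwoPi τ := by
    rw [Function.Periodic.qParam, ← Complex.exp_nat_mul, cexpTwoPi]
    congr 1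
    push_cast
    ring
  have h3 : ‖cexpTwoPi τ‖ = Real.exp (-(2 * Real.pi * τ.im)) := norm_cexpTwoPi _
  rw [ModularForm.discriminant, ModularForm.eta, mul_pow, h2, norm_mul, h3, h1, norm_pow, norm_pow,
    ← pow_mul]

/-- Kronecker's first limit formula at `s = 0`. -/
theorem hasDerivAt_epsteinZeta_zero_zero (τ : UpperHalfPlane) :
    HasDerivAt (epsteinZeta τ 0)
      (-(1 / 6) * (Real.log ((2 * Real.pi) ^ 12 * ‖ModularForm.discriminant τ‖) : ℂ)) 0 := by
  have hd : HasDerivAt (hurwitzZetaEven ((0 : ℝ) : UnitAddCircle))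
      (-(Real.log (2 * Real.pi) : ℂ) / 2) 0 := by
    rw [AddCircle.coe_zero, hurwitzZetaEven_zero]
    have := (differentiableAt_riemannZeta (s := 0) (by norm_num)).hasDerivAt
    rw [deriv_riemannZeta_zero] at this
    rw [ofReal_log (by have := Real.pi_pos; positivity)]
    push_cast
    exact this
  refine (hasDerivAt_epsteinZeta_zero τ 0 hd).congr_deriv ?_
  have h1 := norm_ne_zero_iff.2 (rowProd_ne_zero τ 0)
  have hpi := Real.pi_pos
  rw [norm_discriminant_eq, Real.log_mul (by positivity)
    (mul_ne_zero (Real.exp_ne_zero _) (pow_ne_zero _ h1)), Real.log_mul (Real.exp_ne_zero _)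
    (pow_ne_zero _ h1), Real.log_pow, Real.log_pow, Real.log_exp]
  push_cast
  ring

end Kronecker

end QuadraticOrder

end

/-! ### Galois conjugates of the powers of Siegel functions. -/

section

open Filter Topology Set
open scoped MatrixGroups

namespace QuadraticOrder

section Fourier

open Complex

theorem isPrimitiveRoot_zetaN {N : ℕ} (hN : N ≠ 0) : IsPrimitiveRoot (zetaN N) N :=
  Complex.isPrimitiveRoot_exp N hN

theorem isPrimitiveRoot_zetaN' {N : ℕ} (hN : N ≠ 0) : IsPrimitiveRoot (zetaN' N) N := by
  have h : IsPrimitiveRoot (algebraMap (cyclotomic N) ℂ (zetaN' N)) N := isPrimitiveRoot_zetaN hN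
  exact IsPrimitiveRoot.of_map_of_injective h (algebraMap (cyclotomic N) ℂ).injective

/-- For d prime to N both ζ and ζᵈ are primitive roots, with the same minimal polynomial because the
cyclotomic polynomial is irreducible over ℚ. -/
theorem exists_cyclotomic_aut {N : ℕ} (hN : N ≠ 0) {d : ℤ} (hd : IsCoprime d (N : ℤ)) :
    ∃ σ : cyclotomic N ≃ₐ[ℚ] cyclotomic N, σ (zetaN' N) = zetaN' N ^ d := by
  have : NeZero N := ⟨hN⟩
  have : IsCyclotomicExtension {N} ℚ (cyclotomic N) :=
    (IntermediateField.isCyclotomicExtension_singleton_iff_eq_adjoin N _ _ _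
      (isPrimitiveRoot_zetaN hN)).2 rfl
  have hζ := isPrimitiveRoot_zetaN' hN
  have hζd : IsPrimitiveRoot (zetaN' N ^ d) N := by
    refine hζ.zpow_of_gcd_eq_one d ?_
    exact Int.isCoprime_iff_gcd_eq_one.1 hd
  have hirr := Polynomial.cyclotomic.irreducible_rat (Nat.pos_of_ne_zero hN)
  refine ⟨(hζ.powerBasis ℚ).equivOfMinpoly (hζd.powerBasis ℚ) ?_, ?_⟩
  · simp only [IsPrimitiveRoot.powerBasis_gen]
    rw [← hζ.minpoly_eq_cyclotomic_of_irreducible hirr,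
      ← hζd.minpoly_eq_cyclotomic_of_irreducible hirr]
  · have := (hζ.powerBasis ℚ).equivOfMinpoly_gen (hζd.powerBasis ℚ) (by
      simp only [IsPrimitiveRoot.powerBasis_gen]
      rw [← hζ.minpoly_eq_cyclotomic_of_irreducible hirr,
        ← hζd.minpoly_eq_cyclotomic_of_irreducible hirr])
    simpa only [IsPrimitiveRoot.powerBasis_gen] using this

/-- `f` and `f'` have power series expansions in `exp (2πiτ)` whose coefficients are conjugate
under `σ`. -/
def ConjPair {N : ℕ} (σ : cyclotomic N ≃ₐ[ℚ] cyclotomic N) (f f' : UpperHalfPlane → ℂ) : Prop :=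
  ∃ c : ℕ → cyclotomic N, ∀ τ : UpperHalfPlane,
    HasSum (fun n => (c n : ℂ) * cexpTwoPi τ ^ n) (f τ) ∧
    HasSum (fun n => (σ (c n) : ℂ) * cexpTwoPi τ ^ n) (f' τ)

variable {N : ℕ} {σ : cyclotomic N ≃ₐ[ℚ] cyclotomic N}

theorem hasSum_cauchy {a b : ℕ → ℂ} {q s t : ℂ} (ha : HasSum (fun n => a n * q ^ n) s)
    (hb : HasSum (fun n => b n * q ^ n) t) :
    HasSum (fun n => (∑ kl ∈ Finset.HasAntidiagonal.antidiagonal n, a kl.1 * b kl.2) * q ^ n) (s * t) := by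
  have h1 := ha.summable.norm
  have h2 := hb.summable.norm
  have h3 := (summable_norm_sum_mul_antidiagonal_of_summable_norm h1 h2).of_norm.hasSum
  rw [← tsum_mul_tsum_eq_tsum_sum_antidiagonal_of_summable_norm h1 h2, ha.tsum_eq, hb.tsum_eq] at h3
  refine h3.congr_fun fun n => ?_
  rw [Finset.sum_mul]
  refine Finset.sum_congr rfl fun kl hkl => ?_
  rw [← Finset.HasAntidiagonal.mem_antidiagonal.1 hkl, pow_add]
  ring

theorem ConjPair.mul {f f' g g' : UpperHalfPlane → ℂ} (hf : ConjPair σ f f')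
    (hg : ConjPair σ g g') : ConjPair σ (fun τ => f τ * g τ) (fun τ => f' τ * g' τ) := by
  obtain ⟨a, ha⟩ := hf
  obtain ⟨b, hb⟩ := hg
  refine ⟨fun n => ∑ kl ∈ Finset.HasAntidiagonal.antidiagonal n, a kl.1 * b kl.2, fun τ => ⟨?_, ?_⟩⟩
  · simpa using hasSum_cauchy (ha τ).1 (hb τ).1
  · simpa using hasSum_cauchy (ha τ).2 (hb τ).2

theorem ConjPair.const (a : cyclotomic N) : ConjPair σ (fun _ => (a : ℂ)) (fun _ => (σ a : ℂ)) := by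
  refine ⟨fun n => if n = 0 then a else 0, fun τ => ⟨?_, ?_⟩⟩
  · convert! hasSum_single (f := fun n : ℕ => (((if n = 0 then a else 0 : cyclotomic N) : ℂ)) *
      cexpTwoPi τ ^ n) 0 (fun n hn => by simp [hn]) using 1
    simp
  · convert! hasSum_single (f := fun n : ℕ => ((σ (if n = 0 then a else 0 : cyclotomic N) : ℂ)) *
      cexpTwoPi τ ^ n) 0 (fun n hn => by simp [hn]) using 1
    simp

theorem ConjPair.q : ConjPair σ (fun τ => cexpTwoPi τ) (fun τ => cexpTwoPi τ) := by
  refine ⟨fun n => if n = 1 then 1 else 0, fun τ => ⟨?_, ?_⟩⟩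
  · convert! hasSum_single (f := fun n : ℕ => (((if n = 1 then 1 else 0 : cyclotomic N) : ℂ)) *
      cexpTwoPi τ ^ n) 1 (fun n hn => by simp [hn]) using 1
    simp
  · convert! hasSum_single (f := fun n : ℕ => ((σ (if n = 1 then 1 else 0 : cyclotomic N) : ℂ)) *
      cexpTwoPi τ ^ n) 1 (fun n hn => by simp [hn]) using 1
    simp

theorem ConjPair.pow {f f' : UpperHalfPlane → ℂ} (hf : ConjPair σ f f') (k : ℕ) :
    ConjPair σ (fun τ => f τ ^ k) (fun τ => f' τ ^ k) := by
  induction k with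
  | zero => simpa using ConjPair.const (σ := σ) 1
  | succ k ih => simpa only [pow_succ] using ih.mul hf

/-- The exponent of `q` in `∏ i ∈ s, a q ^ (i + 1)`. -/
def prodWeight (s : Finset ℕ) : ℕ := ∑ i ∈ s, (i + 1)

theorem subset_range_prodWeight (s : Finset ℕ) : s ⊆ Finset.range (prodWeight s) := by
  intro i hi
  have := Finset.single_le_sum (f := fun i : ℕ => i + 1) (fun _ _ => Nat.zero_le _) hi
  rw [Finset.mem_range]
  exact this

/-- The coefficients of `∏ (1 + a q ^ (n + 1))`. -/
def prodCoeff {R : Type*} [CommRing R] (a : R) (n : ℕ) : R :=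
  ∑ s ∈ (Finset.range n).powerset with prodWeight s = n, a ^ s.card

/-- The product expands as a sum over finite sets of indices, grouped by the exponent of q. Each
group is finite because an index is smaller than the weight of any set containing it. The
coefficients are thus integral polynomials in a, hence compatible with σ. -/
theorem hasSum_prodCoeff (a : ℂ) {q : ℂ} (hq : ‖q‖ < 1) :
    HasSum (fun n => prodCoeff a n * q ^ n) (∏' n : ℕ, (1 + a * q ^ (n + 1))) := by
  have hs : Summable fun n : ℕ => ‖a * q ^ (n + 1)‖ := by
    simp only [norm_mul, norm_pow]
    exact ((summable_nat_add_iff 1).2 (summable_geometric_of_lt_one (norm_nonneg _) hq)).mul_left _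
  have h1 := summable_finsetProd_of_summable_norm hs
  have h2 := h1.hasSum
  rw [← tprod_one_add h1] at h2
  have h3 := ((Equiv.sigmaFiberEquiv prodWeight).hasSum_iff.2 h2).sigma
    (g := fun n => prodCoeff a n * q ^ n)
  refine h3 fun n => ?_
  have hterm : ∀ s : Finset ℕ, ∏ i ∈ s, a * q ^ (i + 1) = a ^ s.card * q ^ prodWeight s :=
    fun s => by
      rw [Finset.prod_mul_distrib, Finset.prod_const, Finset.prod_pow_eq_pow_sum, prodWeight]
  have h4 : HasSum ((fun s : Finset ℕ => ∏ i ∈ s, a * q ^ (i + 1)) ∘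
      (Subtype.val : {s // s ∈ {s | prodWeight s = n}} → Finset ℕ)) (prodCoeff a n * q ^ n) := by
    rw [hasSum_subtype_iff_indicator, prodCoeff, Finset.sum_mul]
    convert! hasSum_sum_of_ne_finset_zero (f := Set.indicator {s | prodWeight s = n}
      fun s : Finset ℕ => ∏ i ∈ s, a * q ^ (i + 1))
      (s := (Finset.range n).powerset.filter fun s => prodWeight s = n) ?_ using 1
    · refine Finset.sum_congr rfl fun s hs => ?_
      have h5 : prodWeight s = n := (Finset.mem_filter.1 hs).2
      rw [Set.indicator_of_mem (by exact h5), hterm, h5]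
    · intro s hs
      refine Set.indicator_of_notMem (fun h => hs ?_) _
      have h' : prodWeight s = n := h
      rw [Finset.mem_filter, Finset.mem_powerset]
      exact ⟨h' ▸ subset_range_prodWeight s, h'⟩
    · infer_instance
  exact h4

theorem norm_cexpTwoPi_lt_one (τ : UpperHalfPlane) : ‖cexpTwoPi τ‖ < 1 := by
  rw [norm_cexpTwoPi]
  exact exp_neg_im_lt_one τ

theorem ConjPair.prod (a : cyclotomic N) :
    ConjPair σ (fun τ => ∏' n : ℕ, (1 + (a : ℂ) * cexpTwoPi τ ^ (n + 1)))
      (fun τ => ∏' n : ℕ, (1 + (σ a : ℂ) * cexpTwoPi τ ^ (n + 1))) := by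
  refine ⟨prodCoeff a, fun τ => ⟨?_, ?_⟩⟩
  · refine (hasSum_prodCoeff (a : ℂ) (norm_cexpTwoPi_lt_one τ)).congr_fun fun n => ?_
    simp [prodCoeff]
  · refine (hasSum_prodCoeff (σ a : ℂ) (norm_cexpTwoPi_lt_one τ)).congr_fun fun n => ?_
    simp [prodCoeff, map_sum]

theorem cexpTwoPi_div (d : ℤ) : cexpTwoPi (d / N) = zetaN N ^ d := by
  rw [zetaN, ← Complex.exp_int_mul, cexpTwoPi]
  congr 1
  ring

theorem rowProd_div (τ : UpperHalfPlane) (d : ℤ) :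
    rowProd τ (d / N) = (∏' n : ℕ, (1 + -(zetaN N ^ d) * cexpTwoPi τ ^ (n + 1))) *
      ∏' n : ℕ, (1 + -(zetaN N ^ (-d)) * cexpTwoPi τ ^ (n + 1)) := by
  have h1 := multipliable_one_sub_cexpTwoPi τ (d / N)
  have h2 := multipliable_one_sub_cexpTwoPi τ (-(d / N))
  rw [rowProd]
  have e : ∀ (n : ℕ) (d : ℤ), cexpTwoPi ((n + 1) * τ + d / N) =
      zetaN N ^ d * cexpTwoPi τ ^ (n + 1) := fun n d => by
    rw [← cexpTwoPi_div]
    simp only [cexpTwoPi]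
    rw [← Complex.exp_nat_mul, ← Complex.exp_add]
    congr 1
    push_cast
    ring
  have e' : ∀ n : ℕ, cexpTwoPi ((n + 1) * τ - d / N) =
      zetaN N ^ (-d) * cexpTwoPi τ ^ (n + 1) := fun n => by
    rw [← e]
    congr 1
    push_cast
    ring
  push_cast at h1 h2 ⊢
  simp only [← sub_eq_add_neg, e, e'] at h1 h2 ⊢
  simp only [neg_mul, ← sub_eq_add_neg]
  exact h1.tprod_mul h2

/-- The function `g_{[0, d/N]} ^ (12N)`. -/
noncomputable def siegelPow (N : ℕ) (d : ℤ) (τ : UpperHalfPlane) : ℂ := siegel 0 (d / N) τ ^ (12 * N)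

/-- The power 12N turns q^(1/12) into q^N and kills both the sign and the root of unity exp(-πid/N).
What remains has coefficients built from ζᵈ alone. -/
theorem siegelPow_eq (hN : N ≠ 0) (d : ℤ) (τ : UpperHalfPlane) :
    siegelPow N d τ = cexpTwoPi τ ^ N * (1 - zetaN N ^ d) ^ (12 * N) *
      ((∏' n : ℕ, (1 + -(zetaN N ^ d) * cexpTwoPi τ ^ (n + 1))) *
      ∏' n : ℕ, (1 + -(zetaN N ^ (-d)) * cexpTwoPi τ ^ (n + 1))) ^ (12 * N) := by
  have hN' : (N : ℂ) ≠ 0 := by exact_mod_cast hN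
  rw [siegelPow, siegel_zero_eq]
  have e0 : (((d / N : ℚ) : ℚ) : ℝ) = (d / N : ℝ) := by push_cast; rfl
  have e0' : (((d / N : ℚ) : ℚ) : ℂ) = (d / N : ℂ) := by push_cast; rfl
  rw [e0, e0', rowProd_div, cexpTwoPi_div, mul_pow, mul_pow]
  congr 2
  rw [neg_pow, mul_pow, ← Complex.exp_nat_mul, ← Complex.exp_nat_mul, ← Complex.exp_nat_mul]
  have e1 : (-1 : ℂ) ^ (12 * N) = 1 := by rw [pow_mul]; norm_num
  have e2 : exp (((12 * N : ℕ) : ℂ) * -(Real.pi * I * (d / N))) = 1 := by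
    rw [Complex.exp_eq_one_iff]
    refine ⟨-6 * d, ?_⟩
    push_cast
    field_simp
    ring
  rw [e1, e2, one_mul, mul_one]
  congr 1
  push_cast
  ring

/-- Every factor of the expansion depends on d only through ζᵈ, and conjugate expansions are stable
under products and powers. -/
theorem conjPair_siegelPow (hN : N ≠ 0) {d : ℤ} (hσ : σ (zetaN' N) = zetaN' N ^ d) :
    ConjPair σ (siegelPow N 1) (siegelPow N d) := by
  have h := (((ConjPair.q (σ := σ)).pow N).mul
    ((ConjPair.const (σ := σ) (1 - zetaN' N)).pow (12 * N))).mul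
    (((ConjPair.prod (σ := σ) (-zetaN' N)).mul (ConjPair.prod (σ := σ) (-(zetaN' N)⁻¹))).pow (12 * N))
  have e : ((zetaN' N : cyclotomic N) : ℂ) = zetaN N := rfl
  have ed : ((zetaN' N ^ d : cyclotomic N) : ℂ) = zetaN N ^ d :=
    map_zpow₀ (algebraMap (cyclotomic N) ℂ) (zetaN' N) d
  convert! h using 1
  · funext τ
    rw [siegelPow_eq hN]
    simp only [zpow_one, zpow_neg]
    push_cast
    rw [e]
  · funext τ
    rw [siegelPow_eq hN]
    simp only [map_sub, map_one, map_neg, map_inv₀, hσ, zpow_neg]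
    push_cast
    rw [ed]

/-- Fourier coefficients in `exp (2πiτ/N)` from those in `exp (2πiτ)`. -/
def spreadCoeff {R : Type*} [Zero R] (N : ℕ) (c : ℕ → R) (n : ℤ) : R :=
  if 0 ≤ n ∧ (N : ℤ) ∣ n then c (n / N).toNat else 0

theorem hasFourierExpansion_spreadCoeff (hN : N ≠ 0) {f : UpperHalfPlane → ℂ} {c : ℕ → ℂ}
    (hf : ∀ τ : UpperHalfPlane, HasSum (fun n => c n * cexpTwoPi τ ^ n) (f τ)) :
    HasFourierExpansion N f (spreadCoeff N c) := by
  have hN' : (N : ℤ) ≠ 0 := by exact_mod_cast hN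
  have hNC : (N : ℂ) ≠ 0 := by exact_mod_cast hN
  refine ⟨⟨0, fun n hn => by rw [spreadCoeff, if_neg]; omega⟩, fun τ => ?_⟩
  have hinj : Function.Injective fun n : ℕ => (N : ℤ) * n := fun a b h => by
    have := mul_left_cancel₀ hN' h
    exact_mod_cast this
  refine (hinj.hasSum_iff fun n hn => ?_).1 ((hf τ).congr_fun fun n => ?_)
  · rw [spreadCoeff, if_neg, zero_mul]
    rintro ⟨h0, k, rfl⟩
    apply hn
    have hk : 0 ≤ k := by
      have : (0 : ℤ) < N := by positivity
      exact nonneg_of_mul_nonneg_right h0 this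
    exact ⟨k.toNat, by simp [hk]⟩
  · have e : ((N : ℤ) * n) / N = n := Int.mul_ediv_cancel_left _ hN'
    have e2 : (0 : ℤ) ≤ N * n ∧ (N : ℤ) ∣ N * n := ⟨by positivity, dvd_mul_right _ _⟩
    simp only [Function.comp, spreadCoeff, if_pos e2, e, Int.toNat_natCast]
    rw [cexpTwoPi, ← Complex.exp_nat_mul]
    congr 2
    push_cast
    field_simp

/-- A power series vanishing on `(0, 1)` is zero. -/
theorem eq_zero_of_hasSum_zero {b : ℕ → ℂ}
    (h : ∀ Q : ℝ, 0 < Q → Q < 1 → HasSum (fun n => b n * (Q : ℂ) ^ n) 0) (k : ℕ) : b k = 0 := by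
  induction k using Nat.strong_induction_on with
  | _ k ih =>
    have h1 : ∀ Q : ℝ, 0 < Q → Q < 1 → HasSum (fun n => b (n + k) * (Q : ℂ) ^ n) 0 := by
      intro Q h0 h1
      have h2 := (hasSum_nat_add_iff' k).2 (h Q h0 h1)
      rw [Finset.sum_eq_zero fun i hi => by rw [ih i (Finset.mem_range.1 hi), zero_mul],
        sub_zero] at h2
      have hQ : (Q : ℂ) ≠ 0 := by exact_mod_cast h0.ne'
      have h3 := h2.mul_left ((Q : ℂ) ^ k)⁻¹
      rw [mul_zero] at h3
      refine h3.congr_fun fun n => ?_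
      rw [pow_add]
      field_simp
    -- Once the lower coefficients vanish, letting Q → 0⁺ isolates the coefficient k. The series at
    -- Q = 1/2 dominates.
    have hlim : Tendsto (fun Q : ℝ => ∑' n, b (n + k) * (Q : ℂ) ^ n) (𝓝[>] 0)
        (𝓝 (∑' n, if n = 0 then b k else 0)) := by
      refine tendsto_tsum_of_dominated_convergence
        (bound := fun n => ‖b (n + k) * ((1 / 2 : ℝ) : ℂ) ^ n‖) ?_ ?_ ?_
      · exact (h1 (1 / 2) (by norm_num) (by norm_num)).summable.norm
      · intro n
        have hc : Continuous fun Q : ℝ => b (n + k) * (Q : ℂ) ^ n := by fun_prop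
        have := (hc.tendsto 0).mono_left (nhdsWithin_le_nhds (s := Ioi 0))
        rcases eq_or_ne n 0 with rfl | hn
        · simp
        · simpa [hn] using this
      · filter_upwards [Ioo_mem_nhdsGT (show (0 : ℝ) < 1 / 2 by norm_num)] with Q hQ n
        rw [norm_mul, norm_mul, norm_pow, norm_pow, Complex.norm_real, Complex.norm_real,
          Real.norm_of_nonneg hQ.1.le, Real.norm_of_nonneg (by norm_num : (0 : ℝ) ≤ 1 / 2)]
        gcongr
        · exact hQ.1.le
        · exact hQ.2.le
    have hzero : (fun Q : ℝ => ∑' n, b (n + k) * (Q : ℂ) ^ n) =ᶠ[𝓝[>] 0] fun _ => 0 := by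
      filter_upwards [Ioo_mem_nhdsGT (show (0 : ℝ) < 1 by norm_num)] with Q hQ
      exact (h1 Q hQ.1 hQ.2).tsum_eq
    have := tendsto_nhds_unique (hlim.congr' hzero) tendsto_const_nhds
    rwa [tsum_ite_eq] at this

/-- `IsConjugate` only asserts that some coefficients exist; uniqueness identifies them with the
explicit ones, and hence determines the conjugate function. -/
theorem HasFourierExpansion.unique (hN : N ≠ 0) {f : UpperHalfPlane → ℂ} {c c' : ℤ → ℂ}
    (h : HasFourierExpansion N f c) (h' : HasFourierExpansion N f c') : c = c' := by
  obtain ⟨⟨m₁, hm₁⟩, hs⟩ := h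
  obtain ⟨⟨m₂, hm₂⟩, hs'⟩ := h'
  let m := min m₁ m₂
  have hm : ∀ n < m, c n - c' n = 0 := fun n hn => by
    rw [hm₁ n (hn.trans_le (min_le_left _ _)), hm₂ n (hn.trans_le (min_le_right _ _)), sub_zero]
  let b : ℕ → ℂ := fun n => c (n + m) - c' (n + m)
  have hNC : (N : ℂ) ≠ 0 := by exact_mod_cast hN
  have hNR : (0 : ℝ) < N := by positivity
  have hb : ∀ Q : ℝ, 0 < Q → Q < 1 → HasSum (fun n => b n * (Q : ℂ) ^ n) 0 := by
    intro Q h0 h1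
    have hlog : 0 < -Real.log Q := by
      have := Real.log_neg h0 h1
      linarith
    have hpi := Real.pi_pos
    -- The point of the imaginary axis at which exp(2πiτ/N) = Q.
    let τ : UpperHalfPlane := ⟨((N * -Real.log Q / (2 * Real.pi) : ℝ) : ℂ) * I, by
      simp only [im_ofReal_mul, I_im, mul_one]; positivity⟩
    have hτ : (τ : ℂ) = ((N * -Real.log Q / (2 * Real.pi) : ℝ) : ℂ) * I := rfl
    have hQ : (Q : ℂ) ≠ 0 := by exact_mod_cast h0.ne'
    have hexp : ∀ n : ℤ, exp (2 * Real.pi * I * n * τ / N) = (Q : ℂ) ^ n := fun n => by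
      have : (2 * Real.pi * I * n * τ / N : ℂ) = n * (Real.log Q : ℝ) := by
        have hpc : (Real.pi : ℂ) ≠ 0 := by exact_mod_cast hpi.ne'
        rw [hτ]
        push_cast
        field_simp
        linear_combination (-(n : ℂ) * (Real.log Q : ℂ)) * I_sq
      rw [this, Complex.exp_int_mul, ← ofReal_exp, Real.exp_log h0]
    have h3 := (hs τ).sub (hs' τ)
    rw [sub_self] at h3
    simp only [hexp, ← sub_mul] at h3
    have hinj : Function.Injective fun n : ℕ => (n : ℤ) + m := fun a b h => by
      simpa using h
    have h4 := ((hinj.hasSum_iff fun n hn => by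
      rw [hm n, zero_mul]
      by_contra hlt
      push Not at hlt
      exact hn ⟨(n - m).toNat, by simp [hlt]⟩).2 h3).mul_left ((Q : ℂ) ^ m)⁻¹
    rw [mul_zero] at h4
    refine h4.congr_fun fun n => ?_
    have hQm : (Q : ℂ) ^ m ≠ 0 := zpow_ne_zero _ hQ
    simp only [Function.comp, b]
    rw [zpow_add₀ hQ, zpow_natCast]
    field_simp
  funext n
  rcases lt_or_ge n m with hn | hn
  · exact sub_eq_zero.1 (hm n hn)
  · have := eq_zero_of_hasSum_zero hb (n - m).toNat
    simp only [b, Int.toNat_of_nonneg (sub_nonneg.2 hn), sub_add_cancel] at this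
    exact sub_eq_zero.1 this

theorem ConjPair.hasFourierExpansion (hN : N ≠ 0) {f f' : UpperHalfPlane → ℂ}
    (h : ConjPair σ f f') : ∃ c : ℤ → cyclotomic N,
      HasFourierExpansion N f (fun n => c n) ∧ HasFourierExpansion N f' (fun n => σ (c n)) := by
  obtain ⟨c, hc⟩ := h
  refine ⟨spreadCoeff N c, ?_, ?_⟩
  · convert! hasFourierExpansion_spreadCoeff hN fun τ => (hc τ).1 using 1
    funext n
    simp only [spreadCoeff]
    split_ifs <;> simp
  · convert! hasFourierExpansion_spreadCoeff hN fun τ => (hc τ).2 using 1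
    funext n
    simp only [spreadCoeff]
    split_ifs <;> simp

/-- The conjugates of `g_{[0, 1/N]} ^ (12N)`. -/
theorem IsConjugate.exists_eq (hN : N ≠ 0) {A : Matrix (Fin 2) (Fin 2) ℤ}
    {h : UpperHalfPlane → ℂ}
    (hA : IsConjugate N A (fun τ => siegel 0 (1 / N) τ ^ (12 * N)) h) :
    ∃ (d : ℤ) (γ : SL(2, ℤ)),
      A.map (Int.cast : ℤ → ZMod N) =
        ((!![1, 0; 0, d] : Matrix (Fin 2) (Fin 2) ℤ) * γ.1).map (Int.cast : ℤ → ZMod N) ∧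
      ∀ τ, h τ = siegelPow N d (γ • τ) := by
  obtain ⟨d, γ, σ, c, f', hAγ, hσ, hf, hf', hh⟩ := hA
  refine ⟨d, γ, hAγ, fun τ => ?_⟩
  obtain ⟨c', h1, h2⟩ := (conjPair_siegelPow hN hσ).hasFourierExpansion hN
  have e : siegelPow N 1 = fun τ => siegel 0 (1 / N) τ ^ (12 * N) := by
    funext τ
    simp [siegelPow]
  rw [e] at h1
  have h3 := hf.unique hN h1
  have h4 : c = c' := by
    funext n
    exact Subtype.ext (congrFun h3 n)
  subst h4
  rw [hh]
  exact (hf'.2 _).unique (h2.2 _)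

/-- Surjectivity of the reduction of SL₂(ℤ) modulo N. Dividing the second row by its gcd g and
completing it to δ in SL₂(ℤ) reduces the problem to a triangular matrix whose diagonal entries have
product congruent to 1. -/
theorem exists_SL2_lift {a b c f : ℤ} (h : (N : ℤ) ∣ a * f - b * c - 1) :
    ∃ γ : SL(2, ℤ), (N : ℤ) ∣ γ 0 0 - a ∧ (N : ℤ) ∣ γ 0 1 - b ∧
      (N : ℤ) ∣ γ 1 0 - c ∧ (N : ℤ) ∣ γ 1 1 - f := by
  obtain ⟨c₀, f₀, hc, hf, hu⟩ := extract_gcd c f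
  set g := gcd c f
  have hcop : IsCoprime c₀ f₀ := (gcd_isUnit_iff c₀ f₀).1 hu
  obtain ⟨δ, hδ0, hδ1⟩ := hcop.exists_SL2_row 1
  have hdet := Matrix.SpecialLinearGroup.det_coe δ
  rw [Matrix.det_fin_two] at hdet
  set x := δ 0 0
  set y := δ 0 1
  have hdet' : x * f₀ - y * c₀ = 1 := by rw [← hδ0, ← hδ1]; exact hdet
  -- `[a b; c f] δ⁻¹ = [a' b'; 0 g]`
  let a' := a * f₀ - b * c₀
  let b' := b * x - a * y
  obtain ⟨k, hk⟩ := h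
  have hag : a' * g = 1 + N * k := by
    rw [← hk]
    simp only [a']
    linear_combination (-a) * hf + b * hc
  -- Replacing the lower left entry 0 by N gives determinant a'g - Nk = 1 for every t. As a'g ≡ 1
  -- mod N, this t makes the upper right entry k + tg congruent to b'.
  let t := (b' - k) * a'
  have hM : Matrix.det !![a' + t * N, k + t * g; (N : ℤ), g] = 1 := by
    rw [Matrix.det_fin_two_of]
    linear_combination hag
  let μ : SL(2, ℤ) := ⟨_, hM⟩
  refine ⟨μ * δ, ?_⟩
  have hmul : ∀ i j, (μ * δ) i j = (μ.1 * δ.1) i j := fun i j => by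
    rw [← Matrix.SpecialLinearGroup.coe_mul]
  have e00 : (μ * δ) 0 0 = (a' + t * N) * x + (k + t * g) * c₀ := by
    rw [hmul, Matrix.mul_apply, Fin.sum_univ_two, hδ0]
    simp [μ, x]
  have e01 : (μ * δ) 0 1 = (a' + t * N) * y + (k + t * g) * f₀ := by
    rw [hmul, Matrix.mul_apply, Fin.sum_univ_two, hδ1]
    simp [μ, y]
  have e10 : (μ * δ) 1 0 = N * x + g * c₀ := by
    rw [hmul, Matrix.mul_apply, Fin.sum_univ_two, hδ0]
    simp [μ, x]
  have e11 : (μ * δ) 1 1 = N * y + g * f₀ := by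
    rw [hmul, Matrix.mul_apply, Fin.sum_univ_two, hδ1]
    simp [μ, y]
  rw [e00, e01, e10, e11]
  have hu : k + t * g = b' + N * ((b' - k) * k) := by
    simp only [t]
    linear_combination (b' - k) * hag
  rw [hu]
  refine ⟨⟨t * x + (b' - k) * k * c₀, ?_⟩, ⟨t * y + (b' - k) * k * f₀, ?_⟩, ⟨x, ?_⟩, ⟨y, ?_⟩⟩
  · simp only [a', b']
    linear_combination a * hdet'
  · simp only [a', b']
    linear_combination b * hdet'
  · linear_combination -hc
  · linear_combination -hf

/-- One takes d = det A and divides the second row of A by d modulo N; the result has determinant 1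
modulo N and lifts to SL₂(ℤ). -/
theorem exists_isConjugate (hN : N ≠ 0) {A : Matrix (Fin 2) (Fin 2) ℤ}
    (hA : IsCoprime A.det (N : ℤ)) :
    ∃ h, IsConjugate N A (fun τ => siegel 0 (1 / N) τ ^ (12 * N)) h := by
  obtain ⟨σ, hσ⟩ := exists_cyclotomic_aut hN hA
  obtain ⟨e, u, heu⟩ := hA
  rw [Matrix.det_fin_two] at heu
  obtain ⟨γ, h00, h01, h10, h11⟩ := exists_SL2_lift (a := A 0 0) (b := A 0 1) (c := e * A 1 0)
    (f := e * A 1 1) ⟨-u, by linear_combination heu⟩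
  obtain ⟨c, h1, h2⟩ := (conjPair_siegelPow hN hσ).hasFourierExpansion hN
  refine ⟨fun τ => siegelPow N A.det (γ • τ), A.det, γ, σ, c, siegelPow N A.det, ?_, hσ, ?_, h2,
    fun _ => rfl⟩
  · have key : ∀ x y : ℤ, (N : ℤ) ∣ y - x → (x : ZMod N) = y := fun x y h =>
      (ZMod.intCast_eq_intCast_iff_dvd_sub _ _ _).2 h
    have hd : (N : ℤ) ∣ A.det * e - 1 := ⟨-u, by rw [Matrix.det_fin_two]; linear_combination heu⟩
    have row : ∀ x y : ℤ, (N : ℤ) ∣ y - e * x → (N : ℤ) ∣ A.det * y - x := fun x y h => by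
      have := dvd_add (Dvd.dvd.mul_left h A.det) (Dvd.dvd.mul_left hd x)
      convert! this using 1
      ring
    ext i j
    fin_cases i <;> fin_cases j <;>
      simp only [Matrix.map_apply, Matrix.mul_apply, Fin.sum_univ_two, Matrix.of_apply,
        Matrix.cons_val', Matrix.cons_val_zero, Matrix.cons_val_one, Matrix.cons_val_fin_one,
        Fin.zero_eta, Fin.mk_one, zero_mul, one_mul, add_zero, zero_add]
    · exact key _ _ h00
    · exact key _ _ h01
    · exact key _ _ (row _ _ h10)
    · exact key _ _ (row _ _ h11)
  · have e : siegelPow N 1 = fun τ => siegel 0 (1 / N) τ ^ (12 * N) := by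
      funext τ
      simp [siegelPow]
    rwa [← e]

end Fourier

end QuadraticOrder

end

/-! ### Ray classes and scaling of proper ideals. -/

section

open scoped nonZeroDivisors

namespace QuadraticOrder

section Ideals

open FractionalIdeal

variable {K : Type*} [Field K] [NumberField K] [Algebra.IsQuadraticExtension ℚ K]
  (O : Subring K) [Module.Finite ℤ O] [IsFractionRing O K] {N : ℕ}

theorem coe_toUnit (𝔞 : properIdeals O N) :
    (toUnit O 𝔞 : FractionalIdeal O⁰ K) = (𝔞.1 : FractionalIdeal O⁰ K) :=
  IsUnit.unit_spec _

theorem toUnit_injective : Function.Injective (toUnit O (N := N)) := by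
  intro 𝔞 𝔟 h
  have h' := congrArg Units.val h
  rw [coe_toUnit, coe_toUnit] at h'
  exact Subtype.ext (coeIdeal_injective h')

theorem mem_toUnit {𝔞 : properIdeals O N} {x : K} :
    x ∈ (toUnit O 𝔞 : FractionalIdeal O⁰ K) ↔ ∃ a ∈ 𝔞.1, (a : K) = x := by
  rw [coe_toUnit]
  exact mem_coeIdeal O⁰

omit [NumberField K] [Algebra.IsQuadraticExtension ℚ K] [Module.Finite ℤ O]
  [IsFractionRing O K] in
theorem mem_one_iff_mem {x : K} : x ∈ (1 : FractionalIdeal O⁰ K) ↔ x ∈ O :=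
  (mem_one_iff O⁰).trans ⟨fun ⟨y, hy⟩ => hy ▸ y.2, fun h => ⟨⟨x, h⟩, rfl⟩⟩

omit [NumberField K] [Algebra.IsQuadraticExtension ℚ K] [Module.Finite ℤ O] in
theorem mem_units_inv_iff {u : (FractionalIdeal O⁰ K)ˣ} {x : K} :
    x ∈ ((u⁻¹ : (FractionalIdeal O⁰ K)ˣ) : FractionalIdeal O⁰ K) ↔
      ∀ y ∈ (u : FractionalIdeal O⁰ K), x * y ∈ O := by
  have h1 : (∀ y ∈ (u : FractionalIdeal O⁰ K), x * y ∈ O) ↔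
      spanSingleton O⁰ x * u ≤ 1 := by
    rw [spanSingleton_mul_le_iff]
    simp only [mem_one_iff_mem]
  rw [h1, ← spanSingleton_le_iff_mem]
  constructor
  · intro h
    calc spanSingleton O⁰ x * u ≤ ((u⁻¹ : (FractionalIdeal O⁰ K)ˣ) : FractionalIdeal O⁰ K) * u := by
          gcongr
      _ = 1 := Units.inv_mul u
  · intro h
    calc spanSingleton O⁰ x = spanSingleton O⁰ x * u *
          ((u⁻¹ : (FractionalIdeal O⁰ K)ˣ) : FractionalIdeal O⁰ K) := by
          rw [mul_assoc, Units.mul_inv, mul_one]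
      _ ≤ 1 * ((u⁻¹ : (FractionalIdeal O⁰ K)ˣ) : FractionalIdeal O⁰ K) := by gcongr
      _ = _ := one_mul _

theorem mem_invLattice {𝔠 : properIdeals O N} {x : K} :
    x ∈ invLattice O 𝔠 ↔ ∀ c ∈ 𝔠.1, x * c ∈ O := by
  refine (mem_units_inv_iff O).trans ⟨fun h c hc => h c ((mem_toUnit O).2 ⟨c, hc, rfl⟩), ?_⟩
  intro h y hy
  obtain ⟨c, hc, rfl⟩ := (mem_toUnit O).1 hy
  exact h c hc

omit [NumberField K] [Algebra.IsQuadraticExtension ℚ K] [Module.Finite ℤ O] in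
-- A multiplier x of an invertible 𝔞 satisfies x𝔞 ⊆ 𝔞, and multiplying by 𝔞⁻¹ puts x in O.
theorem isProper_of_isUnit {𝔞 : Ideal O} (h : IsUnit (𝔞 : FractionalIdeal O⁰ K)) :
    IsProper O 𝔞 := by
  intro x hx
  obtain ⟨u, hu⟩ := h
  have h1 : spanSingleton O⁰ x * u ≤ u := by
    rw [spanSingleton_mul_le_iff, hu]
    intro z hz
    obtain ⟨y, hy, rfl⟩ := (mem_coeIdeal O⁰).1 hz
    obtain ⟨z, hz, e⟩ := hx y hy
    exact (mem_coeIdeal O⁰).2 ⟨z, hz, e⟩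
  have h2 : spanSingleton O⁰ x ≤ 1 := by
    calc spanSingleton O⁰ x = spanSingleton O⁰ x * u *
          ((u⁻¹ : (FractionalIdeal O⁰ K)ˣ) : FractionalIdeal O⁰ K) := by
          rw [mul_assoc, Units.mul_inv, mul_one]
      _ ≤ u * ((u⁻¹ : (FractionalIdeal O⁰ K)ˣ) : FractionalIdeal O⁰ K) := by gcongr
      _ = 1 := Units.mul_inv u
  exact (mem_one_iff_mem O).1 (spanSingleton_le_iff_mem.1 h2)

variable (N) in
/-- Congruence to `1` modulo `N` in the order `O`. -/
def CongrOne (ν : O) : Prop := ν - 1 ∈ Ideal.span {(N : O)}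

omit [NumberField K] [Algebra.IsQuadraticExtension ℚ K] [Module.Finite ℤ O] [IsFractionRing O K] in
theorem congrOne_iff {ν : O} : CongrOne O N ν ↔ ∃ w : O, ν = 1 + N * w := by
  rw [CongrOne, Ideal.mem_span_singleton']
  constructor
  · rintro ⟨w, hw⟩
    exact ⟨w, by rw [mul_comm, hw]; ring⟩
  · rintro ⟨w, rfl⟩
    exact ⟨w, by ring⟩

omit [NumberField K] [Algebra.IsQuadraticExtension ℚ K] [Module.Finite ℤ O] [IsFractionRing O K] in
theorem CongrOne.mul {μ ν : O} (hμ : CongrOne O N μ) (hν : CongrOne O N ν) :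
    CongrOne O N (μ * ν) := by
  obtain ⟨w, rfl⟩ := (congrOne_iff O).1 hμ
  obtain ⟨z, rfl⟩ := (congrOne_iff O).1 hν
  exact (congrOne_iff O).2 ⟨w + z + N * (w * z), by ring⟩

omit [NumberField K] [Algebra.IsQuadraticExtension ℚ K] [Module.Finite ℤ O] [IsFractionRing O K] in
theorem congrOne_one : CongrOne O N 1 := (congrOne_iff O).2 ⟨0, by simp⟩

omit [NumberField K] [Algebra.IsQuadraticExtension ℚ K] [Module.Finite ℤ O] [IsFractionRing O K] in
theorem exists_mem_congrOne (𝔠 : properIdeals O N) :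
    ∃ μ ∈ 𝔠.1, μ ≠ 0 ∧ CongrOne O N μ := by
  obtain ⟨h0, -, h1⟩ := 𝔠.2
  have h1' : (1 : O) ∈ 𝔠.1 ⊔ Ideal.span {(N : O)} := h1 ▸ Submodule.mem_top
  obtain ⟨μ, hμ, z, hz, e⟩ := Submodule.mem_sup.1 h1'
  have hc : CongrOne O N μ := by
    rw [CongrOne, ← e]
    simpa using hz
  -- If μ = 0 then NO = O and the congruence is vacuous, so any nonzero element of the ideal serves.
  -- This can occur for N = 1.
  by_cases hμ0 : μ = 0
  · obtain ⟨y, hy, hy0⟩ := Submodule.exists_mem_ne_zero_of_ne_bot h0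
    refine ⟨y, hy, hy0, ?_⟩
    subst hμ0
    have : (1 : O) ∈ Ideal.span {(N : O)} := by simpa [← e] using hz
    rw [CongrOne, (Ideal.eq_top_iff_one _).2 this]
    trivial
  · exact ⟨μ, hμ, hμ0, hc⟩

/-- The working criterion for membership in M(O, N): an integral invertible ideal containing some z
≡ 1 mod N is proper by invertibility and prime to N because of z. -/
theorem exists_properIdeal {J : (FractionalIdeal O⁰ K)ˣ} (hJ : (J : FractionalIdeal O⁰ K) ≤ 1)
    {z : O} (hz : CongrOne O N z) (hzJ : (z : K) ∈ (J : FractionalIdeal O⁰ K)) :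
    ∃ 𝔞 : properIdeals O N, toUnit O 𝔞 = J := by
  obtain ⟨𝔞, h𝔞⟩ := le_one_iff_exists_coeIdeal.1 hJ
  have hu : IsUnit (𝔞 : FractionalIdeal O⁰ K) := h𝔞 ▸ J.isUnit
  refine ⟨⟨𝔞, ?_, isProper_of_isUnit O hu, ?_⟩, Units.ext ?_⟩
  · rintro rfl
    rw [coeIdeal_bot] at hu
    exact not_isUnit_zero hu
  · rw [← h𝔞] at hzJ
    obtain ⟨z', hz', e⟩ := (mem_coeIdeal O⁰).1 hzJ
    have : z' = z := Subtype.ext e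
    subst this
    rw [Ideal.eq_top_iff_one]
    have := Submodule.sub_mem _ (Submodule.mem_sup_left hz' : z' ∈ 𝔞 ⊔ Ideal.span {(N : O)})
      (Submodule.mem_sup_right hz)
    simpa using this
  · rw [coe_toUnit, h𝔞]

theorem toUnit_le_one (𝔞 : properIdeals O N) : (toUnit O 𝔞 : FractionalIdeal O⁰ K) ≤ 1 := by
  rw [coe_toUnit]
  exact coeIdeal_le_one

omit [NumberField K] [Algebra.IsQuadraticExtension ℚ K] [Module.Finite ℤ O] in
-- The elements congruent to 1 are closed under multiplication, so quotients of two such principal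
-- ideals already form a group.
theorem mem_principalGroup {u : (FractionalIdeal O⁰ K)ˣ} :
    u ∈ principalGroup O N ↔ ∃ μ ν : O, μ ≠ 0 ∧ ν ≠ 0 ∧ CongrOne O N μ ∧ CongrOne O N ν ∧
      spanSingleton O⁰ (μ : K) * u = spanSingleton O⁰ (ν : K) := by
  constructor
  · intro hu
    induction hu using Subgroup.closure_induction with
    | mem u h =>
      obtain ⟨ν, h0, h1, e⟩ := h
      refine ⟨1, ν, one_ne_zero, h0, congrOne_one O, h1, ?_⟩
      rw [e, coeIdeal_span_singleton]
      rw [OneMemClass.coe_one, spanSingleton_one, one_mul]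
      rfl
    | one => exact ⟨1, 1, one_ne_zero, one_ne_zero, congrOne_one O, congrOne_one O, by simp⟩
    | mul u v _ _ hu hv =>
      obtain ⟨μ, ν, h1, h2, h3, h4, e⟩ := hu
      obtain ⟨μ', ν', h1', h2', h3', h4', e'⟩ := hv
      refine ⟨μ * μ', ν * ν', mul_ne_zero h1 h1', mul_ne_zero h2 h2', h3.mul O h3', h4.mul O h4', ?_⟩
      push_cast
      rw [← spanSingleton_mul_spanSingleton, ← spanSingleton_mul_spanSingleton, ← e, ← e']
      ring
    | inv u _ hu =>
      obtain ⟨μ, ν, h1, h2, h3, h4, e⟩ := hu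
      refine ⟨ν, μ, h2, h1, h4, h3, ?_⟩
      rw [← e, mul_assoc, Units.mul_inv, mul_one]
  · rintro ⟨μ, ν, h1, h2, h3, h4, e⟩
    have hK : ∀ {ν : O}, ν ≠ 0 → (ν : K) ≠ 0 := fun h h' => h (Subtype.ext h')
    have hP : ∀ (ν : O) (h : ν ≠ 0), CongrOne O N ν →
        toPrincipalIdeal O K (Units.mk0 (ν : K) (hK h)) ∈ principalGroup O N := fun ν h h' => by
      refine Subgroup.subset_closure ⟨ν, h, h', ?_⟩
      rw [coe_toPrincipalIdeal, coeIdeal_span_singleton]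
      rfl
    have : u = (toPrincipalIdeal O K (Units.mk0 (μ : K) (hK h1)))⁻¹ *
        toPrincipalIdeal O K (Units.mk0 (ν : K) (hK h2)) := by
      rw [eq_inv_mul_iff_mul_eq]
      ext1
      simpa using e
    rw [this]
    exact mul_mem (inv_mem (hP μ h1 h3)) (hP ν h2 h4)

theorem rayClass_eq_iff {𝔞 𝔠 : properIdeals O N} :
    rayClass O 𝔠 = rayClass O 𝔞 ↔ ∃ μ ν : O, μ ≠ 0 ∧ ν ≠ 0 ∧ CongrOne O N μ ∧ CongrOne O N ν ∧
      spanSingleton O⁰ (μ : K) * toUnit O 𝔞 = spanSingleton O⁰ (ν : K) * toUnit O 𝔠 := by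
  rw [rayClass, rayClass, QuotientGroup.eq, Subgroup.mem_subgroupOf]
  refine (mem_principalGroup O).trans ?_
  refine exists_congr fun μ => exists_congr fun ν => and_congr_right fun _ =>
    and_congr_right fun _ => and_congr_right fun _ => and_congr_right fun _ => ?_
  push_cast
  rw [mul_comm ((toUnit O 𝔠)⁻¹.1), ← mul_assoc, Units.mul_inv_eq_iff_eq_mul]

/-- Denominators can be cleared by elements congruent to 1. The only real case is inversion: if 𝔞 =
μu and m ∈ 𝔞 with m ≡ 1, then mu⁻¹ = μm𝔞⁻¹ is integral and contains μm ≡ 1. -/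
theorem exists_toUnit_eq_of_mem_idealGroup {u : (FractionalIdeal O⁰ K)ˣ} (hu : u ∈ idealGroup O N) :
    ∃ (𝔞 : properIdeals O N) (μ : O), μ ≠ 0 ∧ CongrOne O N μ ∧
      (toUnit O 𝔞 : FractionalIdeal O⁰ K) = spanSingleton O⁰ (μ : K) * u := by
  have hK : ∀ {ν : O}, ν ≠ 0 → (ν : K) ≠ 0 := fun h h' => h (Subtype.ext h')
  induction hu using Subgroup.closure_induction with
  | mem u h =>
    obtain ⟨𝔞, rfl⟩ := h
    exact ⟨𝔞, 1, one_ne_zero, congrOne_one O, by simp⟩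
  | one =>
    obtain ⟨𝔞, h⟩ := exists_properIdeal O (J := 1) (N := N) le_rfl (congrOne_one O)
      ((mem_one_iff_mem O).2 (one_mem O))
    exact ⟨𝔞, 1, one_ne_zero, congrOne_one O, by simp [h]⟩
  | mul u v _ _ hu hv =>
    obtain ⟨𝔞, μ, h1, h2, e⟩ := hu
    obtain ⟨𝔟, ν, h1', h2', e'⟩ := hv
    obtain ⟨m, hm, -, hm1⟩ := exists_mem_congrOne O 𝔞
    obtain ⟨n, hn, -, hn1⟩ := exists_mem_congrOne O 𝔟
    obtain ⟨𝔡, h⟩ := exists_properIdeal O (J := toUnit O 𝔞 * toUnit O 𝔟) (N := N)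
      (by
        push_cast
        calc _ ≤ (1 : FractionalIdeal O⁰ K) * 1 := by
              gcongr
              · exact toUnit_le_one O 𝔞
              · exact toUnit_le_one O 𝔟
          _ = 1 := one_mul 1)
      (hm1.mul O hn1) (by
        push_cast
        exact mul_mem_mul ((mem_toUnit O).2 ⟨m, hm, rfl⟩) ((mem_toUnit O).2 ⟨n, hn, rfl⟩))
    refine ⟨𝔡, μ * ν, mul_ne_zero h1 h1', h2.mul O h2', ?_⟩
    rw [h]
    push_cast
    rw [← spanSingleton_mul_spanSingleton, e, e']
    ring
  | inv u _ hu =>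
    obtain ⟨𝔞, μ, h1, h2, e⟩ := hu
    obtain ⟨m, hm, hm0, hm1⟩ := exists_mem_congrOne O 𝔞
    have hc : ∀ ν : O, ∀ h : ν ≠ 0, ((toPrincipalIdeal O K (Units.mk0 (ν : K) (hK h)) :
      (FractionalIdeal O⁰ K)ˣ) : FractionalIdeal O⁰ K) = spanSingleton O⁰ (ν : K) := fun ν h =>
        coe_toPrincipalIdeal _
    have eu : toUnit O 𝔞 = toPrincipalIdeal O K (Units.mk0 (μ : K) (hK h1)) * u := by
      ext1
      rw [e, Units.val_mul, hc μ h1]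
    have hle : spanSingleton O⁰ (m : K) * ((u⁻¹ : (FractionalIdeal O⁰ K)ˣ) : FractionalIdeal O⁰ K) =
        spanSingleton O⁰ (μ : K) * (spanSingleton O⁰ (m : K) *
          ((toUnit O 𝔞)⁻¹ : (FractionalIdeal O⁰ K)ˣ)) := by
      rw [eu, mul_inv, Units.val_mul, ← hc μ h1]
      rw [mul_left_comm, ← mul_assoc _ _ ((u⁻¹ : (FractionalIdeal O⁰ K)ˣ) : FractionalIdeal O⁰ K),
        Units.mul_inv, one_mul]
    obtain ⟨𝔡, h⟩ := exists_properIdeal O (N := N)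
      (J := toPrincipalIdeal O K (Units.mk0 (m : K) (hK hm0)) * u⁻¹) (z := μ * m)
      (by
        rw [Units.val_mul, hc m hm0, hle]
        have e1 : spanSingleton O⁰ (μ : K) ≤ 1 :=
          spanSingleton_le_iff_mem.2 ((mem_one_iff_mem O).2 μ.2)
        have e2 : spanSingleton O⁰ (m : K) ≤ toUnit O 𝔞 :=
          spanSingleton_le_iff_mem.2 ((mem_toUnit O).2 ⟨m, hm, rfl⟩)
        calc _ ≤ 1 * ((toUnit O 𝔞 : FractionalIdeal O⁰ K) *
              ((toUnit O 𝔞)⁻¹ : (FractionalIdeal O⁰ K)ˣ)) := by gcongr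
          _ = 1 := by rw [Units.mul_inv, one_mul]) (h2.mul O hm1) (by
        rw [Units.val_mul, hc m hm0, hle]
        push_cast
        refine mul_mem_mul (mem_spanSingleton_self _ _) ?_
        rw [← mul_one (m : K)]
        refine mul_mem_mul ?_ ?_
        · rw [mul_one]; exact mem_spanSingleton_self _ _
        · exact (mem_invLattice O).2 fun c _ => by rw [one_mul]; exact c.2)
    exact ⟨𝔡, m, hm0, hm1, by rw [h, Units.val_mul, hc m hm0]⟩

/-- Every ray class contains an ideal of `M(O, N)`. -/
theorem rayClass_surjective : Function.Surjective (rayClass O (N := N)) := by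
  intro C
  induction C using QuotientGroup.induction_on with
  | _ u =>
    obtain ⟨𝔞, μ, h0, h1, e⟩ := exists_toUnit_eq_of_mem_idealGroup O u.2
    refine ⟨𝔞, ?_⟩
    rw [rayClass, QuotientGroup.eq, Subgroup.mem_subgroupOf]
    refine (mem_principalGroup O).2 ⟨μ, 1, h0, one_ne_zero, h1, congrOne_one O, ?_⟩
    push_cast
    rw [mul_left_comm, ← e, Units.inv_mul, spanSingleton_one]

theorem one_mem_invLattice (𝔠 : properIdeals O N) : (1 : K) ∈ invLattice O 𝔠 :=
  (mem_invLattice O).2 fun c _ => by rw [one_mul]; exact c.2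

theorem mul_mem_invLattice {𝔠 : properIdeals O N} {a x : K} (ha : a ∈ O) (hx : x ∈ invLattice O 𝔠) :
    a * x ∈ invLattice O 𝔠 :=
  (mem_invLattice O).2 fun c hc => by
    rw [mul_assoc]; exact mul_mem ha ((mem_invLattice O).1 hx c hc)

theorem mem_invLattice_of_mem (𝔠 : properIdeals O N) {x : K} (hx : x ∈ O) : x ∈ invLattice O 𝔠 := by
  simpa using mul_mem_invLattice O hx (one_mem_invLattice O 𝔠)

theorem add_mem_invLattice {𝔠 : properIdeals O N} {x y : K} (hx : x ∈ invLattice O 𝔠)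
    (hy : y ∈ invLattice O 𝔠) : x + y ∈ invLattice O 𝔠 :=
  (mem_invLattice O).2 fun c hc => by
    rw [add_mul]
    exact add_mem ((mem_invLattice O).1 hx c hc) ((mem_invLattice O).1 hy c hc)

/-- The nonzero elements of `1 + N𝔠⁻¹`. -/
def congrSet (𝔠 : properIdeals O N) : Set K :=
  {x | x ≠ 0 ∧ ∃ y ∈ invLattice O 𝔠, x = 1 + N * y}

/-- With m ∈ 𝔠 and m ≡ 1 mod N, the product xm = m + N(ym) lies in x𝔠 and is again congruent to 1,
since ym ∈ O. Hence x𝔠 is prime to N and x = (xm)/m exhibits the equality of classes. -/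
theorem exists_scaled {𝔠 : properIdeals O N} {x : K} (hx : x ∈ congrSet O 𝔠) :
    ∃ 𝔞 : properIdeals O N, rayClass O 𝔞 = rayClass O 𝔠 ∧
      (toUnit O 𝔞 : FractionalIdeal O⁰ K) = spanSingleton O⁰ x * toUnit O 𝔠 := by
  obtain ⟨hx0, y, hy, rfl⟩ := hx
  obtain ⟨m, hm, hm0, hm1⟩ := exists_mem_congrOne O 𝔠
  obtain ⟨w, hw⟩ := (congrOne_iff O).1 hm1
  have hc : ((toPrincipalIdeal O K (Units.mk0 _ hx0) :
      (FractionalIdeal O⁰ K)ˣ) : FractionalIdeal O⁰ K) = spanSingleton O⁰ (1 + N * y) :=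
    coe_toPrincipalIdeal _
  have hymO := (mem_invLattice O).1 hy
  let z : O := m + N * ⟨y * m, hymO m hm⟩
  have hz : CongrOne O N z := (congrOne_iff O).2 ⟨w + ⟨y * m, hymO m hm⟩, by
    simp only [z]
    linear_combination hw⟩
  have hzx : (z : K) = (1 + N * y) * m := by
    simp only [z]
    push_cast
    ring
  obtain ⟨𝔞, h𝔞⟩ := exists_properIdeal O (N := N) (z := z)
    (J := toPrincipalIdeal O K (Units.mk0 _ hx0) * toUnit O 𝔠) (by
      rw [Units.val_mul, hc, spanSingleton_mul_le_iff]
      intro _ hc'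
      obtain ⟨c, hc'', rfl⟩ := (mem_toUnit O).1 hc'
      rw [mem_one_iff_mem]
      have := add_mem c.2 (mul_mem (natCast_mem O N) (hymO c hc''))
      convert! this using 1
      ring) hz (by
      rw [Units.val_mul, hc, hzx]
      exact mul_mem_mul (mem_spanSingleton_self _ _) ((mem_toUnit O).2 ⟨m, hm, rfl⟩))
  have he : (toUnit O 𝔞 : FractionalIdeal O⁰ K) = spanSingleton O⁰ (1 + N * y) * toUnit O 𝔠 := by
    rw [h𝔞, Units.val_mul, hc]
  refine ⟨𝔞, ((rayClass_eq_iff O).2 ⟨m, z, hm0, ?_, hm1, hz, ?_⟩).symm, he⟩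
  · intro h
    have : (z : K) = 0 := by rw [h]; rfl
    rw [hzx] at this
    exact mul_ne_zero hx0 (fun h => hm0 (Subtype.ext h)) this
  · rw [he, hzx, ← mul_assoc, spanSingleton_mul_spanSingleton, mul_comm (m : K)]

/-- The converse of `exists_scaled`. The multiplier ν/μ is only a quotient of elements congruent to
1, and it is the integrality of both 𝔠 and 𝔞 = (ν/μ)𝔠 that puts (ν/μ - 1)/N in 𝔠⁻¹. -/
theorem exists_mem_congrSet (hN : N ≠ 0) {𝔠 𝔞 : properIdeals O N}
    (h : rayClass O 𝔞 = rayClass O 𝔠) : ∃ x ∈ congrSet O 𝔠,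
      (toUnit O 𝔞 : FractionalIdeal O⁰ K) = spanSingleton O⁰ x * toUnit O 𝔠 := by
  obtain ⟨μ, ν, hμ0, hν0, hμ1, hν1, e⟩ := (rayClass_eq_iff O).1 h.symm
  have hK : ∀ {ν : O}, ν ≠ 0 → (ν : K) ≠ 0 := fun h h' => h (Subtype.ext h')
  have hNK : (N : K) ≠ 0 := by exact_mod_cast hN
  have he : (toUnit O 𝔞 : FractionalIdeal O⁰ K) = spanSingleton O⁰ (ν / μ : K) * toUnit O 𝔠 := by
    have h1 : spanSingleton O⁰ (ν / μ : K) =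
        spanSingleton O⁰ (μ : K)⁻¹ * spanSingleton O⁰ (ν : K) := by
      rw [spanSingleton_mul_spanSingleton]
      congr 1
      field_simp
    rw [h1, mul_assoc, ← e, ← mul_assoc, spanSingleton_mul_spanSingleton,
      inv_mul_cancel₀ (hK hμ0), spanSingleton_one, one_mul]
  refine ⟨ν / μ, ⟨div_ne_zero (hK hν0) (hK hμ0), (ν / μ - 1) / N, ?_, by field_simp; ring⟩, he⟩
  rw [mem_invLattice]
  intro c hc
  obtain ⟨w, hw⟩ := (congrOne_iff O).1 hμ1
  obtain ⟨v, hv⟩ := (congrOne_iff O).1 hν1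
  have hxc : (ν / μ : K) * c ∈ O := by
    have : (ν / μ : K) * c ∈ (toUnit O 𝔞 : FractionalIdeal O⁰ K) := by
      rw [he]
      exact mul_mem_mul (mem_spanSingleton_self _ _) ((mem_toUnit O).2 ⟨c, hc, rfl⟩)
    exact (mem_one_iff_mem O).1 (toUnit_le_one O 𝔞 this)
  -- `(x - 1) c = (ν - μ) c - N w (x - 1) c`
  have hy : (ν / μ - 1 : K) * c ∈ O := by
    have := sub_mem hxc c.2
    convert! this using 1
    ring
  have key : (ν / μ - 1 : K) / N * c = (v - w) * c - w * ((ν / μ - 1) * c) := by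
    have hvK : (ν : K) = 1 + N * v := by rw [hv]; push_cast; rfl
    have hwK : (μ : K) = 1 + N * w := by rw [hw]; push_cast; rfl
    have hμK := hK hμ0
    field_simp
    linear_combination ((c : K) * (μ - ν + ν)) * (hvK - hwK) - (c : K) * (ν - μ) * hwK
  rw [key]
  exact sub_mem (mul_mem (sub_mem v.2 w.2) c.2) (mul_mem w.2 hy)

variable (N) in
/-- The units of `O` congruent to `1` modulo `N`. -/
abbrev CongrUnits : Type _ := {ν : Oˣ // (ν : O) - 1 ∈ Ideal.span {(N : O)}}

theorem mul_unit_mem_congrSet {𝔠 : properIdeals O N} {x : K} (hx : x ∈ congrSet O 𝔠)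
    (ε : CongrUnits O N) : x * ((ε.1 : O) : K) ∈ congrSet O 𝔠 := by
  obtain ⟨hx0, y, hy, rfl⟩ := hx
  obtain ⟨w, hw⟩ := (congrOne_iff O).1 ε.2
  refine ⟨mul_ne_zero hx0 fun h => ε.1.ne_zero (Subtype.ext h), w + ((ε.1 : O) : K) * y,
    add_mem_invLattice O (mem_invLattice_of_mem O 𝔠 w.2) (mul_mem_invLattice O (ε.1 : O).2 hy), ?_⟩
  rw [hw]
  push_cast
  ring

/-- Cancelling 𝔠 leaves a unit ε with y = xε. For m ∈ 𝔠 with m ≡ 1, both xm and ym are elements of O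
congruent to 1 and ym = ε(xm), which forces ε ≡ 1. -/
theorem exists_unit_of_scaled_eq {𝔠 : properIdeals O N} {x y : K} (hx : x ∈ congrSet O 𝔠)
    (hy : y ∈ congrSet O 𝔠)
    (h : spanSingleton O⁰ x * (toUnit O 𝔠 : FractionalIdeal O⁰ K) =
      spanSingleton O⁰ y * toUnit O 𝔠) :
    ∃ ε : CongrUnits O N, y = x * ((ε.1 : O) : K) := by
  have h1 : spanSingleton O⁰ x = spanSingleton O⁰ y := (toUnit O 𝔠).isUnit.mul_left_injective h
  obtain ⟨ε, hε⟩ := spanSingleton_eq_spanSingleton.1 h1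
  have hε' : y = x * ((ε : O) : K) := by
    rw [← hε, mul_comm]
    rfl
  refine ⟨⟨ε, ?_⟩, hε'⟩
  obtain ⟨m, hm, hm0, hm1⟩ := exists_mem_congrOne O 𝔠
  obtain ⟨w, hw⟩ := (congrOne_iff O).1 hm1
  obtain ⟨-, x', hx', ex⟩ := hx
  obtain ⟨-, y', hy', ey⟩ := hy
  have hx'm := (mem_invLattice O).1 hx' m hm
  have hy'm := (mem_invLattice O).1 hy' m hm
  refine (congrOne_iff O).2 ⟨w + ⟨y' * m, hy'm⟩ - ε * (w + ⟨x' * m, hx'm⟩), Subtype.ext ?_⟩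
  have hwK : (m : K) = 1 + N * w := by rw [hw]; push_cast; rfl
  push_cast
  have : (1 + N * y' : K) = (1 + N * x') * ((ε : O) : K) := by rw [← ex, ← ey, hε']
  linear_combination (1 - ((ε : O) : K)) * hwK - (m : K) * this

end Ideals

end QuadraticOrder

end

/-! ### Oriented bases of lattices. -/

section

open scoped nonZeroDivisors MatrixGroups ComplexConjugate

namespace QuadraticOrder

section OrientedBases

variable {K : Type*} [Field K] {φ : K →+* ℂ} {L : Set K}

namespace OrientedBasis

/-- The covolume of a lattice, for the pairing `(x, y) ↦ Im (x ȳ)`. -/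
noncomputable def area (b : OrientedBasis φ L) : ℝ := (φ b.ξ₁ * conj (φ b.ξ₂)).im

theorem ξ₂_ne_zero (b : OrientedBasis φ L) : b.ξ₂ ≠ 0 := by
  intro h
  have := b.pos
  simp [h] at this

theorem map_ξ₂_ne_zero (b : OrientedBasis φ L) : φ b.ξ₂ ≠ 0 :=
  (map_ne_zero φ).2 b.ξ₂_ne_zero

theorem area_pos (b : OrientedBasis φ L) : 0 < b.area := by
  have h := b.pos
  have h2 : 0 < Complex.normSq (φ b.ξ₂) := Complex.normSq_pos.2 b.map_ξ₂_ne_zero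
  have : b.area = (φ b.ξ₁ / φ b.ξ₂).im * Complex.normSq (φ b.ξ₂) := by
    rw [area, Complex.div_im]
    field_simp
    simp [Complex.mul_im]
    ring
  rw [this]
  positivity

theorem im_combination (b : OrientedBasis φ L) (k l m n : ℤ) :
    (φ (k * b.ξ₁ + l * b.ξ₂) * conj (φ (m * b.ξ₁ + n * b.ξ₂))).im = (k * n - l * m) * b.area := by
  simp [area, Complex.mul_im]
  ring

theorem coord_eq_zero (b : OrientedBasis φ L) {m n : ℤ} (h : m * b.ξ₁ + n * b.ξ₂ = 0) :
    m = 0 ∧ n = 0 := by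
  have h1 := b.im_combination m n 0 1
  have h2 := b.im_combination m n 1 0
  rw [h, map_zero, zero_mul, Complex.zero_im] at h1 h2
  have ha := b.area_pos.ne'
  constructor
  · simpa [ha] using h1.symm
  · simpa [ha] using h2.symm

theorem coord_unique (b : OrientedBasis φ L) {m n m' n' : ℤ}
    (h : m * b.ξ₁ + n * b.ξ₂ = m' * b.ξ₁ + n' * b.ξ₂) : m = m' ∧ n = n' := by
  have := b.coord_eq_zero (m := m - m') (n := n - n') (by push_cast; linear_combination h)
  exact ⟨sub_eq_zero.1 this.1, sub_eq_zero.1 this.2⟩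

theorem ξ₁_mem (b : OrientedBasis φ L) : b.ξ₁ ∈ L := (b.mem_iff _).2 ⟨1, 0, by simp⟩

theorem ξ₂_mem (b : OrientedBasis φ L) : b.ξ₂ ∈ L := (b.mem_iff _).2 ⟨0, 1, by simp⟩

theorem moebius_eq (b : OrientedBasis φ L) (γ : SL(2, ℤ)) :
    φ (γ 0 0 * b.ξ₁ + γ 0 1 * b.ξ₂) / φ (γ 1 0 * b.ξ₁ + γ 1 1 * b.ξ₂) =
      ((γ • b.ξ : UpperHalfPlane) : ℂ) := by
  have h := b.map_ξ₂_ne_zero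
  have hξ : (b.ξ : ℂ) = φ b.ξ₁ / φ b.ξ₂ := rfl
  rw [UpperHalfPlane.coe_specialLinearGroup_apply, hξ]
  simp only [map_add, map_mul, map_intCast, algebraMap_int_eq, eq_intCast, Complex.ofReal_intCast]
  have h1 : ∀ x y : ℂ, x * (φ b.ξ₁ / φ b.ξ₂) + y = (x * φ b.ξ₁ + y * φ b.ξ₂) / φ b.ξ₂ := by
    intro x y
    field_simp
  rw [h1, h1, div_div_div_cancel_right₀ h]

/-- The action of `SL₂(ℤ)` on the oriented bases of a lattice. -/
def smulSL (b : OrientedBasis φ L) (γ : SL(2, ℤ)) : OrientedBasis φ L where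
  ξ₁ := γ 0 0 * b.ξ₁ + γ 0 1 * b.ξ₂
  ξ₂ := γ 1 0 * b.ξ₁ + γ 1 1 * b.ξ₂
  mem_iff x := by
    have hdet := Matrix.SpecialLinearGroup.det_coe γ
    rw [Matrix.det_fin_two] at hdet
    have hK := congrArg (Int.cast : ℤ → K) hdet
    push_cast at hK
    rw [b.mem_iff]
    constructor
    · rintro ⟨m, n, rfl⟩
      refine ⟨m * γ 1 1 - n * γ 1 0, n * γ 0 0 - m * γ 0 1, ?_⟩
      push_cast
      linear_combination -(m * b.ξ₁ + n * b.ξ₂) * hK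
    · rintro ⟨m, n, rfl⟩
      refine ⟨m * γ 0 0 + n * γ 1 0, m * γ 0 1 + n * γ 1 1, ?_⟩
      push_cast
      ring
  pos := by
    rw [b.moebius_eq γ]
    exact (γ • b.ξ).im_pos

theorem smulSL_ξ (b : OrientedBasis φ L) (γ : SL(2, ℤ)) : (b.smulSL γ).ξ = γ • b.ξ :=
  UpperHalfPlane.ext (b.moebius_eq γ)

/-- The basis `xξ₁, xξ₂` of the lattice `xL`. -/
def scale (b : OrientedBasis φ L) {x : K} (hx : x ≠ 0) {L' : Set K}
    (hL' : ∀ y, y ∈ L' ↔ ∃ z ∈ L, y = x * z) : OrientedBasis φ L' where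
  ξ₁ := x * b.ξ₁
  ξ₂ := x * b.ξ₂
  mem_iff y := by
    rw [hL']
    constructor
    · rintro ⟨z, hz, rfl⟩
      obtain ⟨m, n, rfl⟩ := (b.mem_iff z).1 hz
      exact ⟨m, n, by ring⟩
    · rintro ⟨m, n, rfl⟩
      exact ⟨m * b.ξ₁ + n * b.ξ₂, (b.mem_iff _).2 ⟨m, n, rfl⟩, by ring⟩
  pos := by
    rw [map_mul, map_mul, mul_div_mul_left _ _ ((map_ne_zero φ).2 hx)]
    exact b.pos

theorem area_scale (b : OrientedBasis φ L) {x : K} (hx : x ≠ 0) {L' : Set K}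
    (hL' : ∀ y, y ∈ L' ↔ ∃ z ∈ L, y = x * z) :
    (b.scale hx hL').area = ‖φ x‖ ^ 2 * b.area := by
  rw [← Complex.normSq_eq_norm_sq]
  simp only [area, scale, map_mul]
  simp [Complex.mul_im, Complex.normSq_apply]
  ring

theorem exists_module_basis (b : OrientedBasis φ L) {M : Type*} [AddCommGroup M] (f : M →+ K)
    (hf : Function.Injective f) (hL : ∀ x, x ∈ L ↔ x ∈ Set.range f) :
    ∃ B : Module.Basis (Fin 2) ℤ M, f (B 0) = b.ξ₁ ∧ f (B 1) = b.ξ₂ := by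
  obtain ⟨m₁, h₁⟩ := (hL _).1 b.ξ₁_mem
  obtain ⟨m₂, h₂⟩ := (hL _).1 b.ξ₂_mem
  have hli : LinearIndependent ℤ ![m₁, m₂] := by
    rw [LinearIndependent.pair_iff]
    intro s t hst
    have := congrArg f hst
    rw [map_add, map_zsmul, map_zsmul, map_zero, h₁, h₂, zsmul_eq_mul, zsmul_eq_mul] at this
    exact b.coord_eq_zero this
  have hsp : ⊤ ≤ Submodule.span ℤ (Set.range ![m₁, m₂]) := by
    intro y _
    obtain ⟨m, n, e⟩ := (b.mem_iff (f y)).1 ((hL _).2 ⟨y, rfl⟩)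
    have : y = m • m₁ + n • m₂ := hf (by
      rw [map_add, map_zsmul, map_zsmul, h₁, h₂, zsmul_eq_mul, zsmul_eq_mul, e])
    rw [this]
    exact add_mem (Submodule.smul_mem _ _ (Submodule.subset_span ⟨0, rfl⟩))
      (Submodule.smul_mem _ _ (Submodule.subset_span ⟨1, rfl⟩))
  refine ⟨Module.Basis.mk hli hsp, ?_, ?_⟩
  · simpa using h₁
  · simpa using h₂

end OrientedBasis

end OrientedBases

/-! ### Ideal norms as ratios of areas, and the generator of the order. -/

section Norms

open FractionalIdeal

variable {K : Type*} [Field K] {φ : K →+* ℂ}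

/-- The index of a sublattice is the absolute value of the determinant of a change of basis, and the
area form is multiplied by that determinant. Both bases being positively oriented, the sign is
positive. -/
theorem idealNorm_mul_area {O : Subring K} {𝔞 : Ideal O} {L : Set K}
    (hL : ∀ x, x ∈ L ↔ ∃ a ∈ 𝔞, (a : K) = x)
    (b : OrientedBasis φ (O : Set K)) (b' : OrientedBasis φ L) :
    idealNorm O 𝔞 * b.area = b'.area := by
  obtain ⟨B, hB1, hB2⟩ := b.exists_module_basis (M := O) O.subtype.toAddMonoidHom
    Subtype.val_injective (fun x => by simp)
  obtain ⟨B', hB1', hB2'⟩ := b'.exists_module_basis (M := 𝔞.toAddSubgroup)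
    (O.subtype.toAddMonoidHom.comp 𝔞.toAddSubgroup.subtype)
    (Subtype.val_injective.comp Subtype.val_injective) (fun x => by
      rw [hL]
      exact ⟨fun ⟨a, ha, e⟩ => ⟨⟨a, ha⟩, e⟩, fun ⟨a, e⟩ => ⟨a.1, a.2, e⟩⟩)
  have hindex : idealNorm O 𝔞 = 𝔞.toAddSubgroup.index := rfl
  rw [hindex, AddSubgroup.index_eq_natAbs_det B _ B', Module.Basis.det_apply, Matrix.det_fin_two]
  simp only [Module.Basis.toMatrix_apply]
  have hco : ∀ y : O, (y : K) = B.repr y 0 * b.ξ₁ + B.repr y 1 * b.ξ₂ := fun y => by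
    have h := congrArg (fun z : O => (z : K)) (B.sum_repr y)
    rw [Fin.sum_univ_two] at h
    rw [← hB1, ← hB2]
    simpa [zsmul_eq_mul] using h.symm
  have h1 := hco (B' 0)
  have h2 := hco (B' 1)
  have h3 : b'.area = (B.repr (B' 0) 0 * B.repr (B' 1) 1 - B.repr (B' 0) 1 * B.repr (B' 1) 0) *
      b.area := by
    rw [← b.im_combination, ← h1, ← h2, OrientedBasis.area, ← hB1', ← hB2']
    rfl
  have hpos := b'.area_pos
  have hpos' := b.area_pos
  rw [h3] at hpos ⊢
  congr 1
  have hint : 0 < B.repr (B' 0) 0 * B.repr (B' 1) 1 - B.repr (B' 0) 1 * B.repr (B' 1) 0 := by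
    have := pos_of_mul_pos_left hpos hpos'.le
    exact_mod_cast this
  rw [mul_comm ((B.repr (B' 1)) 0), Nat.cast_natAbs, abs_of_pos hint]
  push_cast
  ring

variable [NumberField K] [Algebra.IsQuadraticExtension ℚ K]
  (O : Subring K) [Module.Finite ℤ O] [IsFractionRing O K] {N : ℕ}

omit [NumberField K] [Algebra.IsQuadraticExtension ℚ K] [Module.Finite ℤ O] in
/-- In a totally complex field an order is not contained in the real numbers. -/
theorem exists_im_ne_zero [NumberField.IsTotallyComplex K] (φ : K →+* ℂ) :
    ∃ ω ∈ O, (φ ω).im ≠ 0 := by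
  by_contra! h
  refine NumberField.IsTotallyComplex.complexEmbedding_not_isReal φ ?_
  rw [NumberField.ComplexEmbedding.isReal_iff]
  ext x
  obtain ⟨a, b, -, rfl⟩ := IsFractionRing.div_surjective O x
  have hc : ∀ a : O, conj (φ a) = φ a := fun a => Complex.conj_eq_iff_im.2 (h a a.2)
  rw [NumberField.ComplexEmbedding.conjugate_coe_eq, map_div₀, map_div₀]
  exact congrArg₂ (· / ·) (hc a) (hc b)

theorem exists_orientedBasis [NumberField.IsTotallyComplex K] (φ : K →+* ℂ)
    {J : FractionalIdeal O⁰ K} (hJ : J ≠ 0) : Nonempty (OrientedBasis φ {x | x ∈ J}) := by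
  obtain ⟨a, 𝔞, ha, e⟩ := exists_eq_spanSingleton_mul J
  have haK : (a : K) ≠ 0 := fun h => ha (Subtype.ext h)
  obtain ⟨α, hα, β, hβ, hgen⟩ := exists_two_generators O 𝔞
  have hmem : ∀ x, x ∈ J ↔ ∃ m n : ℤ, x = m * (α / a : K) + n * (β / a : K) := by
    intro x
    rw [e, mem_singleton_mul]
    constructor
    · rintro ⟨y, hy, rfl⟩
      obtain ⟨y, hy', rfl⟩ := (mem_coeIdeal O⁰).1 hy
      obtain ⟨m, n, rfl⟩ := hgen y hy'
      refine ⟨m, n, ?_⟩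
      change (a : K)⁻¹ * ((m • α + n • β : O) : K) = _
      push_cast [zsmul_eq_mul]
      field_simp
    · rintro ⟨m, n, rfl⟩
      refine ⟨((m • α + n • β : O) : K), (mem_coeIdeal O⁰).2 ⟨m • α + n • β,
        add_mem (zsmul_mem hα _) (zsmul_mem hβ _), rfl⟩, ?_⟩
      change _ = (a : K)⁻¹ * ((m • α + n • β : O) : K)
      push_cast [zsmul_eq_mul]
      field_simp
  generalize (α : K) / a = p, (β : K) / a = q at hmem
  -- If the generators were real multiples of each other, the whole lattice J would lie on a real
  -- line. For y ∈ J nonzero and ω ∈ O not real, J also contains ωy, which is off the line through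
  -- y.
  have him : (φ p * conj (φ q)).im ≠ 0 := by
    intro h0
    obtain ⟨ω, hω, hω'⟩ := exists_im_ne_zero O φ
    obtain ⟨y, hy, hy0⟩ : ∃ y ∈ J, y ≠ 0 := by
      by_contra! h
      exact hJ ((FractionalIdeal.eq_zero_iff).2 h)
    have hωy : ω * y ∈ J := by
      exact Submodule.smul_mem (J : Submodule O K) ⟨ω, hω⟩ hy
    obtain ⟨k, l, e1⟩ := (hmem _).1 hωy
    obtain ⟨m, n, e2⟩ := (hmem _).1 hy
    have h1 : (φ (ω * y) * conj (φ y)).im = 0 := by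
      rw [e1, e2]
      simp only [map_add, map_mul, map_intCast]
      have := h0
      simp [Complex.mul_im] at this ⊢
      linear_combination ((k : ℝ) * n - l * m) * this
    have h2 : (φ (ω * y) * conj (φ y)).im = (φ ω).im * Complex.normSq (φ y) := by
      rw [map_mul]
      simp [Complex.mul_im, Complex.normSq_apply]
      ring
    rw [h2] at h1
    have := Complex.normSq_pos.2 ((map_ne_zero φ).2 hy0)
    exact mul_ne_zero hω' this.ne' h1
  have hdiv : ∀ z w : ℂ, 0 < (z * conj w).im → 0 < (z / w).im := by
    intro z w h
    have hw : w ≠ 0 := by rintro rfl; simp at h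
    have hw' := Complex.normSq_pos.2 hw
    have : (z / w).im = (z * conj w).im / Complex.normSq w := by
      rw [Complex.div_im]
      simp [Complex.mul_im]
      ring
    rw [this]
    positivity
  rcases lt_or_gt_of_ne him with h | h
  · refine ⟨⟨q, p, fun x => ?_, hdiv _ _ ?_⟩⟩
    · rw [Set.mem_ofPred_eq, hmem, exists_comm]
      simp only [add_comm]
    · simp [Complex.mul_im] at h ⊢
      linarith
  · exact ⟨⟨p, q, hmem, hdiv _ _ h⟩⟩

theorem exists_orientedBasis_order [NumberField.IsTotallyComplex K] (φ : K →+* ℂ) :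
    Nonempty (OrientedBasis φ (O : Set K)) := by
  obtain ⟨b⟩ := exists_orientedBasis O φ (J := 1) one_ne_zero
  exact ⟨⟨b.ξ₁, b.ξ₂, fun x => (mem_one_iff_mem O).symm.trans (b.mem_iff x), b.pos⟩⟩

theorem nonempty_orientedBasis_invLattice [NumberField.IsTotallyComplex K] (φ : K →+* ℂ)
    (𝔠 : properIdeals O N) : Nonempty (OrientedBasis φ (invLattice O 𝔠)) :=
  exists_orientedBasis O φ (Units.ne_zero _)

/-- Multiplication by x multiplies areas by |x|². -/
theorem idealNorm_of_scaled [NumberField.IsTotallyComplex K] (φ : K →+* ℂ) {𝔞 𝔠 : Ideal O}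
    (h𝔠 : 𝔠 ≠ ⊥) {x : K} (hx : x ≠ 0)
    (h : (𝔞 : FractionalIdeal O⁰ K) = spanSingleton O⁰ x * 𝔠) :
    (idealNorm O 𝔞 : ℝ) = idealNorm O 𝔠 * ‖φ x‖ ^ 2 := by
  obtain ⟨b⟩ := exists_orientedBasis_order O φ
  obtain ⟨b'⟩ := exists_orientedBasis O φ (coeIdeal_ne_zero.2 h𝔠)
  have h1 := idealNorm_mul_area (fun x => mem_coeIdeal O⁰) b b'
  have h2 := idealNorm_mul_area (fun x => mem_coeIdeal O⁰) b
    (b'.scale hx (L' := {y | y ∈ (𝔞 : FractionalIdeal O⁰ K)}) fun y => by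
      rw [Set.mem_ofPred_eq, h, mem_singleton_mul]
      rfl)
  rw [b'.area_scale, ← h1] at h2
  refine mul_right_cancel₀ b.area_pos.ne' (h2.trans ?_)
  ring

theorem idealNorm_pos [NumberField.IsTotallyComplex K] (φ : K →+* ℂ) {𝔠 : Ideal O}
    (h𝔠 : 𝔠 ≠ ⊥) : 0 < idealNorm O 𝔠 := by
  obtain ⟨b⟩ := exists_orientedBasis_order O φ
  obtain ⟨b'⟩ := exists_orientedBasis O φ (coeIdeal_ne_zero.2 h𝔠)
  have h1 := idealNorm_mul_area (fun x => mem_coeIdeal O⁰) b b'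
  have := b'.area_pos
  rw [← h1] at this
  exact_mod_cast pos_of_mul_pos_left this b.area_pos.le

theorem idealNorm_span_singleton [NumberField.IsTotallyComplex K] (φ : K →+* ℂ) {y : O}
    (hy : y ≠ 0) : (idealNorm O (Ideal.span {y}) : ℝ) = ‖φ y‖ ^ 2 := by
  have h1 : (idealNorm O (⊤ : Ideal O) : ℝ) = 1 := by
    have : Subsingleton (O ⧸ (⊤ : Ideal O)) := Ideal.Quotient.subsingleton_iff.2 rfl
    rw [idealNorm, Nat.card_unique, Nat.cast_one]
  have := idealNorm_of_scaled O φ (𝔞 := Ideal.span {y}) (𝔠 := ⊤) (x := y) top_ne_bot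
    (fun h => hy (Subtype.ext h)) (by rw [coeIdeal_span_singleton, coeIdeal_top, mul_one]; rfl)
  rw [this, h1, one_mul]

/-- The standard generator of the order. -/
theorem exists_isTau [NumberField.IsTotallyComplex K] (φ : K →+* ℂ) : ∃ τ, IsTau φ O τ := by
  obtain ⟨b⟩ := exists_orientedBasis_order O φ
  obtain ⟨p, q, hpq⟩ := (b.mem_iff 1).1 O.one_mem
  -- The element 1 is primitive in the lattice O: if 1 = gy with y ∈ O, then y = 1/g is rational and
  -- integral over ℤ, so g = 1. Hence 1 can be completed to a basis of O.
  have hcop : IsCoprime p q := by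
    rw [Int.isCoprime_iff_gcd_eq_one]
    obtain ⟨p', hp'⟩ := Int.gcd_dvd_left p q
    obtain ⟨q', hq'⟩ := Int.gcd_dvd_right p q
    set g := Int.gcd p q with hg
    have hy : (p' * b.ξ₁ + q' * b.ξ₂ : K) ∈ O := (b.mem_iff _).2 ⟨p', q', rfl⟩
    have hgy : (g : K) * (p' * b.ξ₁ + q' * b.ξ₂) = 1 := by
      rw [hpq, hp', hq']
      push_cast
      ring
    have hg0 : (g : K) ≠ 0 := left_ne_zero_of_mul_eq_one hgy
    have hint : IsIntegral ℤ (p' * b.ξ₁ + q' * b.ξ₂ : K) :=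
      (Algebra.IsIntegral.isIntegral (R := ℤ) (⟨_, hy⟩ : O)).map (O.subtype.toIntAlgHom)
    obtain ⟨m, hm⟩ := exists_int_of_rat hint ((g : ℚ)⁻¹) (by
      rw [map_inv₀, map_natCast]
      exact eq_inv_of_mul_eq_one_right hgy)
    rw [hm] at hgy
    have : (g : ℤ) * m = 1 := by exact_mod_cast hgy
    have := Int.eq_one_or_neg_one_of_mul_eq_one this
    omega
  obtain ⟨γ, h0, h1⟩ := hcop.exists_SL2_row 1
  set b' := b.smulSL γ
  have hξ₂ : b'.ξ₂ = 1 := by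
    rw [hpq, ← h0, ← h1]
    rfl
  obtain ⟨m, n, hmn⟩ := (b'.mem_iff (b'.ξ₁ * b'.ξ₁)).1 (O.mul_mem b'.ξ₁_mem b'.ξ₁_mem)
  have hpos := b'.pos
  rw [hξ₂, map_one, _root_.div_one] at hpos
  rw [hξ₂, mul_one] at hmn
  have hre : (φ b'.ξ₁).re = m / 2 := by
    have h := congrArg (fun x => (φ x).im) hmn
    simp [Complex.mul_im] at h
    have : (φ b'.ξ₁).im * (2 * (φ b'.ξ₁).re - m) = 0 := by linarith
    rcases mul_eq_zero.1 this with h' | h'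
    · exact absurd h' hpos.ne'
    · linarith
  -- Here m is the trace of ξ₁. Rounding m/2 upwards, as the integer division does, leaves real part
  -- 0 for m even and -1/2 for m odd.
  refine ⟨b'.ξ₁ - ((m + 1) / 2 : ℤ), fun x => ?_, ?_, ?_⟩
  · refine (b'.mem_iff x).trans ⟨?_, ?_⟩
    · rintro ⟨k, l, rfl⟩
      exact ⟨k, l + k * ((m + 1) / 2), by rw [hξ₂]; push_cast; ring⟩
    · rintro ⟨k, l, rfl⟩
      exact ⟨k, l - k * ((m + 1) / 2), by rw [hξ₂]; push_cast; ring⟩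
  · simpa using hpos
  · rw [map_sub, map_intCast, Complex.sub_re, hre, Complex.intCast_re]
    rcases Int.even_or_odd' m with ⟨j, rfl | rfl⟩
    · left
      rw [show (2 * j + 1) / 2 = j by omega]
      push_cast
      ring
    · right
      rw [show (2 * j + 1 + 1) / 2 = j + 1 by omega]
      push_cast
      ring

/-- The matrix expressing a basis of `O` through a basis of `𝔠⁻¹` has determinant prime to `N`. -/
theorem isCoprime_det {𝔠 : properIdeals O N} (b : OrientedBasis φ (invLattice O 𝔠)) {τ : K}
    (hτ : IsTau φ O τ) {A : Matrix (Fin 2) (Fin 2) ℤ} (h1 : τ = A 0 0 * b.ξ₁ + A 0 1 * b.ξ₂)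
    (h2 : 1 = A 1 0 * b.ξ₁ + A 1 1 * b.ξ₂) : IsCoprime A.det (N : ℤ) := by
  obtain ⟨μ, hμ, -, hμ1⟩ := exists_mem_congrOne O 𝔠
  obtain ⟨w, hw⟩ := (congrOne_iff O).1 hμ1
  have hwK : (μ : K) = 1 + N * w := by rw [hw]; push_cast; rfl
  -- With μ = 1 + Nw in 𝔠, writing y = μy - Nwy shows 𝔠⁻¹ = O + N𝔠⁻¹. Thus a basis of O spans 𝔠⁻¹
  -- modulo N, and A is invertible modulo N.
  have key : ∀ y ∈ invLattice O 𝔠, ∃ k l m n : ℤ,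
      y = (k * τ + l) + N * (m * b.ξ₁ + n * b.ξ₂) := by
    intro y hy
    obtain ⟨k, l, e⟩ := (hτ.1 _).1 ((mem_invLattice O).1 hy μ hμ)
    obtain ⟨m, n, e'⟩ := (b.mem_iff _).1 (mul_mem_invLattice O (neg_mem w.2) hy)
    refine ⟨k, l, m, n, ?_⟩
    rw [← e, ← e', hwK]
    ring
  obtain ⟨k, l, m, n, e⟩ := key _ b.ξ₁_mem
  obtain ⟨k', l', m', n', e'⟩ := key _ b.ξ₂_mem
  obtain ⟨e1, e2⟩ := b.coord_unique (m := 1) (n := 0) (m' := k * A 0 0 + l * A 1 0 + N * m)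
    (n' := k * A 0 1 + l * A 1 1 + N * n) (by
      push_cast
      linear_combination e + (k : K) * h1 + (l : K) * h2)
  obtain ⟨e3, e4⟩ := b.coord_unique (m := 0) (n := 1) (m' := k' * A 0 0 + l' * A 1 0 + N * m')
    (n' := k' * A 0 1 + l' * A 1 1 + N * n') (by
      push_cast
      linear_combination e' + (k' : K) * h1 + (l' : K) * h2)
  refine ⟨k * l' - l * k', m + n' - N * (m * n' - n * m'), ?_⟩
  rw [Matrix.det_fin_two]
  have f1 : k * A 0 0 + l * A 1 0 = 1 - N * m := by linarith
  have f2 : k * A 0 1 + l * A 1 1 = - N * n := by linarith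
  have f3 : k' * A 0 0 + l' * A 1 0 = - N * m' := by linarith
  have f4 : k' * A 0 1 + l' * A 1 1 = 1 - N * n' := by linarith
  have : (k * l' - l * k') * (A 0 0 * A 1 1 - A 0 1 * A 1 0) =
      (k * A 0 0 + l * A 1 0) * (k' * A 0 1 + l' * A 1 1) -
      (k * A 0 1 + l * A 1 1) * (k' * A 0 0 + l' * A 1 0) := by ring
  rw [this, f1, f2, f3, f4]
  ring

end Norms

end QuadraticOrder

end

/-! ### Partial zeta functions as Epstein zeta functions. -/

section

open scoped nonZeroDivisors MatrixGroups

namespace QuadraticOrder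

section ClassSeries

open FractionalIdeal

variable {K : Type*} [Field K] [NumberField K] [Algebra.IsQuadraticExtension ℚ K]
  (O : Subring K) [Module.Finite ℤ O] [IsFractionRing O K] {N : ℕ}

theorem ofReal_mul_sq_cpow {a r : ℝ} (ha : 0 ≤ a) (hr : 0 < r) (s : ℂ) :
    ((a * r ^ 2 : ℝ) : ℂ) ^ (-s) = (a : ℂ) ^ (-s) * (r : ℂ) ^ (-2 * s) := by
  have hr' : (r : ℂ) ≠ 0 := by exact_mod_cast hr.ne'
  rw [Complex.ofReal_mul, Complex.mul_cpow_ofReal_nonneg ha (by positivity), sq, Complex.ofReal_mul,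
    Complex.mul_cpow_ofReal_nonneg hr.le hr.le, ← Complex.cpow_add _ _ hr']
  congr 2
  ring

/-- The sum of `|x| ^ (-2s)` over `1 + N𝔠⁻¹`, as an Epstein zeta function. -/
theorem hasSum_congrSet (hN : N ≠ 0) {φ : K →+* ℂ} {𝔠 : properIdeals O N}
    (b : OrientedBasis φ (invLattice O 𝔠)) {d : ℤ} {v : ℝ} (hv : N * v = d) {y : K}
    (hy : y ∈ invLattice O 𝔠) (h1 : 1 = N * y + d * b.ξ₂) {s : ℂ} (hs : 1 < s.re) :
    HasSum (fun x : congrSet O 𝔠 => (‖φ x‖ : ℂ) ^ (-2 * s))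
      (((N * ‖φ b.ξ₂‖ : ℝ) : ℂ) ^ (-2 * s) * epsteinZeta b.ξ v s) := by
  let g : ℤ × ℤ → K := fun p => N * (p.1 * b.ξ₁ + p.2 * b.ξ₂) + d * b.ξ₂
  let F : K → ℂ := fun x => (‖φ x‖ : ℂ) ^ (-2 * s)
  have hNK : (N : K) ≠ 0 := by exact_mod_cast hN
  have hginj : Function.Injective g := by
    intro p p' h
    have := b.coord_unique (mul_left_cancel₀ hNK (add_right_cancel h))
    exact Prod.ext this.1 this.2
  have hφ : ∀ p : ℤ × ℤ, ‖φ (g p)‖ = N * ‖φ b.ξ₂‖ * ‖(p.1 : ℂ) * b.ξ + ((p.2 + v : ℝ) : ℂ)‖ := by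
    intro p
    have hξ : (b.ξ : ℂ) = φ b.ξ₁ / φ b.ξ₂ := rfl
    have hv' : (N : ℂ) * v = d := by exact_mod_cast hv
    have hne := b.map_ξ₂_ne_zero
    rw [← Complex.norm_natCast N, ← norm_mul, ← norm_mul, hξ]
    congr 1
    simp only [g, map_add, map_mul, map_intCast, map_natCast]
    push_cast
    field_simp
    linear_combination -(φ b.ξ₂) * hv'
  have h2 := (hasSum_epsteinZeta b.ξ v hs).mul_left (((N * ‖φ b.ξ₂‖ : ℝ) : ℂ) ^ (-2 * s))
  have h3 : HasSum (Set.indicator (Set.range g) F ∘ g)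
      (((N * ‖φ b.ξ₂‖ : ℝ) : ℂ) ^ (-2 * s) * epsteinZeta b.ξ v s) := by
    refine h2.congr_fun fun p => ?_
    rw [Function.comp, Set.indicator_of_mem (Set.mem_range_self p)]
    simp only [F]
    rw [hφ, Complex.ofReal_mul, Complex.mul_cpow_ofReal_nonneg (by positivity) (norm_nonneg _)]
  rw [hginj.hasSum_iff fun x hx => Set.indicator_of_notMem hx _] at h3
  change HasSum (F ∘ Subtype.val) _
  rw [hasSum_subtype_iff_indicator]
  convert! h3 using 1
  have hmem : ∀ x, x ∈ congrSet O 𝔠 ↔ x ≠ 0 ∧ x ∈ Set.range g := by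
    intro x
    refine and_congr_right fun _ => ⟨?_, ?_⟩
    · rintro ⟨z, hz, rfl⟩
      obtain ⟨m, n, e⟩ := (b.mem_iff _).1 (add_mem_invLattice O hz hy)
      refine ⟨(m, n), ?_⟩
      simp only [g]
      rw [← e]
      linear_combination -h1
    · rintro ⟨⟨m, n⟩, rfl⟩
      refine ⟨(m * b.ξ₁ + n * b.ξ₂) + (-1 : K) * y, add_mem_invLattice O ((b.mem_iff _).2 ⟨m, n, rfl⟩)
        (mul_mem_invLattice O (neg_mem O.one_mem) hy), ?_⟩
      simp only [g]
      linear_combination -h1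
  funext x
  -- The coset 1 + N𝔠⁻¹ contains 0 exactly when N divides d, as it does for N = 1. The term there is
  -- 0^(-2s) = 0, matching the Epstein series.
  rcases eq_or_ne x 0 with rfl | hx
  · have hF : F 0 = 0 := by
      simp only [F, map_zero, norm_zero, Complex.ofReal_zero]
      refine Complex.zero_cpow fun h => ?_
      have := congrArg Complex.re h
      simp at this
      linarith
    rw [Set.indicator_apply_eq_zero.2 fun _ => hF, Set.indicator_apply_eq_zero.2 fun _ => hF]
  · by_cases h : x ∈ Set.range g
    · rw [Set.indicator_of_mem h, Set.indicator_of_mem ((hmem x).2 ⟨hx, h⟩)]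
    · rw [Set.indicator_of_notMem h, Set.indicator_of_notMem fun h' => h ((hmem x).1 h').2]

/-- Choosing one multiplier for each ideal of the class, every other multiplier of that ideal
differs from it by a unique unit congruent to 1. -/
theorem exists_equiv_congrSet (hN : N ≠ 0) (𝔠 : properIdeals O N) :
    ∃ e : {𝔞 : properIdeals O N // rayClass O 𝔞 = rayClass O 𝔠} × CongrUnits O N ≃ congrSet O 𝔠,
      ∀ p, (toUnit O p.1.1 : FractionalIdeal O⁰ K) = spanSingleton O⁰ (e p : K) * toUnit O 𝔠 := by
  choose x hx hx' using fun 𝔞 : {𝔞 : properIdeals O N // rayClass O 𝔞 = rayClass O 𝔠} =>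
    exists_mem_congrSet O hN 𝔞.2
  let f : {𝔞 : properIdeals O N // rayClass O 𝔞 = rayClass O 𝔠} × CongrUnits O N → congrSet O 𝔠 :=
    fun p => ⟨x p.1 * ((p.2.1 : O) : K), mul_unit_mem_congrSet O (hx p.1) p.2⟩
  have hf : ∀ p, (toUnit O p.1.1 : FractionalIdeal O⁰ K) =
      spanSingleton O⁰ (f p : K) * toUnit O 𝔠 := fun p => by
    rw [hx' p.1]
    congr 1
    rw [spanSingleton_eq_spanSingleton]
    exact ⟨p.2.1, mul_comm _ _⟩
  refine ⟨Equiv.ofBijective f ⟨?_, ?_⟩, hf⟩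
  · intro p q h
    have h1 : p.1 = q.1 := by
      refine Subtype.ext (toUnit_injective O (Units.ext ?_))
      rw [hf, hf, h]
    refine Prod.ext h1 (Subtype.ext (Units.ext (Subtype.ext ?_)))
    have h2 : x p.1 * ((p.2.1 : O) : K) = x q.1 * ((q.2.1 : O) : K) := congrArg Subtype.val h
    rw [h1] at h2
    exact mul_left_cancel₀ (hx q.1).1 h2
  · intro y
    obtain ⟨𝔞, h1, h2⟩ := exists_scaled O y.2
    rw [hx' ⟨𝔞, h1⟩] at h2
    obtain ⟨ε, hε⟩ := exists_unit_of_scaled_eq O (hx ⟨𝔞, h1⟩) y.2 h2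
    exact ⟨(⟨𝔞, h1⟩, ε), Subtype.ext hε.symm⟩

variable [NumberField.IsTotallyComplex K]

theorem idealNorm_cpow (φ : K →+* ℂ) {𝔞 𝔠 : properIdeals O N} {x : K} (hx : x ≠ 0)
    (h : (toUnit O 𝔞 : FractionalIdeal O⁰ K) = spanSingleton O⁰ x * toUnit O 𝔠) (s : ℂ) :
    (idealNorm O 𝔞.1 : ℂ) ^ (-s) =
      (idealNorm O 𝔠.1 : ℂ) ^ (-s) * (‖φ x‖ : ℂ) ^ (-2 * s) := by
  rw [coe_toUnit, coe_toUnit] at h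
  have h1 := idealNorm_of_scaled O φ 𝔠.2.1 hx h
  have h2 := ofReal_mul_sq_cpow (Nat.cast_nonneg (idealNorm O 𝔠.1))
    (norm_pos_iff.2 ((map_ne_zero φ).2 hx)) s
  rw [← h1] at h2
  simpa only [Complex.ofReal_natCast] using h2

/-- The partial zeta function of a ray class. -/
theorem hasSum_rayClass (hN : N ≠ 0) {φ : K →+* ℂ} {𝔠 : properIdeals O N}
    (b : OrientedBasis φ (invLattice O 𝔠)) {d : ℤ} {v : ℝ} (hv : N * v = d) {y : K}
    (hy : y ∈ invLattice O 𝔠) (h1 : 1 = N * y + d * b.ξ₂) {s : ℂ} (hs : 1 < s.re) :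
    unitCount O N ≠ 0 ∧
    HasSum (fun 𝔞 : {𝔞 : properIdeals O N // rayClass O 𝔞 = rayClass O 𝔠} =>
      (idealNorm O 𝔞.1.1 : ℂ) ^ (-s))
      ((unitCount O N : ℂ)⁻¹ * ((idealNorm O 𝔠.1 * (N * ‖φ b.ξ₂‖) ^ 2 : ℝ) : ℂ) ^ (-s) *
        epsteinZeta b.ξ v s) := by
  have hN0 : (0 : ℝ) < N := by positivity
  obtain ⟨e, he⟩ := exists_equiv_congrSet O hN 𝔠
  have h2 := (hasSum_congrSet O hN b hv hy h1 hs).mul_left ((idealNorm O 𝔠.1 : ℂ) ^ (-s))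
  rw [← mul_assoc, ← Complex.ofReal_natCast, ← ofReal_mul_sq_cpow (Nat.cast_nonneg _)
    (mul_pos hN0 (norm_pos_iff.2 b.map_ξ₂_ne_zero)), Complex.ofReal_natCast, ← e.hasSum_iff] at h2
  have h3 : HasSum (fun p : {𝔞 : properIdeals O N // rayClass O 𝔞 = rayClass O 𝔠} ×
      CongrUnits O N => (idealNorm O p.1.1.1 : ℂ) ^ (-s)) _ :=
    h2.congr_fun fun p => idealNorm_cpow O φ (e p).2.1 (he p) s
  -- In the convergent sum over pairs (ideal, unit) the terms do not depend on the unit and are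
  -- nonzero, so the units are finite in number.
  have hfin : Finite (CongrUnits O N) := by
    by_contra hinf
    rw [not_finite_iff_infinite] at hinf
    have h4 := h3.summable.comp_injective (i := fun ε : CongrUnits O N =>
      ((⟨𝔠, rfl⟩ : {𝔞 : properIdeals O N // rayClass O 𝔞 = rayClass O 𝔠}), ε))
      (Prod.mk_right_injective _)
    have h5 := (summable_const_iff (β := CongrUnits O N) ((idealNorm O 𝔠.1 : ℂ) ^ (-s))).1 h4
    have h6 : (idealNorm O 𝔠.1 : ℂ) ≠ 0 := by
      exact_mod_cast (idealNorm_pos O φ 𝔠.2.1).ne'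
    exact (Complex.cpow_ne_zero_iff_of_exponent_ne_zero (by
      intro h; have := congrArg Complex.re h; simp at this; linarith)).2 h6 h5
  have : Nonempty (CongrUnits O N) := ⟨⟨1, by simp⟩⟩
  have hcard : unitCount O N ≠ 0 := Nat.card_ne_zero.2 ⟨inferInstance, inferInstance⟩
  refine ⟨hcard, ?_⟩
  have h7 := h3.prod_fiberwise (g := fun 𝔞 => (unitCount O N : ℂ) * (idealNorm O 𝔞.1.1 : ℂ) ^ (-s))
    (fun 𝔞 => by
      have := Fintype.ofFinite (CongrUnits O N)
      convert! hasSum_fintype (fun _ : CongrUnits O N => (idealNorm O 𝔞.1.1 : ℂ) ^ (-s)) using 1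
      rw [Finset.sum_const, nsmul_eq_mul, Finset.card_univ, ← Nat.card_eq_fintype_card]
      rfl)
  have hc : (unitCount O N : ℂ) ≠ 0 := by exact_mod_cast hcard
  rw [mul_assoc]
  refine (h7.mul_left (unitCount O N : ℂ)⁻¹).congr_fun fun 𝔞 => ?_
  rw [inv_mul_cancel_left₀ hc]

end ClassSeries

/-! ### Finiteness of the ray class group. -/

section Finiteness

open FractionalIdeal

variable {K : Type*} [Field K] [NumberField K] [Algebra.IsQuadraticExtension ℚ K]
  [NumberField.IsTotallyComplex K]
  (O : Subring K) [Module.Finite ℤ O] [IsFractionRing O K] {N : ℕ}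

/-- Pigeonhole: with n = |O/𝔠| and k = ⌊√n⌋, the (k + 1)² > n combinations of a basis of O with
coefficients in [0, k] cannot all be distinct mod 𝔠. The difference of two congruent ones has size
at most k(|ξ₁| + |ξ₂|), and k² ≤ n. -/
theorem exists_small_element (φ : K →+* ℂ) : ∃ B : ℕ, ∀ 𝔠 : Ideal O, 𝔠 ≠ ⊥ →
    ∃ y ∈ 𝔠, y ≠ 0 ∧ idealNorm O (Ideal.span {y}) ≤ B * idealNorm O 𝔠 := by
  obtain ⟨b⟩ := exists_orientedBasis_order O φ
  refine ⟨⌈(‖φ b.ξ₁‖ + ‖φ b.ξ₂‖) ^ 2⌉₊, fun 𝔠 h𝔠 => ?_⟩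
  have hpos := idealNorm_pos O φ h𝔠
  have hfin : Finite (O ⧸ 𝔠) := Nat.finite_of_card_ne_zero hpos.ne'
  have := Fintype.ofFinite (O ⧸ 𝔠)
  set n := idealNorm O 𝔠 with hn
  let k := n.sqrt
  let f : Fin (k + 1) × Fin (k + 1) → O := fun p =>
    (p.1 : ℕ) • (⟨b.ξ₁, b.ξ₁_mem⟩ : O) + (p.2 : ℕ) • (⟨b.ξ₂, b.ξ₂_mem⟩ : O)
  have hcard : Fintype.card (O ⧸ 𝔠) < Fintype.card (Fin (k + 1) × Fin (k + 1)) := by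
    rw [Fintype.card_prod, Fintype.card_fin, ← Nat.card_eq_fintype_card]
    exact Nat.lt_succ_sqrt n
  obtain ⟨p, q, hpq, he⟩ := Fintype.exists_ne_map_eq_of_card_lt
    (fun p => Ideal.Quotient.mk 𝔠 (f p)) hcard
  have hy : ((f p - f q : O) : K) = ((p.1 - q.1 : ℤ) : K) * b.ξ₁ + ((p.2 - q.2 : ℤ) : K) * b.ξ₂ := by
    simp only [f]
    push_cast [nsmul_eq_mul]
    ring
  have hy0 : f p - f q ≠ 0 := by
    intro h
    rw [h] at hy
    obtain ⟨h1, h2⟩ := b.coord_eq_zero hy.symm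
    exact hpq (Prod.ext (Fin.ext (by omega)) (Fin.ext (by omega)))
  refine ⟨f p - f q, Ideal.Quotient.eq.1 he, hy0, ?_⟩
  have hb : ∀ i j : Fin (k + 1), ‖((i - j : ℤ) : ℂ)‖ ≤ k := fun i j => by
    rw [Complex.norm_intCast]
    have : |((i : ℕ) - (j : ℕ) : ℤ)| ≤ k := abs_le.2 ⟨by omega, by omega⟩
    exact_mod_cast this
  have h1 : ‖φ ((f p - f q : O) : K)‖ ≤ k * (‖φ b.ξ₁‖ + ‖φ b.ξ₂‖) := by
    rw [hy, map_add, map_mul, map_mul, map_intCast, map_intCast, mul_add]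
    refine (norm_add_le _ _).trans (add_le_add ?_ ?_) <;>
    · rw [norm_mul]
      exact mul_le_mul_of_nonneg_right (hb _ _) (norm_nonneg _)
  have h2 : (idealNorm O (Ideal.span {f p - f q}) : ℝ) ≤
      ⌈(‖φ b.ξ₁‖ + ‖φ b.ξ₂‖) ^ 2⌉₊ * n := by
    rw [idealNorm_span_singleton O φ hy0]
    have hk : (k : ℝ) ^ 2 ≤ n := by exact_mod_cast Nat.sqrt_le' n
    calc _ ≤ (k * (‖φ b.ξ₁‖ + ‖φ b.ξ₂‖)) ^ 2 := by gcongr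
      _ = (‖φ b.ξ₁‖ + ‖φ b.ξ₂‖) ^ 2 * k ^ 2 := by ring
      _ ≤ _ := by
        gcongr
        exact Nat.le_ceil _
  exact_mod_cast h2

/-- Every nonzero ideal is equivalent to an integral ideal containing a fixed integer. -/
theorem exists_equivalent_ideal (φ : K →+* ℂ) : ∃ M : ℕ, M ≠ 0 ∧ ∀ 𝔠 : Ideal O, 𝔠 ≠ ⊥ →
    ∃ (z : K) (𝔟 : Ideal O), z ≠ 0 ∧ (M : O) ∈ 𝔟 ∧
      (𝔟 : FractionalIdeal O⁰ K) = spanSingleton O⁰ z * 𝔠 := by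
  obtain ⟨B, hB⟩ := exists_small_element O φ
  -- For a small y ∈ 𝔠, the index of yO in 𝔠 is at most B, so B! kills 𝔠/yO. Hence 𝔟 = (B!/y)𝔠 is
  -- integral, and it contains B! because y ∈ 𝔠.
  refine ⟨B.factorial, Nat.factorial_ne_zero B, fun 𝔠 h𝔠 => ?_⟩
  obtain ⟨y, hy, hy0, hle⟩ := hB 𝔠 h𝔠
  have hyK : (y : K) ≠ 0 := fun h => hy0 (Subtype.ext h)
  have hsub : (Ideal.span {y}).toAddSubgroup ≤ 𝔠.toAddSubgroup :=
    (Ideal.span_singleton_le_iff_mem 𝔠).2 hy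
  have hindex := AddSubgroup.relIndex_mul_index hsub
  set r := (Ideal.span {y}).toAddSubgroup.relIndex 𝔠.toAddSubgroup with hr
  have hr1 : r * idealNorm O 𝔠 = idealNorm O (Ideal.span {y}) := hindex
  have hpos := idealNorm_pos O φ h𝔠
  have hpos' := idealNorm_pos O φ (𝔠 := Ideal.span {y}) (by simpa using hy0)
  have hrB : r ≤ B := Nat.le_of_mul_le_mul_right (hr1.trans_le hle) hpos
  have hr0 : 0 < r := Nat.pos_of_ne_zero fun h => by
    rw [h, zero_mul] at hr1
    exact hpos'.ne hr1
  have hmul : ∀ c ∈ 𝔠, ∃ w : O, (B.factorial : O) * c = w * y := by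
    intro c hc
    have h1 : r • (⟨c, hc⟩ : 𝔠.toAddSubgroup) ∈
        (Ideal.span {y}).toAddSubgroup.addSubgroupOf 𝔠.toAddSubgroup :=
      AddSubgroup.nsmul_index_mem _ _
    have h2 : r • c ∈ Ideal.span {y} := h1
    obtain ⟨t, ht⟩ := Nat.dvd_factorial hr0 hrB
    obtain ⟨w, hw⟩ := Ideal.mem_span_singleton'.1 h2
    refine ⟨t * w, ?_⟩
    rw [mul_assoc, hw, ht, nsmul_eq_mul]
    push_cast
    ring
  have hJ : spanSingleton O⁰ ((B.factorial : K) / y) * (𝔠 : FractionalIdeal O⁰ K) ≤ 1 := by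
    rw [spanSingleton_mul_le_iff]
    intro c' hc'
    obtain ⟨c, hc, rfl⟩ := (mem_coeIdeal O⁰).1 hc'
    obtain ⟨w, hw⟩ := hmul c hc
    have hwK : (B.factorial : K) * c = w * y := by exact_mod_cast congrArg (Subtype.val : O → K) hw
    rw [mem_one_iff_mem]
    have : (B.factorial : K) / y * algebraMap O K c = w := by
      change (B.factorial : K) / y * (c : K) = w
      field_simp
      rw [hwK, mul_comm]
    rw [this]
    exact w.2
  obtain ⟨𝔟, h𝔟⟩ := le_one_iff_exists_coeIdeal.1 hJ
  refine ⟨(B.factorial : K) / y, 𝔟, div_ne_zero (by exact_mod_cast Nat.factorial_ne_zero B) hyK, ?_, h𝔟⟩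
  have : ((B.factorial : O) : K) ∈ (𝔟 : FractionalIdeal O⁰ K) := by
    rw [h𝔟, mem_singleton_mul]
    refine ⟨y, (mem_coeIdeal O⁰).2 ⟨y, hy, rfl⟩, ?_⟩
    push_cast
    field_simp
  obtain ⟨z, hz, e⟩ := (mem_coeIdeal O⁰).1 this
  have : z = (B.factorial : O) := Subtype.ext e
  exact this ▸ hz

theorem finite_ideals_containing (φ : K →+* ℂ) {M : ℕ} (hM : M ≠ 0) :
    {𝔟 : Ideal O | (M : O) ∈ 𝔟}.Finite := by
  have hMK : (M : K) ≠ 0 := by exact_mod_cast hM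
  have hM0 : (M : O) ≠ 0 := fun h => hMK (by
    have := congrArg (Subtype.val : O → K) h
    simpa using this)
  have : Finite (O ⧸ Ideal.span {(M : O)}) :=
    Nat.finite_of_card_ne_zero (idealNorm_pos O φ (by simpa using hM0)).ne'
  have : Finite (Ideal (O ⧸ Ideal.span {(M : O)})) := Finite.of_injective _ SetLike.coe_injective
  refine (Set.finite_range (Ideal.comap (Ideal.Quotient.mk (Ideal.span {(M : O)})))).subset ?_
  intro 𝔟 h𝔟
  refine ⟨𝔟.map (Ideal.Quotient.mk _), ?_⟩
  rw [Ideal.comap_map_of_surjective _ Ideal.Quotient.mk_surjective, ← RingHom.ker_eq_comap_bot,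
    Ideal.mk_ker, sup_eq_left]
  exact (Ideal.span_singleton_le_iff_mem 𝔟).2 h𝔟

omit [NumberField.IsTotallyComplex K] in
-- Since w/z = 1 + N(y/z) with y/z in the inverse of z𝔠, the passage from z𝔠 to w𝔠 is a case of
-- `exists_scaled`.
theorem rayClass_eq_of_scaled {𝔠 𝔞 𝔟 : properIdeals O N} {z w : K} (hz : z ≠ 0) (hw : w ≠ 0)
    (h𝔞 : (toUnit O 𝔞 : FractionalIdeal O⁰ K) = spanSingleton O⁰ z * toUnit O 𝔠)
    (h𝔟 : (toUnit O 𝔟 : FractionalIdeal O⁰ K) = spanSingleton O⁰ w * toUnit O 𝔠)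
    {y : K} (hy : y ∈ invLattice O 𝔠) (hzw : w = z + N * y) : rayClass O 𝔞 = rayClass O 𝔟 := by
  have hmem : w / z ∈ congrSet O 𝔞 := by
    refine ⟨div_ne_zero hw hz, y / z, ?_, by rw [hzw]; field_simp⟩
    rw [mem_invLattice]
    intro c hc
    have : (c : K) ∈ (toUnit O 𝔞 : FractionalIdeal O⁰ K) := (mem_toUnit O).2 ⟨c, hc, rfl⟩
    rw [h𝔞, mem_singleton_mul] at this
    obtain ⟨c', hc', e⟩ := this
    obtain ⟨c', hc'', rfl⟩ := (mem_toUnit O).1 hc'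
    rw [e]
    have : y / z * (z * c') = y * c' := by field_simp
    rw [this]
    exact (mem_invLattice O).1 hy c' hc''
  obtain ⟨𝔡, h1, h2⟩ := exists_scaled O hmem
  rw [h𝔞, ← mul_assoc, spanSingleton_mul_spanSingleton, div_mul_cancel₀ _ hz, ← h𝔟] at h2
  rw [← toUnit_injective O (Units.ext h2), h1]

/-- A class is determined by finitely many data. First, an equivalent integral ideal 𝔟 containing a
fixed integer M. Then, for fixed 𝔟, representatives differ by a multiplier in 𝔠⁻¹ for one fixed 𝔠,
and its coordinates modulo N determine the class. -/
theorem finite_rayClassGroup (hN : N ≠ 0) (φ : K →+* ℂ) : Finite (RayClassGroup O N) := by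
  have : NeZero N := ⟨hN⟩
  obtain ⟨M, hM, hM'⟩ := exists_equivalent_ideal O φ
  choose r hr using rayClass_surjective O (N := N)
  choose z 𝔟 hz hMb h𝔟 using fun C => hM' (r C).1 (r C).2.1
  rw [← Set.finite_univ_iff]
  refine Set.Finite.of_finite_fibers 𝔟 ((finite_ideals_containing O φ hM).subset ?_) ?_
  · rintro _ ⟨C, -, rfl⟩
    exact hMb C
  rintro _ ⟨C₀, -, rfl⟩
  rw [Set.univ_inter]
  obtain ⟨b⟩ := nonempty_orientedBasis_invLattice O φ (r C₀)
  have hsc : ∀ C, 𝔟 C = 𝔟 C₀ → (toUnit O (r C) : FractionalIdeal O⁰ K) =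
      spanSingleton O⁰ (z C₀ / z C) * toUnit O (r C₀) := by
    intro C hC
    have h1 : spanSingleton O⁰ (z C) * (toUnit O (r C) : FractionalIdeal O⁰ K) =
        spanSingleton O⁰ (z C₀) * toUnit O (r C₀) := by
      rw [coe_toUnit, coe_toUnit, ← h𝔟, ← h𝔟, hC]
    have h2 : spanSingleton O⁰ (z C₀ / z C) =
        spanSingleton O⁰ (z C)⁻¹ * spanSingleton O⁰ (z C₀) := by
      rw [spanSingleton_mul_spanSingleton, div_eq_inv_mul]
    rw [h2, mul_assoc, ← h1, ← mul_assoc, spanSingleton_mul_spanSingleton,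
      inv_mul_cancel₀ (hz C), spanSingleton_one, one_mul]
  have hco : ∀ C, ∃ m n : ℤ, 𝔟 C = 𝔟 C₀ → z C₀ / z C = m * b.ξ₁ + n * b.ξ₂ := by
    intro C
    by_cases hC : 𝔟 C = 𝔟 C₀
    · have : z C₀ / z C ∈ invLattice O (r C₀) := by
        rw [mem_invLattice]
        intro c hc
        refine (mem_one_iff_mem O).1 (toUnit_le_one O (r C) ?_)
        rw [hsc C hC]
        exact mul_mem_mul (mem_spanSingleton_self _ _) ((mem_toUnit O).2 ⟨c, hc, rfl⟩)
      obtain ⟨m, n, e⟩ := (b.mem_iff _).1 this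
      exact ⟨m, n, fun _ => e⟩
    · exact ⟨0, 0, fun h => absurd h hC⟩
  choose m n hmn using hco
  refine Set.Finite.of_injOn (f := fun C => ((m C : ZMod N), (n C : ZMod N))) (t := Set.univ)
    (Set.mapsTo_univ _ _) ?_ Set.finite_univ
  intro C hC C' hC' h
  obtain ⟨h1, h2⟩ := Prod.ext_iff.1 h
  obtain ⟨k, hk⟩ := (ZMod.intCast_eq_intCast_iff_dvd_sub _ _ _).1 h1
  obtain ⟨l, hl⟩ := (ZMod.intCast_eq_intCast_iff_dvd_sub _ _ _).1 h2
  rw [← hr C, ← hr C']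
  refine rayClass_eq_of_scaled O (div_ne_zero (hz C₀) (hz C)) (div_ne_zero (hz C₀) (hz C'))
    (hsc C hC) (hsc C' hC') (y := k * b.ξ₁ + l * b.ξ₂) ((b.mem_iff _).2 ⟨k, l, rfl⟩) ?_
  rw [hmn C hC, hmn C' hC']
  have hk' : (m C' : K) - m C = N * k := by exact_mod_cast congrArg (Int.cast : ℤ → K) hk
  have hl' : (n C' : K) - n C = N * l := by exact_mod_cast congrArg (Int.cast : ℤ → K) hl
  linear_combination b.ξ₁ * hk' + b.ξ₂ * hl'

end Finiteness

end QuadraticOrder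

end

/-! ### The invariants and the L-function. -/

section

open scoped nonZeroDivisors MatrixGroups

namespace QuadraticOrder

section LFunction

variable {K : Type*} [Field K] [NumberField K] [Algebra.IsQuadraticExtension ℚ K]
  [NumberField.IsTotallyComplex K] (φ : K →+* ℂ)
  (O : Subring K) [Module.Finite ℤ O] [IsFractionRing O K] {N : ℕ}

/-- The defining predicate is satisfied by some value, so the chosen value comes from an actual
ideal and basis. The partial zeta function is then computed from those same data, and independence
of the choices is never needed. -/
theorem gInvariant_spec_one (C : RayClassGroup O 1) :
    IsDeltaValue φ O 1 C (gInvariant φ O 1 C) := by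
  obtain ⟨𝔠, h𝔠⟩ := rayClass_surjective O C
  obtain ⟨b⟩ := nonempty_orientedBasis_invLattice O φ 𝔠
  have h := Classical.epsilon_spec (p := fun x => if 1 = 1 then IsDeltaValue φ O 1 C x
    else IsInvariantValue φ O 1 (fun τ => siegel 0 (1 / (1 : ℕ)) τ ^ (12 * 1)) C x)
    ⟨_, (if_pos rfl).mpr ⟨𝔠, b, h𝔠, rfl⟩⟩
  exact (if_pos rfl).mp h

theorem gInvariant_spec (hN : N ≠ 0) (hN1 : N ≠ 1) (C : RayClassGroup O N) :
    IsInvariantValue φ O N (fun τ => siegel 0 (1 / N) τ ^ (12 * N)) C (gInvariant φ O N C) := by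
  obtain ⟨𝔠, h𝔠⟩ := rayClass_surjective O C
  obtain ⟨b⟩ := nonempty_orientedBasis_invLattice O φ 𝔠
  obtain ⟨τ, hτ⟩ := exists_isTau O φ
  obtain ⟨m, n, h1⟩ := (b.mem_iff τ).1
    (mem_invLattice_of_mem O 𝔠 ((hτ.1 τ).2 ⟨1, 0, by simp⟩))
  obtain ⟨p, q, h2⟩ := (b.mem_iff 1).1 (one_mem_invLattice O 𝔠)
  have h1' : τ = (!![m, n; p, q] 0 0 : ℤ) * b.ξ₁ + (!![m, n; p, q] 0 1 : ℤ) * b.ξ₂ := h1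
  have h2' : 1 = (!![m, n; p, q] 1 0 : ℤ) * b.ξ₁ + (!![m, n; p, q] 1 1 : ℤ) * b.ξ₂ := h2
  -- The action of A is defined only because its determinant is prime to N.
  obtain ⟨h, hh⟩ := exists_isConjugate hN (isCoprime_det O b hτ h1' h2')
  have h := Classical.epsilon_spec (p := fun x => if N = 1 then IsDeltaValue φ O N C x
    else IsInvariantValue φ O N (fun τ => siegel 0 (1 / N) τ ^ (12 * N)) C x)
    ⟨_, (if_neg hN1).mpr ⟨𝔠, b, τ, _, h, h𝔠, hτ, h1', h2', hh, rfl⟩⟩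
  exact (if_neg hN1).mp h

omit [NumberField K] [Algebra.IsQuadraticExtension ℚ K] [NumberField.IsTotallyComplex K] in
theorem log_norm_Δ {L : Set K} (b : OrientedBasis φ L) {n : ℕ} (hn : 0 < n) :
    Real.log ‖(2 * Real.pi : ℂ) ^ 12 * ((n : ℂ)⁻¹) ^ 6 * (‖b.Δ‖ : ℂ)‖ =
      Real.log ((2 * Real.pi) ^ 12 * ‖ModularForm.discriminant b.ξ‖) -
        6 * Real.log (n * ‖φ b.ξ₂‖ ^ 2) := by
  have hpi := Real.pi_pos
  have hn' : (0 : ℝ) < n := by exact_mod_cast hn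
  have hξ : 0 < ‖φ b.ξ₂‖ := norm_pos_iff.2 b.map_ξ₂_ne_zero
  have hΔ : 0 < ‖ModularForm.discriminant b.ξ‖ :=
    norm_pos_iff.2 (ModularForm.discriminant_ne_zero b.ξ)
  have h1 : ‖(2 * Real.pi : ℂ) ^ 12 * ((n : ℂ)⁻¹) ^ 6 * (‖b.Δ‖ : ℂ)‖ =
      ((2 * Real.pi) ^ 12 * ‖ModularForm.discriminant b.ξ‖) / (n * ‖φ b.ξ₂‖ ^ 2) ^ 6 := by
    rw [OrientedBasis.Δ]
    simp only [norm_mul, norm_pow, norm_inv, Complex.norm_real, Complex.norm_natCast,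
      Real.norm_eq_abs, abs_of_pos hpi, Complex.norm_ofNat, abs_norm]
    field_simp
  rw [h1, Real.log_div (by positivity) (by positivity), Real.log_pow]
  norm_num

/-- Differentiating κ⁻ˢE(s) at 0 gives E'(0) - E(0) log κ, into which the limit formulas are
substituted. -/
theorem exists_partialZeta (hN : N ≠ 0) (C : RayClassGroup O N) :
    ∃ Z : ℂ → ℂ, DifferentiableOn ℂ Z {1}ᶜ ∧
      (∀ s : ℂ, 1 < s.re → HasSum (fun 𝔞 : {𝔞 : properIdeals O N // rayClass O 𝔞 = C} =>
        (idealNorm O 𝔞.1.1 : ℂ) ^ (-s)) (Z s)) ∧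
      HasDerivAt Z (-(1 / ((unitCount O N : ℂ) * 6 * N)) *
        (Real.log ‖gInvariant φ O N C‖ : ℂ)) 0 := by
  have hNR : (0 : ℝ) < N := by positivity
  have hNC : (N : ℂ) ≠ 0 := by exact_mod_cast hN
  -- the general shape of the partial zeta function
  have main : ∀ (𝔠 : properIdeals O N) (b : OrientedBasis φ (invLattice O 𝔠)) (d : ℤ) (v : ℝ)
      (y : K) (e : ℂ), rayClass O 𝔠 = C → N * v = d → y ∈ invLattice O 𝔠 →
      1 = N * y + d * b.ξ₂ → HasDerivAt (epsteinZeta b.ξ v) e 0 →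
      (unitCount O N ≠ 0 → -(1 / ((unitCount O N : ℂ) * 6 * N)) *
        (Real.log ‖gInvariant φ O N C‖ : ℂ) = (unitCount O N : ℂ)⁻¹ *
          (e - Real.log (idealNorm O 𝔠.1 * (N * ‖φ b.ξ₂‖) ^ 2) * epsteinZeta b.ξ v 0)) →
      ∃ Z : ℂ → ℂ, DifferentiableOn ℂ Z {1}ᶜ ∧
        (∀ s : ℂ, 1 < s.re → HasSum (fun 𝔞 : {𝔞 : properIdeals O N // rayClass O 𝔞 = C} =>
          (idealNorm O 𝔞.1.1 : ℂ) ^ (-s)) (Z s)) ∧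
        HasDerivAt Z (-(1 / ((unitCount O N : ℂ) * 6 * N)) *
          (Real.log ‖gInvariant φ O N C‖ : ℂ)) 0 := by
    rintro 𝔠 b d v y e rfl hv hy h1 hE he
    have hκ : 0 < (idealNorm O 𝔠.1 : ℝ) * (N * ‖φ b.ξ₂‖) ^ 2 := by
      have h2 : (0 : ℝ) < idealNorm O 𝔠.1 := by exact_mod_cast idealNorm_pos O φ 𝔠.2.1
      have h3 : 0 < ‖φ b.ξ₂‖ := norm_pos_iff.2 b.map_ξ₂_ne_zero
      positivity
    set κ : ℝ := idealNorm O 𝔠.1 * (N * ‖φ b.ξ₂‖) ^ 2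
    have hκ' : (κ : ℂ) ≠ 0 := by exact_mod_cast hκ.ne'
    have hsum := fun (s : ℂ) (hs : 1 < s.re) => hasSum_rayClass O hN b hv hy h1 hs
    have hu : unitCount O N ≠ 0 := (hsum 2 (by norm_num)).1
    have hpow : ∀ s : ℂ, HasDerivAt (fun s : ℂ => (κ : ℂ) ^ (-s))
        ((κ : ℂ) ^ (-s) * Complex.log κ * -1) s := fun s =>
      (hasDerivAt_neg s).const_cpow (Or.inl hκ')
    refine ⟨_, ?_, fun s hs => (hsum s hs).2, ?_⟩
    · intro s hs
      exact ((((hpow s).differentiableAt).const_mul _).mul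
        (differentiableAt_epsteinZeta b.ξ v hs)).differentiableWithinAt
    · convert! (((hpow 0).const_mul (unitCount O N : ℂ)⁻¹).mul hE) using 1
      rw [he hu, neg_zero, Complex.cpow_zero, ← Complex.ofReal_log hκ.le]
      ring
  rcases eq_or_ne N 1 with rfl | hN1
  · obtain ⟨𝔠, b, h𝔠, hg⟩ := gInvariant_spec_one φ O C
    refine main 𝔠 b 0 0 1 _ h𝔠 (by simp) (one_mem_invLattice O 𝔠) (by simp)
      (hasDerivAt_epsteinZeta_zero_zero b.ξ) fun hu => ?_
    -- For N = 1 one has E(0) = -1, so log κ survives; it supplies the factors N(𝔠)⁻⁶ and |ξ₂|⁻¹²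
    -- that make the discriminant that of the lattice 𝔠⁻¹.
    rw [hg, log_norm_Δ φ b (idealNorm_pos O φ 𝔠.2.1), epsteinZeta_zero_zero]
    have hu' : (unitCount O 1 : ℂ) ≠ 0 := by exact_mod_cast hu
    push_cast
    rw [one_mul]
    field_simp
    ring
  · obtain ⟨𝔠, b, τ, A, h, h𝔠, hτ, h1, h2, hh, hg⟩ := gInvariant_spec φ O hN hN1 C
    obtain ⟨d, γ, hA, hval⟩ := hh.exists_eq hN
    have hcop := isCoprime_det O b hτ h1 h2
    have row : ∀ j, ∃ k : ℤ, A 1 j = d * γ 1 j + N * k := by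
      intro j
      have := congrFun (congrFun hA 1) j
      simp only [Matrix.map_apply, Matrix.mul_apply, Fin.sum_univ_two] at this
      have h' : ((A 1 j : ℤ) : ZMod N) = ((d * γ 1 j : ℤ) : ZMod N) := by simpa using this
      obtain ⟨k, hk⟩ := (ZMod.intCast_eq_intCast_iff_dvd_sub _ _ _).1 h'.symm
      exact ⟨k, by linarith⟩
    obtain ⟨k, hk⟩ := row 0
    obtain ⟨l, hl⟩ := row 1
    -- Otherwise the second row of A would vanish modulo N, contradicting that det A is prime to N >
    -- 1. Hence d/N is not an integer and the second limit formula applies.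
    have hd : ¬ (N : ℤ) ∣ d := by
      intro hd
      have h3 : (N : ℤ) ∣ A 1 0 := hk ▸ dvd_add (hd.mul_right _) (dvd_mul_right _ _)
      have h4 : (N : ℤ) ∣ A 1 1 := hl ▸ dvd_add (hd.mul_right _) (dvd_mul_right _ _)
      have h5 : (N : ℤ) ∣ A.det := by
        rw [Matrix.det_fin_two]
        exact dvd_sub (h4.mul_left _) (h3.mul_left _)
      have h6 := hcop.symm.isUnit_of_dvd h5
      rw [Int.isUnit_iff] at h6
      omega
    have hv : (((d / N : ℚ) : ℝ) : UnitAddCircle) ≠ 0 := by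
      intro h0
      obtain ⟨n, hn⟩ := (AddCircle.coe_eq_zero_iff 1).1 h0
      refine hd ⟨n, ?_⟩
      push_cast at hn
      rw [zsmul_eq_mul, mul_one, eq_div_iff hNR.ne'] at hn
      have : n * (N : ℤ) = d := by exact_mod_cast hn
      rw [← this, mul_comm]
    -- The second row of A expresses 1 in the basis ξ₁, ξ₂ and is congruent to d times the second
    -- row of γ. So 1 is d times the second vector of the γ-transformed basis modulo N𝔠⁻¹, and that
    -- basis has quotient γξ, where the conjugate function is evaluated.
    refine main 𝔠 (b.smulSL γ) d ((d / N : ℚ) : ℝ) (k * b.ξ₁ + l * b.ξ₂) _ h𝔠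
      (by push_cast; field_simp) ((b.mem_iff _).2 ⟨k, l, rfl⟩) ?_
      (hasDerivAt_epsteinZeta_of_ne _ hv) fun hu => ?_
    · have hk' := congrArg (Int.cast : ℤ → K) hk
      have hl' := congrArg (Int.cast : ℤ → K) hl
      push_cast at hk' hl'
      change (1 : K) = N * (k * b.ξ₁ + l * b.ξ₂) + d * (γ 1 0 * b.ξ₁ + γ 1 1 * b.ξ₂)
      linear_combination h2 + b.ξ₁ * hk' + b.ξ₂ * hl'
    · have hu' : (unitCount O N : ℂ) ≠ 0 := by exact_mod_cast hu
      -- Here E(0) = 0, so κ plays no role; the exponent 12N accounts for the constant 6N against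
      -- the factor 2 in the limit formula.
      rw [epsteinZeta_zero_of_ne _ hv, hg, hval, siegelPow, norm_pow, Real.log_pow, b.smulSL_ξ]
      push_cast
      field_simp
      ring

end LFunction

theorem hasSum_lTerm {K : Type*} [Field K] [NumberField K] [Algebra.IsQuadraticExtension ℚ K]
    {O : Subring K} [Module.Finite ℤ O] [IsFractionRing O K] {N : ℕ}
    [Fintype (RayClassGroup O N)] (χ : RayClassGroup O N →* ℂˣ) {Z : RayClassGroup O N → ℂ} {s : ℂ}
    (hZ : ∀ C, HasSum (fun 𝔞 : {𝔞 : properIdeals O N // rayClass O 𝔞 = C} =>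
      (idealNorm O 𝔞.1.1 : ℂ) ^ (-s)) (Z C)) :
    HasSum (lTerm O χ s) (∑ C, (χ C : ℂ) * Z C) := by
  have h1 : ∀ C ∈ Finset.univ, HasSum (Set.indicator {𝔞 : properIdeals O N | rayClass O 𝔞 = C}
      (lTerm O χ s)) ((χ C : ℂ) * Z C) := fun C _ => by
    rw [← hasSum_subtype_iff_indicator]
    refine ((hZ C).mul_left (χ C : ℂ)).congr_fun fun 𝔞 => ?_
    have h𝔞 : rayClass O 𝔞.1 = C := 𝔞.2
    rw [Function.comp, lTerm, h𝔞]
  refine (hasSum_sum h1).congr_fun fun 𝔞 => ?_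
  classical
  simp [Set.indicator_apply]

end QuadraticOrder

end

theorem theoremF {K : Type*} [Field K] [NumberField K] [Algebra.IsQuadraticExtension ℚ K]
    [NumberField.IsTotallyComplex K] (φ : K →+* ℂ)
    (O : Subring K) [Module.Finite ℤ O] [IsFractionRing O K]
    (N : ℕ) (hN : 0 < N)
    (χ : QuadraticOrder.RayClassGroup O N →* ℂˣ) :
    Finite (QuadraticOrder.RayClassGroup O N) ∧
    ∃ L : ℂ → ℂ, DifferentiableOn ℂ L {1}ᶜ ∧
      (∀ s : ℂ, 1 < s.re → HasSum (QuadraticOrder.lTerm O χ s) (L s)) ∧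
      deriv L 0 =
        -(1 / ((QuadraticOrder.unitCount O N : ℂ) * 6 * N)) *
          ∑ᶠ C : QuadraticOrder.RayClassGroup O N,
            (χ C : ℂ) * (Real.log ‖QuadraticOrder.gInvariant φ O N C‖ : ℂ) := by
  have hfin := QuadraticOrder.finite_rayClassGroup O hN.ne' φ
  refine ⟨hfin, ?_⟩
  have := Fintype.ofFinite (QuadraticOrder.RayClassGroup O N)
  choose Z hdiff hsum hderiv using QuadraticOrder.exists_partialZeta φ O hN.ne'
  refine ⟨fun s => ∑ C, (χ C : ℂ) * Z C s, ?_,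
    fun s hs => QuadraticOrder.hasSum_lTerm χ fun C => hsum C s hs, ?_⟩
  · exact DifferentiableOn.fun_sum fun C _ => (hdiff C).const_mul _
  · rw [(HasDerivAt.fun_sum fun C _ => (hderiv C).const_mul (χ C : ℂ)).deriv,
      finsum_eq_sum_of_fintype, Finset.mul_sum]
    exact Finset.sum_congr rfl fun C _ => mul_left_comm _ _ _
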